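/- Let $N,M\ge1$ be integers and let $A=(A_{i,j})_{1\le i,j\le N}$, with blocks $A_{i,j}\in\mathbf{R}^{M\times M}$, be a random block tridiagonal matrix sampled according to the probability density $a\mapsto Z^{-1}e^{-\frac M4\operatorname{tr}a^*a}$ with respect to Lebesgue measure on the space of block matrices $a\in(\mathbf{R}^{M\times M})^{N\times N}$ with $a^*=a$ and $a_{i,j}=0$ for $|i-j|>1$. For real $\lambda$ define, almost surely, $$D_1=A_{1,1}-\lambda,\qquad B_k=-A_{k,k+1},\qquad D_{k+1}=A_{k+1,k+1}-\lambda-B_k^*D_k^{-1}B_k\qquad(1\le k<N),$$ and let $S_k=\|D_k\|$ (operator norm) and $\bar D_k=\|D_k\|^{-1}D_k$. Write $\mathbf V(\,\cdot\mid\cdot\,)$ for conditional variance. For every $\varepsilon>0$ there are constants $C_\varepsilon>1>c_\varepsilon>0$, depending only on $\varepsilon$, such that for all real $\lambda$ and all integers $N$, $M$ with $|\lambda|<\varepsilon^{-1}$ and $M\ge C_\varepsilon$, and for every $k$ with $1<k<N$: (i) with probability at least $1-M^{-c_\varepsilon}$, $$\mathbf V\big(\log S_k\,\big|\,D_{k-1},\bar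 D_k,D_{k+1},B_{k-1},B_k\big)\ge M^{-3-\varepsilon};$$ (ii) $\mathbf E\big(\mathbf V(\log S_k\mid D_{k-1},\bar D_k,D_{k+1},B_{k-1},B_k)\big)\ge M^{-3-\varepsilon}$. In other words, if $N\ge3$, then $$\min_{1<k<N}\mathbf E\big(\mathbf V(\log S_k\mid D_{k-1},\bar D_k,D_{k+1},B_{k-1},B_k)\big)\ge M^{-3-\varepsilon}.$$ -/

import Mathlib

open MeasureTheory ProbabilityTheory

noncomputable section

namespace BandMatrix

/-- A vector of entries, indexed by pairs of (block index, index inside the block), read as an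
`NM × NM` matrix. The Euclidean norm of the vector is the Frobenius norm of the matrix. -/
def toMat {N M : ℕ} (a : EuclideanSpace ℝ ((Fin N × Fin M) × (Fin N × Fin M))) :
    Matrix (Fin N × Fin M) (Fin N × Fin M) ℝ :=
  Matrix.of fun u v => a (u, v)

/-- The real vector space of block matrices `a ∈ (ℝ^{M × M})^{N × N}` with `a* = a` and
`a_{i,j} = 0` for `|i - j| > 1`. -/
def blockTridiag (N M : ℕ) :
    Submodule ℝ (EuclideanSpace ℝ ((Fin N × Fin M) × (Fin N × Fin M))) where
  carrier := {a | (toMat a).transpose = toMat a ∧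
    ∀ (i j : Fin N) (p q : Fin M), 1 < |(i : ℤ) - (j : ℤ)| → toMat a (i, p) (j, q) = 0}
  add_mem' := by
    rintro a b ⟨ha, ha'⟩ ⟨hb, hb'⟩
    refine ⟨?_, fun i j p q h => ?_⟩
    · ext u v
      have h1 := congrFun (congrFun ha u) v
      have h2 := congrFun (congrFun hb u) v
      simp only [toMat, Matrix.transpose_apply, Matrix.of_apply, PiLp.add_apply] at h1 h2 ⊢
      rw [h1, h2]
    · have h1 := ha' i j p q h
      have h2 := hb' i j p q h
      simp only [toMat, Matrix.of_apply, PiLp.add_apply] at h1 h2 ⊢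
      rw [h1, h2, add_zero]
  zero_mem' := by
    refine ⟨?_, fun i j p q _ => ?_⟩
    · ext u v
      simp [toMat]
    · simp [toMat]
  smul_mem' := by
    rintro c a ⟨ha, ha'⟩
    refine ⟨?_, fun i j p q h => ?_⟩
    · ext u v
      have h1 := congrFun (congrFun ha u) v
      simp only [toMat, Matrix.transpose_apply, Matrix.of_apply, PiLp.smul_apply] at h1 ⊢
      rw [h1]
    · have h1 := ha' i j p q h
      simp only [toMat, Matrix.of_apply, PiLp.smul_apply] at h1 ⊢
      rw [h1, smul_zero]

/-- The unnormalized density `exp (- (M / 4) tr a* a)`. -/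
def weight (N M : ℕ) (a : blockTridiag N M) : ℝ :=
  Real.exp (-((M : ℝ) / 4) * ((toMat a.1).transpose * toMat a.1).trace)

/-- The law with density `Z⁻¹ exp (- (M / 4) tr a* a)`, `Z = ∫ exp (- (M / 4) tr a* a) da`, with
respect to Lebesgue measure on the space of symmetric block tridiagonal matrices. -/
def law (N M : ℕ) : Measure (blockTridiag N M) :=
  (volume : Measure (blockTridiag N M)).withDensity fun a =>
    ENNReal.ofReal ((∫ b : blockTridiag N M, weight N M b)⁻¹ * weight N M a)

/-- The block `a_{i,j}`, for `1 ≤ i, j ≤ N` (and `0` for other indices). Blocks are numbered from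
`1` here. -/
def block {N M : ℕ} (a : blockTridiag N M) (i j : ℕ) : Matrix (Fin M) (Fin M) ℝ :=
  if h : (1 ≤ i ∧ i ≤ N) ∧ (1 ≤ j ∧ j ≤ N) then
    Matrix.of fun p q => toMat a.1 (⟨i - 1, by omega⟩, p) (⟨j - 1, by omega⟩, q)
  else 0

/-- `B_k = - A_{k,k+1}`, for `1 ≤ k < N`. -/
def B {N M : ℕ} (a : blockTridiag N M) (k : ℕ) : Matrix (Fin M) (Fin M) ℝ :=
  -block a k (k + 1)

/-- `D_1 = A_{1,1} - λ` and `D_{k+1} = A_{k+1,k+1} - λ - B_k* D_k⁻¹ B_k`, for `1 ≤ k < N`.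
The value at index `0` is not used. -/
def D {N M : ℕ} (lam : ℝ) (a : blockTridiag N M) : ℕ → Matrix (Fin M) (Fin M) ℝ
  | 0 => 0
  | 1 => block a 1 1 - lam • (1 : Matrix (Fin M) (Fin M) ℝ)
  | k + 2 => block a (k + 2) (k + 2) - lam • (1 : Matrix (Fin M) (Fin M) ℝ)
      - (B a (k + 1)).transpose * (D lam a (k + 1))⁻¹ * B a (k + 1)

/-- `S_k = ‖D_k‖`, the operator norm of `D_k` on Euclidean space. -/
def S {N M : ℕ} (lam : ℝ) (a : blockTridiag N M) (k : ℕ) : ℝ :=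
  ‖Matrix.toEuclideanCLM (n := Fin M) (𝕜 := ℝ) (D lam a k)‖

/-- `D̄_k = ‖D_k‖⁻¹ D_k`. -/
def Dbar {N M : ℕ} (lam : ℝ) (a : blockTridiag N M) (k : ℕ) : Matrix (Fin M) (Fin M) ℝ :=
  (S lam a k)⁻¹ • D lam a k

/-- The σ-algebra generated by (the entries of) a random matrix. -/
abbrev sigma {Ω : Type*} {M : ℕ} (X : Ω → Matrix (Fin M) (Fin M) ℝ) : MeasurableSpace Ω :=
  MeasurableSpace.comap (fun ω (i j : Fin M) => X ω i j) MeasurableSpace.pi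

/-- The σ-algebra generated by `(D_{k-1}, D̄_k, D_{k+1}, B_{k-1}, B_k)`. -/
abbrev condSigma {Ω : Type*} {N M : ℕ} (lam : ℝ) (A : Ω → blockTridiag N M) (k : ℕ) :
    MeasurableSpace Ω :=
  sigma (fun ω => D lam (A ω) (k - 1)) ⊔ sigma (fun ω => Dbar lam (A ω) k) ⊔
    sigma (fun ω => D lam (A ω) (k + 1)) ⊔ sigma (fun ω => B (A ω) (k - 1)) ⊔
    sigma (fun ω => B (A ω) k)

/-- The conditional variance `V(log S_k | D_{k-1}, D̄_k, D_{k+1}, B_{k-1}, B_k)`, as a random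
variable. -/
def condVarLogS {Ω : Type*} [MeasurableSpace Ω] (P : Measure Ω) {N M : ℕ} (lam : ℝ)
    (A : Ω → blockTridiag N M) (k : ℕ) : Ω → ℝ :=
  condVar (condSigma lam A k) (fun ω => Real.log (S lam (A ω) k)) P

end BandMatrix

end

/-!
The law of `A` is an isotropic Gaussian measure on the Euclidean space of symmetric block tridiagonal
matrices. The lower bound on the conditional variance comes from a symmetry of the conditioning: the
flow `scaleFlow` adds `(exp x - 1) D_k` to the block `(k, k)` and `(exp (-x) - 1) Y_k`, with
`Y_k = B_k* D_k⁻¹ B_k`, to the block `(k + 1, k + 1)`. It fixes `D_j` for `j ≠ k` up to `k + 1`, all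
`B_j` and `D̄_k`, hence all conditioning variables, and it adds `x` to `log S_k`. It multiplies
Lebesgue measure by a constant (`map_scaleFlow`).

Averaged over `x` and `-x`, the first order change of `‖a‖²` along the flow cancels
(`norm_sq_scaleFlow_le`), so that the density stays comparable for `|x| ≤ r` as long as
`M r² (‖D_k‖² + ‖Y_k‖² + ‖A_{k,k}‖² + ‖A_{k+1,k+1}‖²)` is bounded, with Frobenius norms. As the sum
is at most `M^{2 + η}` with high probability, this permits `r² = M^{-3 - η}`. On an event `F`
measurable with respect to the conditioning variables, `log S_k` is therefore at distance at least
`r / 2` from its conditional mean on a fixed proportion of `F`, up to a small probability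
(`isoGauss_le_of_invariant`). For `F = {V < δ}` the definition of the conditional variance bounds
the probability of such deviations by `4 δ / r²` (`measure_condVar_lt_inter_le`), whence `F` has
small probability for `δ` slightly smaller than `r²`.

The bounds on `D_k` and `Y_k` rest on a Wegner estimate, `P (‖D_k⁻¹‖ ≥ X) = O (M / X)`
(`isoGauss_frobSq_inv_ge_le`). For a fixed vector `u`, the determinant is quadratic along the
perturbations `u w* + w u*` of `D_k` (`det_add_symProd`). Rotating the corresponding Gaussian
components turns it into a trigonometric polynomial of degree two, whose logarithmic derivative is
large on a small set of angles only (`volume_resolvent_le`); this derivative has the size of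
`D_k⁻¹ u`. A random `u` then captures the Frobenius norm of `D_k⁻¹` up to a factor `√M`. Since `B_k`
is independent of `D_k` and its entries have variance `1 / M`, the Frobenius norm of `Y_k` is
comparable to that of `D_k⁻¹` (`lintegral_frobSq_conj_le`). The same tail bounds show that `log S_k`
is square integrable (`memLp_log_S`).
-/

namespace BandMatrix

/-! ### Isotropic Gaussian measures on Euclidean spaces -/

section IsotropicGaussian

variable {E : Type*} [NormedAddCommGroup E] [InnerProductSpace ℝ E] [FiniteDimensional ℝ E]
  [MeasurableSpace E] [BorelSpace E]

/-- The centred isotropic Gaussian measure on a Euclidean space `E`, with density proportional to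
`exp (- b ‖a‖²)`; a linear functional `⟪v, ·⟫` has variance `‖v‖² / (2 b)`. -/
noncomputable def isoGauss (E : Type*) [NormedAddCommGroup E] [InnerProductSpace ℝ E]
    [FiniteDimensional ℝ E] [MeasurableSpace E] [BorelSpace E] (b : ℝ) : Measure E :=
  (volume : Measure E).withDensity fun a =>
    ENNReal.ofReal ((∫ x : E, Real.exp (-b * ‖x‖ ^ 2))⁻¹ * Real.exp (-b * ‖a‖ ^ 2))

theorem integral_gauss_pos {b : ℝ} (hb : 0 < b) : 0 < ∫ x : E, Real.exp (-b * ‖x‖ ^ 2) := by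
  rw [GaussianFourier.integral_rexp_neg_mul_sq_norm hb]
  positivity

theorem integrable_gauss {b : ℝ} (hb : 0 < b) :
    Integrable (fun x : E => Real.exp (-b * ‖x‖ ^ 2)) := by
  by_contra h
  have := integral_gauss_pos (E := E) hb
  rw [integral_undef h] at this
  exact lt_irrefl _ this

theorem isProbabilityMeasure_isoGauss {b : ℝ} (hb : 0 < b) :
    IsProbabilityMeasure (isoGauss E b) := by
  constructor
  rw [isoGauss, withDensity_apply _ MeasurableSet.univ, Measure.restrict_univ,
    ← ofReal_integral_eq_lintegral_ofReal ((integrable_gauss hb).const_mul _)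
      (Filter.Eventually.of_forall fun a => by
        have := integral_gauss_pos (E := E) hb
        positivity),
    integral_const_mul, inv_mul_cancel₀ (integral_gauss_pos hb).ne', ENNReal.ofReal_one]

theorem isoGauss_map_inner {b : ℝ} (hb : 0 < b) (v : E) :
    (isoGauss E b).map (fun a => inner ℝ v a) =
      gaussianReal 0 (‖v‖ ^ 2 / (2 * b)).toNNReal := by
  have := isProbabilityMeasure_isoGauss (E := E) hb
  have hm : Measurable (fun a : E => inner ℝ v a) := by fun_prop
  have : IsProbabilityMeasure ((isoGauss E b).map (fun a => inner ℝ v a)) :=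
    Measure.isProbabilityMeasure_map hm.aemeasurable
  refine Measure.ext_of_charFun ?_
  funext t
  have hZ := integral_gauss_pos (E := E) hb
  rw [charFun_gaussianReal, charFun_apply_real,
    integral_map hm.aemeasurable (by fun_prop), isoGauss,
    integral_withDensity_eq_integral_toReal_smul (by fun_prop) (by simp)]
  have h1 : ∀ a : E, (ENNReal.ofReal ((∫ x : E, Real.exp (-b * ‖x‖ ^ 2))⁻¹ *
      Real.exp (-b * ‖a‖ ^ 2))).toReal • Complex.exp (t * (inner ℝ v a : ℝ) * Complex.I)
      = ((∫ x : E, Real.exp (-b * ‖x‖ ^ 2))⁻¹ : ℝ) *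
        Complex.exp (-(b : ℂ) * ‖a‖ ^ 2 + (t * Complex.I) * (inner ℝ v a : ℝ)) := by
    intro a
    rw [ENNReal.toReal_ofReal (by positivity), Complex.real_smul, Complex.ofReal_mul, mul_assoc,
      Complex.ofReal_exp, ← Complex.exp_add]
    congr 2
    push_cast
    ring
  simp_rw [h1]
  rw [integral_const_mul, GaussianFourier.integral_cexp_neg_mul_sq_norm_add (by simpa using hb)]
  have h2 : ((∫ x : E, Real.exp (-b * ‖x‖ ^ 2) : ℝ) : ℂ)
      = (Real.pi / b : ℂ) ^ (Module.finrank ℝ E / 2 : ℂ) := by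
    rw [← GaussianFourier.integral_cexp_neg_mul_sq_norm (V := E) (b := (b : ℂ)) (by simpa using hb)]
    rw [← integral_complex_ofReal]
    congr 1
    funext x
    push_cast
    rfl
  rw [← h2, ← mul_assoc, Complex.ofReal_inv, inv_mul_cancel₀ (by exact_mod_cast hZ.ne'), one_mul]
  congr 1
  rw [mul_pow, Complex.I_sq]
  have : (b : ℂ) ≠ 0 := by exact_mod_cast hb.ne'
  push_cast
  rw [Real.coe_toNNReal _ (by positivity)]
  push_cast
  field_simp
  ring

theorem memLp_inner_isoGauss {b : ℝ} (hb : 0 < b) (v : E) (p : NNReal) :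
    MemLp (fun a : E => inner ℝ v a) p (isoGauss E b) := by
  have hm : Measurable (fun a : E => inner ℝ v a) := by fun_prop
  have h := memLp_id_gaussianReal (μ := 0) (v := (‖v‖ ^ 2 / (2 * b)).toNNReal) p
  rw [← isoGauss_map_inner hb v, memLp_map_measure_iff (by fun_prop) hm.aemeasurable] at h
  exact h

theorem integrable_inner_pow_isoGauss {b : ℝ} (hb : 0 < b) (v : E) (n : ℕ) :
    Integrable (fun a : E => (inner ℝ v a) ^ n) (isoGauss E b) := by
  have := isProbabilityMeasure_isoGauss (E := E) hb
  have h := (memLp_inner_isoGauss hb v n).integrable_norm_pow'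
  refine h.mono' (by fun_prop) (Filter.Eventually.of_forall fun a => ?_)
  simp

theorem integral_inner_sq_isoGauss {b : ℝ} (hb : 0 < b) (v : E) :
    ∫ a : E, (inner ℝ v a) ^ 2 ∂(isoGauss E b) = ‖v‖ ^ 2 / (2 * b) := by
  have hm : Measurable (fun a : E => inner ℝ v a) := by fun_prop
  have h := variance_fun_id_gaussianReal (μ := 0) (v := (‖v‖ ^ 2 / (2 * b)).toNNReal)
  rw [variance_of_integral_eq_zero (by fun_prop) integral_id_gaussianReal,
    ← isoGauss_map_inner hb v, integral_map hm.aemeasurable (by fun_prop),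
    Real.coe_toNNReal _ (by positivity)] at h
  exact h

/-- The constant is not optimal: the fourth moment of a standard Gaussian is bounded through
`x ^ 4 ≤ 24 (exp x + exp (-x))`. -/
theorem integral_pow_four_gaussianReal_le {s : ℝ} (hs : 0 < s) :
    ∫ x : ℝ, x ^ 4 ∂(gaussianReal 0 s.toNNReal) ≤ 100 * s ^ 2 := by
  have hq : 0 < Real.sqrt s := Real.sqrt_pos.2 hs
  have hsq : Real.sqrt s ^ 2 = s := Real.sq_sqrt hs.le
  set t : ℝ := (Real.sqrt s)⁻¹ with ht
  have htp : 0 < t := inv_pos.2 hq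
  have hst : s ^ 2 * t ^ 4 = 1 := by
    rw [ht, inv_pow, show Real.sqrt s ^ 4 = (Real.sqrt s ^ 2) ^ 2 by ring, hsq]
    field_simp
  have hst2 : s * t ^ 2 = 1 := by
    rw [ht, inv_pow, hsq, mul_inv_cancel₀ hs.ne']
  have hi1 := integrable_exp_mul_gaussianReal (μ := 0) (v := s.toNNReal) t
  have hi2 := integrable_exp_mul_gaussianReal (μ := 0) (v := s.toNNReal) (-t)
  have e1 := congrFun (mgf_fun_id_gaussianReal (μ := 0) (v := s.toNNReal)) t
  have e2 := congrFun (mgf_fun_id_gaussianReal (μ := 0) (v := s.toNNReal)) (-t)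
  simp only [mgf] at e1 e2
  have aux : ∀ x : ℝ, 0 ≤ x → x ^ 4 ≤ 24 * Real.exp x := by
    intro x hx
    have := Real.pow_div_factorial_le_exp x hx 4
    have h24 : ((Nat.factorial 4 : ℕ) : ℝ) = 24 := by norm_num [Nat.factorial]
    rw [h24, div_le_iff₀ (by norm_num)] at this
    linarith
  have hle : ∀ x : ℝ, x ^ 4 ≤ 24 * s ^ 2 * Real.exp (t * x) + 24 * s ^ 2 * Real.exp (-t * x) := by
    have aux2 : ∀ y : ℝ, y ^ 4 ≤ 24 * Real.exp y + 24 * Real.exp (-y) := by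
      intro y
      rcases le_total 0 y with h | h
      · have := aux y h
        have := Real.exp_pos (-y)
        linarith
      · have := aux (-y) (by linarith)
        have := Real.exp_pos y
        have h4 : (-y) ^ 4 = y ^ 4 := by ring
        linarith
    intro x
    have h := mul_le_mul_of_nonneg_left (aux2 (t * x)) (sq_nonneg s)
    have h1 : s ^ 2 * (t * x) ^ 4 = x ^ 4 := by
      rw [mul_pow, ← mul_assoc, hst, one_mul]
    rw [h1] at h
    rw [neg_mul]
    linarith
  have hb1 : ∫ x : ℝ, x ^ 4 ∂(gaussianReal 0 s.toNNReal) ≤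
      ∫ x : ℝ, (24 * s ^ 2 * Real.exp (t * x) + 24 * s ^ 2 * Real.exp (-t * x))
        ∂(gaussianReal 0 s.toNNReal) :=
    integral_mono_of_nonneg (Filter.Eventually.of_forall fun x => by positivity)
      ((hi1.const_mul _).add (hi2.const_mul _)) (Filter.Eventually.of_forall hle)
  refine hb1.trans ?_
  rw [integral_add (hi1.const_mul _) (hi2.const_mul _), integral_const_mul, integral_const_mul,
    e1, e2, Real.coe_toNNReal _ hs.le]
  have h3 : Real.exp (1 / 2) ≤ 2 := by
    have := Real.exp_one_lt_d9
    have h5 : Real.exp (1 / 2) ^ 2 = Real.exp 1 := by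
      rw [← Real.exp_nat_mul]; norm_num
    nlinarith [Real.exp_pos (1 / 2)]
  have h6 : 0 * t + s * t ^ 2 / 2 = 1 / 2 := by rw [hst2]; ring
  have h7 : 0 * -t + s * (-t) ^ 2 / 2 = 1 / 2 := by rw [neg_sq, hst2]; ring
  rw [h6, h7]
  nlinarith [sq_nonneg s]

theorem integral_inner_pow_four_isoGauss_le {b : ℝ} (hb : 0 < b) (v : E) :
    ∫ a : E, (inner ℝ v a) ^ 4 ∂(isoGauss E b) ≤ 100 * (‖v‖ ^ 2 / (2 * b)) ^ 2 := by
  rcases eq_or_ne v 0 with rfl | hv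
  · simp
  have hm : Measurable (fun a : E => inner ℝ v a) := by fun_prop
  have hv' : 0 < ‖v‖ := norm_pos_iff.2 hv
  have h := integral_pow_four_gaussianReal_le (s := ‖v‖ ^ 2 / (2 * b)) (by positivity)
  rwa [← isoGauss_map_inner hb v, integral_map hm.aemeasurable (by fun_prop)] at h

/-- The rotation by the angle with cosine `c` and sine `s` of the two copies, inside `E × E`, of the
range of a projection `Q`; the identity on the two copies of the kernel of `Q`. -/
def rotOn (Q : E →ₗ[ℝ] E) (c s : ℝ) : E × E →ₗ[ℝ] E × E :=
  LinearMap.prod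
    (LinearMap.fst ℝ E E + (c - 1) • Q.comp (LinearMap.fst ℝ E E)
      + s • Q.comp (LinearMap.snd ℝ E E))
    (LinearMap.snd ℝ E E + (c - 1) • Q.comp (LinearMap.snd ℝ E E)
      - s • Q.comp (LinearMap.fst ℝ E E))

omit [FiniteDimensional ℝ E] [MeasurableSpace E] [BorelSpace E] in
theorem rotOn_apply (Q : E →ₗ[ℝ] E) (c s : ℝ) (z : E × E) :
    rotOn Q c s z = (z.1 + (c - 1) • Q z.1 + s • Q z.2, z.2 + (c - 1) • Q z.2 - s • Q z.1) := rfl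

omit [FiniteDimensional ℝ E] [MeasurableSpace E] [BorelSpace E] in
theorem rotOn_norm_sq {Q : E →ₗ[ℝ] E} (hQ : ∀ x, Q (Q x) = Q x)
    (hs : ∀ x y, inner ℝ (Q x) y = inner ℝ x (Q y)) {c s : ℝ} (h : c ^ 2 + s ^ 2 = 1)
    (z : E × E) :
    ‖(rotOn Q c s z).1‖ ^ 2 + ‖(rotOn Q c s z).2‖ ^ 2 = ‖z.1‖ ^ 2 + ‖z.2‖ ^ 2 := by
  have h1 : ∀ x y, inner ℝ x (Q y) = inner ℝ (Q x) (Q y) := fun x y => by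
    rw [hs x (Q y), hQ]
  have h2 : ∀ x y, inner ℝ (Q x) y = inner ℝ (Q x) (Q y) := fun x y => by
    rw [hs x y, h1]
  have h3 := real_inner_comm (Q z.1) (Q z.2)
  rw [rotOn_apply]
  simp only [← real_inner_self_eq_norm_sq, inner_add_left, inner_add_right, inner_sub_left,
    inner_sub_right, inner_smul_left, inner_smul_right, h1 z.1, h2 _ z.1, h1 z.2, h2 _ z.2]
  simp only [RCLike.conj_to_real]
  linear_combination (inner ℝ (Q z.1) (Q z.1) + inner ℝ (Q z.2) (Q z.2)) * h

/-- Two independent copies of an isotropic Gaussian vector have a rotation invariant joint law, and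
the rotation may be restricted to the range of an orthogonal projection. -/
theorem measurePreserving_rotOn {b : ℝ} (hb : 0 < b) {Q : E →ₗ[ℝ] E} (hQ : ∀ x, Q (Q x) = Q x)
    (hs : ∀ x y, inner ℝ (Q x) y = inner ℝ x (Q y)) {c s : ℝ} (h : c ^ 2 + s ^ 2 = 1) :
    MeasurePreserving (rotOn Q c s) ((isoGauss E b).prod (isoGauss E b))
      ((isoGauss E b).prod (isoGauss E b)) := by
  have := isProbabilityMeasure_isoGauss (E := E) hb
  have hZ := integral_gauss_pos (E := E) hb
  have hcont : Continuous (rotOn Q c s) := LinearMap.continuous_of_finiteDimensional _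
  refine ⟨hcont.measurable, ?_⟩
  have hinj : Function.Injective (rotOn Q c s) := by
    rw [injective_iff_map_eq_zero]
    intro z hz
    have := rotOn_norm_sq hQ hs h z
    rw [hz] at this
    simp only [Prod.fst_zero, Prod.snd_zero, norm_zero] at this
    have a1 : ‖z.1‖ = 0 := by nlinarith [norm_nonneg z.1, norm_nonneg z.2]
    have a2 : ‖z.2‖ = 0 := by nlinarith [norm_nonneg z.1, norm_nonneg z.2]
    exact Prod.ext (norm_eq_zero.1 a1) (norm_eq_zero.1 a2)
  have hdet : LinearMap.det (rotOn Q c s) ≠ 0 := by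
    intro h0
    exact (LinearMap.bot_lt_ker_of_det_eq_zero h0).ne' (LinearMap.ker_eq_bot.2 hinj)
  set g : E × E → ENNReal := fun z =>
    ENNReal.ofReal ((∫ x : E, Real.exp (-b * ‖x‖ ^ 2))⁻¹ * Real.exp (-b * ‖z.1‖ ^ 2)) *
    ENNReal.ofReal ((∫ x : E, Real.exp (-b * ‖x‖ ^ 2))⁻¹ * Real.exp (-b * ‖z.2‖ ^ 2)) with hg
  have hgm : Measurable g := by
    rw [hg]; fun_prop
  have hprod : (isoGauss E b).prod (isoGauss E b) =
      ((volume : Measure E).prod (volume : Measure E)).withDensity g := by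
    rw [isoGauss, prod_withDensity (by fun_prop) (by fun_prop)]
  have hginv : ∀ z, g (rotOn Q c s z) = g z := by
    intro z
    simp only [hg]
    rw [← ENNReal.ofReal_mul (by positivity), ← ENNReal.ofReal_mul (by positivity)]
    congr 1
    have e : ∀ p q : ℝ, (∫ x : E, Real.exp (-b * ‖x‖ ^ 2))⁻¹ * Real.exp (-b * p) *
        ((∫ x : E, Real.exp (-b * ‖x‖ ^ 2))⁻¹ * Real.exp (-b * q)) =
        ((∫ x : E, Real.exp (-b * ‖x‖ ^ 2))⁻¹) ^ 2 * Real.exp (-b * (p + q)) := by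
      intro p q
      rw [mul_add, Real.exp_add]; ring
    rw [e, e, rotOn_norm_sq hQ hs h]
  have hvol := Measure.map_linearMap_addHaar_eq_smul_addHaar
    ((volume : Measure E).prod (volume : Measure E)) hdet
  set k := ENNReal.ofReal |(LinearMap.det (rotOn Q c s))⁻¹|
  have hmap : ((isoGauss E b).prod (isoGauss E b)).map (rotOn Q c s) =
      k • ((isoGauss E b).prod (isoGauss E b)) := by
    refine Measure.ext fun A hA => ?_
    rw [Measure.map_apply hcont.measurable hA, Measure.smul_apply, hprod,
      withDensity_apply _ (hcont.measurable hA), withDensity_apply _ hA,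
      ← setLIntegral_congr_fun (hcont.measurable hA) (fun z _ => hginv z),
      ← setLIntegral_map hA hgm hcont.measurable, hvol, Measure.restrict_smul,
      lintegral_smul_measure]
  have hk : k = 1 := by
    have h1 := congrArg (fun m : Measure (E × E) => m Set.univ) hmap
    simp only [Measure.smul_apply, measure_univ, smul_eq_mul, mul_one] at h1
    rw [Measure.map_apply hcont.measurable MeasurableSet.univ, Set.preimage_univ,
      measure_univ] at h1
    exact h1.symm
  rw [hmap, hk, one_smul]

/-- The component of an isotropic Gaussian vector in the range of an orthogonal projection may be
replaced by that of an independent copy. -/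
theorem lintegral_isoGauss_resample {b : ℝ} (hb : 0 < b) {Q : E →ₗ[ℝ] E} (hQ : ∀ x, Q (Q x) = Q x)
    (hs : ∀ x y, inner ℝ (Q x) y = inner ℝ x (Q y)) {F : E → ENNReal} (hF : Measurable F) :
    ∫⁻ a, F a ∂(isoGauss E b) =
      ∫⁻ a, ∫⁻ a', F (a - Q a + Q a') ∂(isoGauss E b) ∂(isoGauss E b) := by
  have := isProbabilityMeasure_isoGauss (E := E) hb
  have hc : Continuous Q := LinearMap.continuous_of_finiteDimensional _
  have hp := measurePreserving_rotOn hb hQ hs (c := 0) (s := 1) (by norm_num)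
  have h1 := hp.lintegral_comp (f := fun z => F z.1) (by fun_prop)
  have h2 : ∫⁻ z, F z.1 ∂((isoGauss E b).prod (isoGauss E b)) = ∫⁻ a, F a ∂(isoGauss E b) := by
    rw [lintegral_prod _ (by fun_prop)]
    simp
  rw [← h2, ← h1, lintegral_prod]
  · simp [rotOn_apply, sub_eq_add_neg]
  · have := hp.measurable
    fun_prop

end IsotropicGaussian

/-! ### Small-ball, change-of-variables and logarithmic derivative estimates -/

/-- The Paley–Zygmund inequality, at level one half. -/
theorem paley_zygmund {Ω : Type*} [MeasurableSpace Ω] (P : Measure Ω) [IsProbabilityMeasure P]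
    {Z : Ω → ℝ} (hZ : Measurable Z) (hi : Integrable Z P)
    (hi2 : Integrable (fun ω => Z ω ^ 2) P) {m K : ℝ} (hm : 0 < m) (hK : 0 < K)
    (h1 : m ≤ ∫ ω, Z ω ∂P) (h2 : ∫ ω, Z ω ^ 2 ∂P ≤ K * m ^ 2) :
    1 / (4 * K) ≤ P.real {ω | m / 2 ≤ Z ω} := by
  have hA : MeasurableSet {ω | m / 2 ≤ Z ω} := measurableSet_le measurable_const hZ
  have hpt : ∀ ω, Z ω ≤ m / 2 + (4 * K * m)⁻¹ * Z ω ^ 2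
      + K * m * ({ω | m / 2 ≤ Z ω}.indicator (fun _ => (1 : ℝ)) ω) := by
    intro ω
    have h3 : 0 ≤ (4 * K * m)⁻¹ * Z ω ^ 2 := by positivity
    by_cases h : m / 2 ≤ Z ω
    · rw [Set.indicator_of_mem (by exact h)]
      have h4 : (4 * K * m)⁻¹ * Z ω ^ 2 + K * m - Z ω
          = (4 * K * m)⁻¹ * (Z ω - 2 * K * m) ^ 2 := by
        field_simp; ring
      have h5 : 0 ≤ (4 * K * m)⁻¹ * (Z ω - 2 * K * m) ^ 2 := by positivity
      linarith
    · rw [Set.indicator_of_notMem (by exact h)]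
      linarith [not_le.1 h]
  have hind : Integrable ({ω | m / 2 ≤ Z ω}.indicator (fun _ => (1 : ℝ))) P :=
    (integrable_const 1).indicator hA
  have hmono := integral_mono hi
    (((integrable_const (m / 2)).add (hi2.const_mul (4 * K * m)⁻¹)).add (hind.const_mul (K * m))) hpt
  have e : ∫ ω, ((m / 2 + (4 * K * m)⁻¹ * Z ω ^ 2)
      + K * m * ({ω | m / 2 ≤ Z ω}.indicator (fun _ => (1 : ℝ)) ω)) ∂P
      = m / 2 + (4 * K * m)⁻¹ * ∫ ω, Z ω ^ 2 ∂P + K * m * P.real {ω | m / 2 ≤ Z ω} := by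
    rw [integral_add (f := fun ω => m / 2 + (4 * K * m)⁻¹ * Z ω ^ 2)
        ((integrable_const _).add (hi2.const_mul _)) (hind.const_mul _),
      integral_add (integrable_const _) (hi2.const_mul _), integral_const_mul, integral_const_mul,
      integral_indicator hA]
    simp
  simp only [Pi.add_apply] at hmono
  rw [e] at hmono
  have h6 : (4 * K * m)⁻¹ * ∫ ω, Z ω ^ 2 ∂P ≤ m / 4 := by
    calc _ ≤ (4 * K * m)⁻¹ * (K * m ^ 2) := by gcongr
      _ = m / 4 := by field_simp
  rw [div_le_iff₀ (by positivity)]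
  have h7 : m * (1 / 4) ≤ m * (K * P.real {ω | m / 2 ≤ Z ω}) := by linarith
  have := le_of_mul_le_mul_left h7 hm
  linarith

section Flow

variable {E : Type*} [NormedAddCommGroup E] [InnerProductSpace ℝ E] [FiniteDimensional ℝ E]
  [MeasurableSpace E] [BorelSpace E]

/-- A shear along a subspace `V` preserves Lebesgue measure. Smearing the integral over the unit
ball of `V` reduces this to the translation invariance of the measures on `E` and on `V`. -/
theorem measurePreserving_shear (V : Submodule ℝ E) {φ : E → E} (hφ : Measurable φ)
    (hV : ∀ a, φ a ∈ V) (hinv : ∀ a, ∀ v ∈ V, φ (a + v) = φ a) :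
    MeasurePreserving (fun a => a + φ a) (volume : Measure E) volume := by
  have hm : Measurable (fun a => a + φ a) := measurable_id.add hφ
  refine ⟨hm, Measure.ext_of_lintegral _ fun F hF => ?_⟩
  rw [lintegral_map hF hm]
  set g : V → ENNReal := (Metric.ball (0 : V) 1).indicator 1 with hg
  have hgm : Measurable g := measurable_one.indicator Metric.isOpen_ball.measurableSet
  have hc : ∫⁻ v, g v = volume (Metric.ball (0 : V) 1) := by
    rw [hg, lintegral_indicator_one Metric.isOpen_ball.measurableSet]
  have hc0 : ∫⁻ v, g v ≠ 0 := by
    rw [hc]; exact (Metric.measure_ball_pos _ _ one_pos).ne'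
  have hct : ∫⁻ v, g v ≠ ⊤ := by
    rw [hc]; exact measure_ball_lt_top.ne
  set φ' : E → V := fun a => ⟨φ a, hV a⟩ with hφ'
  have hφm : Measurable φ' := hφ.subtype_mk
  have hφinv : ∀ (a : E) (v : V), φ' (a + v) = φ' a := fun a v => Subtype.ext (hinv a v v.2)
  have key : (∫⁻ v, g v) * ∫⁻ a, F (a + φ a) = (∫⁻ v, g v) * ∫⁻ a, F a := by
    calc (∫⁻ v, g v) * ∫⁻ a, F (a + φ a)
        = ∫⁻ v, ∫⁻ a, g v * F (a + ((v + φ' a : V) : E)) := by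
          rw [← lintegral_mul_const _ hgm]
          refine lintegral_congr fun v => ?_
          rw [← lintegral_const_mul _ (by fun_prop),
            ← lintegral_add_right_eq_self (fun a => g v * F (a + φ a)) (v : E)]
          refine lintegral_congr fun a => ?_
          rw [hinv a v v.2, Submodule.coe_add, add_assoc]
      _ = ∫⁻ a, ∫⁻ v, g v * F (a + ((v + φ' a : V) : E)) := by
          refine lintegral_lintegral_swap ?_
          exact Measurable.aemeasurable (by fun_prop)
      _ = ∫⁻ a, ∫⁻ v, g (v - φ' a) * F (a + (v : E)) := by
          refine lintegral_congr fun a => ?_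
          rw [← lintegral_add_right_eq_self (fun v : V => g (v - φ' a) * F (a + (v : E))) (φ' a)]
          simp
      _ = ∫⁻ v, ∫⁻ a, g (v - φ' a) * F (a + (v : E)) := by
          refine lintegral_lintegral_swap ?_
          exact Measurable.aemeasurable (by fun_prop)
      _ = ∫⁻ v, ∫⁻ a, g (v - φ' a) * F a := by
          refine lintegral_congr fun v => ?_
          rw [← lintegral_add_right_eq_self (fun a => g (v - φ' a) * F a) (v : E)]
          simp [hφinv]
      _ = ∫⁻ a, ∫⁻ v, g (v - φ' a) * F a := by
          refine lintegral_lintegral_swap ?_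
          exact Measurable.aemeasurable (by fun_prop)
      _ = (∫⁻ v, g v) * ∫⁻ a, F a := by
          rw [← lintegral_const_mul _ hF]
          refine lintegral_congr fun a => ?_
          rw [lintegral_mul_const _ (by fun_prop), lintegral_sub_right_eq_self]
  exact (ENNReal.mul_right_inj hc0 hct).1 key

/-- Rescaling the range of a projection `Q`, about a centre `ψ a` depending on the other component
of `a` only, multiplies Lebesgue measure by a constant. -/
theorem map_rescale_shear {Q : E →ₗ[ℝ] E} (hQ : ∀ a, Q (Q a) = Q a) {ψ : E → E}
    (hψ : Measurable ψ) (hψQ : ∀ a, Q (ψ a) = ψ a) (hinv : ∀ a v, ψ (a + Q v) = ψ a) (x : ℝ) :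
    ∃ κ : ENNReal, κ ≠ 0 ∧ κ ≠ ⊤ ∧
      (volume : Measure E).map (fun a => a + (Real.exp x - 1) • (Q a - ψ a)) = κ • volume := by
  set L : ℝ → E →ₗ[ℝ] E := fun x => LinearMap.id + (Real.exp x - 1) • Q with hL
  have hLL : ∀ a, L (-x) (L x a) = a := by
    intro a
    simp only [hL, LinearMap.add_apply, LinearMap.id_apply, LinearMap.smul_apply, map_add,
      map_smul, hQ]
    have h : Real.exp (-x) * Real.exp x = 1 := by rw [← Real.exp_add]; simp
    have : (Real.exp x - 1) + (Real.exp (-x) - 1) + (Real.exp (-x) - 1) * (Real.exp x - 1) = 0 := by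
      linear_combination h
    have h' : a + (Real.exp (-x) - 1) • Q a + (Real.exp x - 1) • (Q a + (Real.exp (-x) - 1) • Q a)
        = a + ((Real.exp x - 1) + (Real.exp (-x) - 1)
          + (Real.exp (-x) - 1) * (Real.exp x - 1)) • Q a := by module
    rw [h', this, zero_smul, add_zero]
  have hdet : LinearMap.det (L x) ≠ 0 := by
    intro h0
    have hinj : Function.Injective (L x) := Function.LeftInverse.injective hLL
    exact (LinearMap.bot_lt_ker_of_det_eq_zero h0).ne' (LinearMap.ker_eq_bot.2 hinj)
  have hLc : Continuous (L x) := LinearMap.continuous_of_finiteDimensional _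
  have hvol := Measure.map_linearMap_addHaar_eq_smul_addHaar (volume : Measure E) hdet
  have hmem : ∀ a, ψ a ∈ LinearMap.range Q := fun a => ⟨ψ a, hψQ a⟩
  have hinv' : ∀ a, ∀ v ∈ LinearMap.range Q, ψ (a + v) = ψ a := by
    rintro a _ ⟨v, rfl⟩
    exact hinv a v
  have h1 := measurePreserving_shear (LinearMap.range Q) hψ.neg
    (fun a => (LinearMap.range Q).neg_mem (hmem a)) (fun a v hv => by simp [hinv' a v hv])
  have h2 := measurePreserving_shear (LinearMap.range Q) hψ hmem hinv'
  have hcomp : (fun a => a + (Real.exp x - 1) • (Q a - ψ a)) =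
      (fun a => a + ψ a) ∘ (L x) ∘ (fun a => a + (-ψ) a) := by
    funext a
    have h3 : ψ (L x (a + -ψ a)) = ψ a := by
      have : L x (a + -ψ a) = a + Q (-ψ a + (Real.exp x - 1) • (a - ψ a)) := by
        simp only [hL, LinearMap.add_apply, LinearMap.id_apply, LinearMap.smul_apply, map_add,
          map_neg, map_smul, map_sub, hψQ]
        module
      rw [this, hinv]
    simp only [Function.comp_apply, Pi.neg_apply]
    rw [h3]
    simp only [hL, LinearMap.add_apply, LinearMap.id_apply, LinearMap.smul_apply, map_add,
          map_neg, hψQ]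
    module
  refine ⟨ENNReal.ofReal |(LinearMap.det (L x))⁻¹|, ?_, ENNReal.ofReal_ne_top, ?_⟩
  · rw [Ne, ENNReal.ofReal_eq_zero, not_le]
    exact abs_pos.2 (inv_ne_zero hdet)
  · rw [hcomp, ← Measure.map_map h2.measurable (hLc.measurable.comp h1.measurable),
      ← Measure.map_map hLc.measurable h1.measurable, h1.map_eq, hvol, Measure.map_smul,
      h2.map_eq]

end Flow

/-- If the log-density is, on a set, at most `log C` above its average over the two points
`T a`, `T' a`, then the mass of the set is controlled by those of its two translates. The
Jacobian of `T` drops out, as that of `T' = T⁻¹` is its inverse. -/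
theorem measure_le_of_flow {F : Type*} [MeasurableSpace F] {ν : Measure F} {w : F → ℝ}
    (hw : Measurable w) (hw0 : ∀ a, 0 ≤ w a)
    {T T' : F → F} (hT : Measurable T) (hT' : Measurable T') (h1 : ∀ a, T' (T a) = a)
    (h2 : ∀ a, T (T' a) = a) {κ : ENNReal} (hκ : κ ≠ 0) (hκ' : κ ≠ ⊤) (hmap : ν.map T = κ • ν)
    {S : Set F} (hS : MeasurableSet S) {C : ℝ} (hC : 0 ≤ C)
    (hle : ∀ a ∈ S, w a ^ 2 ≤ C ^ 2 * (w (T a) * w (T' a))) :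
    (ν.withDensity fun a => ENNReal.ofReal (w a)) S ≤ ENNReal.ofReal C *
      ((ν.withDensity fun a => ENNReal.ofReal (w a)) (T ⁻¹' S) +
        (ν.withDensity fun a => ENNReal.ofReal (w a)) (T' ⁻¹' S)) := by
  have hmap' : ν.map T' = κ⁻¹ • ν := by
    have h3 : (ν.map T).map T' = ν := by
      rw [Measure.map_map hT' hT]
      have : T' ∘ T = id := funext h1
      rw [this, Measure.map_id]
    rw [hmap, Measure.map_smul] at h3
    calc ν.map T' = κ⁻¹ • κ • ν.map T' := by
          rw [smul_smul, ENNReal.inv_mul_cancel hκ hκ', one_smul]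
      _ = κ⁻¹ • ν := by rw [h3]
  have hk : ENNReal.ofReal κ.toReal = κ := ENNReal.ofReal_toReal hκ'
  have hkp : 0 < κ.toReal := ENNReal.toReal_pos hκ hκ'
  have hki : ENNReal.ofReal κ.toReal⁻¹ = κ⁻¹ := by rw [ENNReal.ofReal_inv_of_pos hkp, hk]
  set f : F → ENNReal := fun a => ENNReal.ofReal (w a) with hf
  have hfm : Measurable f := hw.ennreal_ofReal
  have hpt : ∀ a ∈ S, f a ≤ ENNReal.ofReal C * (κ⁻¹ * f (T a) + κ * f (T' a)) := by
    intro a ha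
    simp only [hf]
    rw [← hki]
    nth_rw 2 [← hk]
    rw [← ENNReal.ofReal_mul (by positivity),
      ← ENNReal.ofReal_mul (by positivity), ← ENNReal.ofReal_add
        (mul_nonneg (by positivity) (hw0 _)) (mul_nonneg (by positivity) (hw0 _)),
      ← ENNReal.ofReal_mul hC]
    refine ENNReal.ofReal_le_ofReal ?_
    have hp : 0 ≤ κ.toReal⁻¹ * w (T a) := mul_nonneg (by positivity) (hw0 _)
    have hq : 0 ≤ κ.toReal * w (T' a) := mul_nonneg (by positivity) (hw0 _)
    -- by the inequality of arithmetic and geometric means, the Jacobian factors being inverse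
    refine abs_le_of_sq_le_sq' ?_ (by positivity) |>.2
    refine (hle a ha).trans ?_
    have h4 : w (T a) * w (T' a) = (κ.toReal⁻¹ * w (T a)) * (κ.toReal * w (T' a)) := by
      field_simp
    rw [h4, mul_pow]
    gcongr
    nlinarith
  have e1 : ∫⁻ a in S, f (T a) ∂ν = κ * ∫⁻ a in T' ⁻¹' S, f a ∂ν := by
    have : T ⁻¹' (T' ⁻¹' S) = S := by
      ext a; simp [h1]
    rw [← this, ← setLIntegral_map (hT' hS) hfm hT, hmap, Measure.restrict_smul,
      lintegral_smul_measure, this, smul_eq_mul]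
  have e2 : ∫⁻ a in S, f (T' a) ∂ν = κ⁻¹ * ∫⁻ a in T ⁻¹' S, f a ∂ν := by
    have : T' ⁻¹' (T ⁻¹' S) = S := by
      ext a; simp [h2]
    rw [← this, ← setLIntegral_map (hT hS) hfm hT', hmap', Measure.restrict_smul,
      lintegral_smul_measure, this, smul_eq_mul]
  rw [withDensity_apply _ hS, withDensity_apply _ (hT hS), withDensity_apply _ (hT' hS)]
  calc ∫⁻ a in S, f a ∂ν ≤ ∫⁻ a in S, ENNReal.ofReal C * (κ⁻¹ * f (T a) + κ * f (T' a)) ∂ν :=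
        setLIntegral_mono (by fun_prop) hpt
    _ = ENNReal.ofReal C * (∫⁻ a in T ⁻¹' S, f a ∂ν + ∫⁻ a in T' ⁻¹' S, f a ∂ν) := by
        rw [lintegral_const_mul _ (by fun_prop), lintegral_add_left (by fun_prop),
          lintegral_const_mul _ (by fun_prop), lintegral_const_mul _ (by fun_prop), e1, e2,
          ← mul_assoc, ← mul_assoc, ENNReal.inv_mul_cancel hκ hκ', ENNReal.mul_inv_cancel hκ hκ',
          one_mul, one_mul, add_comm]


section Trigonometric

open Polynomial in
/-- The logarithmic derivative of a trigonometric polynomial of degree `2` is large on a small set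
only: written in `exp (i θ)`, it is a sum of at most four simple fractions, and each of them is
large near its pole only. -/
theorem volume_logDeriv_trig_le (p : ℂ[X]) (hp : p.natDegree ≤ 4) {f f' : ℝ → ℝ}
    (hf : ∀ θ, HasDerivAt f (f' θ) θ)
    (hpf : ∀ θ : ℝ, p.eval (Complex.exp (θ * Complex.I)) =
      Complex.exp (θ * Complex.I) ^ 2 * (f θ : ℂ)) {y : ℝ} (hy : 0 < y) :
    volume {θ : ℝ | θ ∈ Set.Icc (0 : ℝ) 1 ∧ f θ ≠ 0 ∧ y * |f θ| ≤ |f' θ|} ≤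
      ENNReal.ofReal (256 / y) := by
  classical
  have harc : ∀ r : ℂ, volume {θ : ℝ | θ ∈ Set.Icc (0 : ℝ) 1 ∧
      ‖Complex.exp (θ * Complex.I) - r‖ ≤ 8 / y} ≤ ENNReal.ofReal (64 / y) := by
    intro r
    rcases Set.eq_empty_or_nonempty {θ : ℝ | θ ∈ Set.Icc (0 : ℝ) 1 ∧
      ‖Complex.exp (θ * Complex.I) - r‖ ≤ 8 / y} with h | ⟨θ₀, h₀, h₀'⟩
    · rw [h]; simp
    · have hsub : {θ : ℝ | θ ∈ Set.Icc (0 : ℝ) 1 ∧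
          ‖Complex.exp (θ * Complex.I) - r‖ ≤ 8 / y} ⊆ Metric.closedBall θ₀ (32 / y) := by
        rintro θ ⟨h, h'⟩
        rw [Metric.mem_closedBall, Real.dist_eq]
        have h1 : ‖Complex.exp (θ * Complex.I) - Complex.exp (θ₀ * Complex.I)‖ ≤ 16 / y := by
          calc _ = ‖(Complex.exp (θ * Complex.I) - r) - (Complex.exp (θ₀ * Complex.I) - r)‖ := by
                congr 1; ring
            _ ≤ 8 / y + 8 / y := (norm_sub_le _ _).trans (add_le_add h' h₀')
            _ = 16 / y := by ring
        have h2 : Complex.exp (θ * Complex.I) - Complex.exp (θ₀ * Complex.I)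
            = Complex.exp (θ₀ * Complex.I) *
              (Complex.exp (Complex.I * ((θ - θ₀ : ℝ) : ℂ)) - 1) := by
          rw [mul_sub, ← Complex.exp_add, mul_one]
          congr 2
          push_cast; ring
        rw [h2, norm_mul, Complex.norm_exp_ofReal_mul_I, one_mul,
          Complex.norm_exp_I_mul_ofReal_sub_one, Real.norm_eq_abs, abs_mul, abs_two] at h1
        have h3 : |(θ - θ₀) / 2| ≤ Real.pi / 2 := by
          rw [abs_le]
          have := Real.pi_gt_three
          constructor <;> linarith [h.1, h.2, h₀.1, h₀.2]
        have h4 := Real.mul_abs_le_abs_sin h3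
        rw [abs_div, abs_two] at h4
        have h5 : 1 / 2 ≤ 2 / Real.pi := by
          rw [div_le_div_iff₀ (by norm_num) Real.pi_pos]
          linarith [Real.pi_le_four]
        have h6 : 1 / 2 * (|θ - θ₀| / 2) ≤ 2 / Real.pi * (|θ - θ₀| / 2) := by gcongr
        have h7 : (32 : ℝ) / y = 2 * (16 / y) := by ring
        rw [h7]
        linarith
      refine (measure_mono hsub).trans ?_
      rw [Real.volume_closedBall]
      exact ENNReal.ofReal_le_ofReal (by rw [← mul_div_assoc]; norm_num)
  have hsub : {θ : ℝ | θ ∈ Set.Icc (0 : ℝ) 1 ∧ f θ ≠ 0 ∧ y * |f θ| ≤ |f' θ|} ⊆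
      ⋃ r ∈ p.roots.toFinset, {θ : ℝ | θ ∈ Set.Icc (0 : ℝ) 1 ∧
        ‖Complex.exp (θ * Complex.I) - r‖ ≤ 8 / y} := by
    rintro θ ⟨hθ, hne, hle⟩
    set z := Complex.exp (θ * Complex.I) with hz
    have hz1 : ‖z‖ = 1 := Complex.norm_exp_ofReal_mul_I θ
    have hz0 : z ≠ 0 := Complex.exp_ne_zero _
    have hpz : p.eval z ≠ 0 := by
      rw [hz, hpf θ]
      exact mul_ne_zero (pow_ne_zero _ hz0) (by exact_mod_cast hne)
    have hp0 : p ≠ 0 := by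
      rintro rfl
      simp at hpz
    have hdz : HasDerivAt (fun t : ℝ => Complex.exp (t * Complex.I)) (z * Complex.I) θ := by
      have h1 : HasDerivAt (fun t : ℝ => (t : ℂ) * Complex.I) (1 * Complex.I) θ :=
        (Complex.ofRealCLM.hasDerivAt (x := θ)).mul_const Complex.I
      simpa using h1.cexp
    have hd1 : HasDerivAt (fun t : ℝ => p.eval (Complex.exp (t * Complex.I)))
        (p.derivative.eval z * (z * Complex.I)) θ :=
      HasDerivAt.comp (h₂ := fun w : ℂ => p.eval w) θ (p.hasDerivAt z) hdz
    have hd2 : HasDerivAt (fun t : ℝ => Complex.exp (t * Complex.I) ^ 2 * (f t : ℂ))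
        ((2 : ℕ) * z ^ (2 - 1) * (z * Complex.I) * (f θ : ℂ) + z ^ 2 * (f' θ : ℂ)) θ :=
      (hdz.pow 2).mul (hf θ).ofReal_comp
    have heq : p.derivative.eval z * (z * Complex.I) =
        z ^ 2 * (2 * Complex.I * (f θ : ℂ) + (f' θ : ℂ)) := by
      have h1 : (fun t : ℝ => p.eval (Complex.exp (t * Complex.I))) =
          fun t : ℝ => Complex.exp (t * Complex.I) ^ 2 * (f t : ℂ) := funext hpf
      rw [h1] at hd1
      rw [hd1.unique hd2]
      push_cast; ring
    have hnorm : y ≤ ‖p.derivative.eval z / p.eval z‖ := by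
      have h1 : ‖p.derivative.eval z‖ = ‖2 * Complex.I * (f θ : ℂ) + (f' θ : ℂ)‖ := by
        have := congrArg norm heq
        simpa [hz1] using this
      have h2 : ‖p.eval z‖ = |f θ| := by
        rw [hz, hpf θ, ← hz, norm_mul, norm_pow, hz1]; simp
      rw [norm_div, h1, h2, le_div_iff₀ (abs_pos.2 hne)]
      refine hle.trans ?_
      have h3 := Complex.abs_re_le_norm (2 * Complex.I * (f θ : ℂ) + (f' θ : ℂ))
      simpa using h3
    -- the logarithmic derivative is the sum of `1 / (z - r)` over the roots; if no root is close to
    -- `z`, each of these at most four terms is at most `y / 8`, too little for a sum of size `y`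
    rw [(IsAlgClosed.splits p).eval_derivative_div_eval_of_ne_zero hpz] at hnorm
    by_contra hcon
    simp only [Set.mem_iUnion, Multiset.mem_toFinset, not_exists, Set.mem_ofPred_eq, not_and,
      not_le] at hcon
    have hb : ∀ x ∈ (p.roots.map fun r => ‖1 / (z - r)‖), x ≤ y / 8 := by
      intro x hx
      obtain ⟨r, hr, rfl⟩ := Multiset.mem_map.1 hx
      have h1 := hcon r hr hθ
      rw [norm_div, norm_one]
      have h2 : 0 < 8 / y := by positivity
      calc 1 / ‖z - r‖ ≤ 1 / (8 / y) := one_div_le_one_div_of_le h2 h1.le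
        _ = y / 8 := by rw [one_div_div]
    have h3 := Multiset.sum_le_card_nsmul _ _ hb
    have h4 : ‖(p.roots.map fun r => 1 / (z - r)).sum‖ ≤
        (p.roots.map fun r => ‖1 / (z - r)‖).sum := by
      have := norm_multiset_sum_le (p.roots.map fun r => 1 / (z - r))
      simpa [Multiset.map_map] using this
    rw [Multiset.card_map, nsmul_eq_mul] at h3
    have h5 : (Multiset.card p.roots : ℝ) ≤ 4 := by
      exact_mod_cast (Polynomial.card_roots' p).trans hp
    have h6 : (Multiset.card p.roots : ℝ) * (y / 8) ≤ 4 * (y / 8) := by gcongr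
    linarith
  calc _ ≤ volume (⋃ r ∈ p.roots.toFinset, {θ : ℝ | θ ∈ Set.Icc (0 : ℝ) 1 ∧
        ‖Complex.exp (θ * Complex.I) - r‖ ≤ 8 / y}) := measure_mono hsub
    _ ≤ ∑ r ∈ p.roots.toFinset, volume {θ : ℝ | θ ∈ Set.Icc (0 : ℝ) 1 ∧
        ‖Complex.exp (θ * Complex.I) - r‖ ≤ 8 / y} := measure_biUnion_finset_le _ _
    _ ≤ p.roots.toFinset.card • ENNReal.ofReal (64 / y) :=
        Finset.sum_le_card_nsmul _ _ _ fun r _ => harc r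
    _ ≤ 4 • ENNReal.ofReal (64 / y) := by
        have : p.roots.toFinset.card ≤ 4 :=
          (Multiset.toFinset_card_le _).trans ((Polynomial.card_roots' p).trans hp)
        gcongr
    _ = ENNReal.ofReal (256 / y) := by
        rw [nsmul_eq_mul, ← ENNReal.ofReal_natCast, ← ENNReal.ofReal_mul (by positivity)]
        congr 1
        push_cast; ring

open Polynomial in
/-- The special case of a quadratic polynomial in `cos θ` and `sin θ`. -/
theorem volume_logDeriv_quadratic_le (k₀ k₁ k₂ k₁₁ k₁₂ k₂₂ : ℝ) {f f' : ℝ → ℝ}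
    (hf : ∀ θ, HasDerivAt f (f' θ) θ)
    (hq : ∀ θ, f θ = k₀ + k₁ * Real.cos θ + k₂ * Real.sin θ + k₁₁ * Real.cos θ ^ 2
      + k₁₂ * (Real.cos θ * Real.sin θ) + k₂₂ * Real.sin θ ^ 2) {y : ℝ} (hy : 0 < y) :
    volume {θ : ℝ | θ ∈ Set.Icc (0 : ℝ) 1 ∧ f θ ≠ 0 ∧ y * |f θ| ≤ |f' θ|} ≤
      ENNReal.ofReal (256 / y) := by
  set u : ℂ[X] := C (1 / 2) * (X ^ 2 + 1) with hu
  set v : ℂ[X] := C (-Complex.I / 2) * (X ^ 2 - 1) with hv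
  refine volume_logDeriv_trig_le (C (k₀ : ℂ) * X ^ 2 + C (k₁ : ℂ) * (X * u)
    + C (k₂ : ℂ) * (X * v) + C (k₁₁ : ℂ) * u ^ 2 + C (k₁₂ : ℂ) * (u * v) + C (k₂₂ : ℂ) * v ^ 2)
    ?_ hf (fun θ => ?_) hy
  · rw [hu, hv]
    compute_degree
  · set z := Complex.exp (θ * Complex.I) with hz
    have hz0 : z ≠ 0 := Complex.exp_ne_zero _
    have hzc : z = Complex.cos θ + Complex.sin θ * Complex.I := Complex.exp_mul_I _
    have hcs := Complex.cos_sq_add_sin_sq θ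
    have h1 : u.eval z = z * Complex.cos θ := by
      rw [hu, hzc]
      simp only [eval_mul, eval_C, eval_add, eval_pow, eval_X, eval_one]
      linear_combination (1 / 2 * Complex.sin θ ^ 2) * Complex.I_sq - 1 / 2 * hcs
    have h2 : v.eval z = z * Complex.sin θ := by
      rw [hv, hzc]
      simp only [eval_mul, eval_C, eval_sub, eval_pow, eval_X, eval_one]
      linear_combination (- Complex.I / 2 * Complex.sin θ ^ 2 - Complex.cos θ * Complex.sin θ)
        * Complex.I_sq - Complex.I / 2 * hcs
    simp only [eval_mul, eval_C, eval_add, eval_pow, eval_X, h1, h2]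
    rw [hq θ]
    push_cast
    ring

end Trigonometric

/-! ### Blocks and the recursion for the matrices `D_k` -/

section Structure

variable {N M : ℕ}

/-- The square of the Frobenius norm, the sum of the squares of the entries. -/
def frobSq {n : Type*} [Fintype n] (m : Matrix n n ℝ) : ℝ := ∑ p, ∑ q, m p q ^ 2

theorem frobSq_nonneg {n : Type*} [Fintype n] (m : Matrix n n ℝ) : 0 ≤ frobSq m :=
  Finset.sum_nonneg fun _ _ => Finset.sum_nonneg fun _ _ => sq_nonneg _

theorem ext_toMat {a b : blockTridiag N M} (h : ∀ u v, toMat a.1 u v = toMat b.1 u v) : a = b :=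
  Subtype.ext (PiLp.ext fun i => h i.1 i.2)

theorem toMat_symm (a : blockTridiag N M) (u v : Fin N × Fin M) :
    toMat a.1 u v = toMat a.1 v u :=
  congrFun (congrFun a.2.1 v) u

theorem toMat_add (a b : blockTridiag N M) (u v : Fin N × Fin M) :
    toMat (a + b).1 u v = toMat a.1 u v + toMat b.1 u v := rfl

theorem toMat_sub (a b : blockTridiag N M) (u v : Fin N × Fin M) :
    toMat (a - b).1 u v = toMat a.1 u v - toMat b.1 u v := rfl

theorem toMat_smul (c : ℝ) (a : blockTridiag N M) (u v : Fin N × Fin M) :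
    toMat (c • a).1 u v = c * toMat a.1 u v := rfl

theorem inner_eq_sum (a b : blockTridiag N M) :
    inner ℝ a b = ∑ u, ∑ v, toMat a.1 u v * toMat b.1 u v := by
  rw [Submodule.coe_inner, PiLp.inner_apply, Fintype.sum_prod_type]
  refine Finset.sum_congr rfl fun u _ => Finset.sum_congr rfl fun v _ => ?_
  simp [toMat, mul_comm]

theorem weight_eq (a : blockTridiag N M) :
    weight N M a = Real.exp (-((M : ℝ) / 4) * ‖a‖ ^ 2) := by
  rw [weight, ← real_inner_self_eq_norm_sq, inner_eq_sum]
  congr 2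
  rw [Matrix.trace, Finset.sum_comm]
  rfl

theorem law_eq_isoGauss : law N M = isoGauss (blockTridiag N M) ((M : ℝ) / 4) := by
  simp only [law, isoGauss, weight_eq]

theorem continuous_toMat (u v : Fin N × Fin M) :
    Continuous fun a : blockTridiag N M => toMat a.1 u v := by
  have h : Continuous fun a : EuclideanSpace ℝ ((Fin N × Fin M) × (Fin N × Fin M)) =>
    a (u, v) := by fun_prop
  exact h.comp continuous_subtype_val

/-- The matrix with block `m` at `(i, j)`, symmetrized. It represents the linear functional
`a ↦ tr (a_{i,j}* m)`, see `inner_emb`. -/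
noncomputable def emb (i j : Fin N) (h : |(i : ℤ) - (j : ℤ)| ≤ 1) :
    Matrix (Fin M) (Fin M) ℝ →ₗ[ℝ] blockTridiag N M where
  toFun m := ⟨WithLp.toLp 2 fun x =>
      ((if x.1.1 = i ∧ x.2.1 = j then m x.1.2 x.2.2 else 0) +
        (if x.2.1 = i ∧ x.1.1 = j then m x.2.2 x.1.2 else 0)) / 2, by
    refine ⟨?_, fun i' j' p q hij => ?_⟩
    · ext u v
      simp only [toMat, Matrix.transpose_apply, Matrix.of_apply]
      rw [add_comm]
    · simp only [toMat, Matrix.of_apply]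
      rw [if_neg, if_neg]
      · simp
      · rintro ⟨rfl, rfl⟩
        rw [abs_sub_comm] at hij
        omega
      · rintro ⟨rfl, rfl⟩
        omega⟩
  map_add' m m' := by
    refine ext_toMat fun u v => ?_
    simp only [toMat_add]
    simp only [toMat, Matrix.of_apply, Matrix.add_apply]
    split_ifs <;> ring
  map_smul' c m := by
    refine ext_toMat fun u v => ?_
    simp only [toMat_smul, RingHom.id_apply]
    simp only [toMat, Matrix.of_apply, Matrix.smul_apply, smul_eq_mul]
    split_ifs <;> ring

theorem toMat_emb (i j : Fin N) (h : |(i : ℤ) - (j : ℤ)| ≤ 1) (m : Matrix (Fin M) (Fin M) ℝ)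
    (u v : Fin N × Fin M) : toMat (emb i j h m).1 u v =
      ((if u.1 = i ∧ v.1 = j then m u.2 v.2 else 0) +
        (if v.1 = i ∧ u.1 = j then m v.2 u.2 else 0)) / 2 := rfl

theorem inner_emb (i j : Fin N) (h : |(i : ℤ) - (j : ℤ)| ≤ 1) (m : Matrix (Fin M) (Fin M) ℝ)
    (a : blockTridiag N M) :
    inner ℝ (emb i j h m) a = ∑ p, ∑ q, m p q * toMat a.1 (i, p) (j, q) := by
  have e1 : ∀ f : (Fin N × Fin M) → (Fin N × Fin M) → ℝ,
      ∑ u, ∑ v, (if u.1 = i ∧ v.1 = j then m u.2 v.2 else 0) * f u v =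
        ∑ p, ∑ q, m p q * f (i, p) (j, q) := by
    intro f
    rw [Fintype.sum_prod_type, Finset.sum_eq_single i]
    · refine Finset.sum_congr rfl fun p _ => ?_
      rw [Fintype.sum_prod_type, Finset.sum_eq_single j]
      · simp
      · intro b _ hb; simp [hb]
      · simp
    · intro b _ hb
      simp [hb]
    · simp
  rw [inner_eq_sum]
  simp only [toMat_emb]
  have e2 : ∑ u, ∑ v, (if v.1 = i ∧ u.1 = j then m v.2 u.2 else 0) * toMat a.1 u v =
      ∑ p, ∑ q, m p q * toMat a.1 (i, p) (j, q) := by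
    rw [Finset.sum_comm, ← e1 fun u v => toMat a.1 u v]
    refine Finset.sum_congr rfl fun u _ => Finset.sum_congr rfl fun v _ => ?_
    rw [toMat_symm a v u]
  have e3 : ∀ u v : Fin N × Fin M, ((if u.1 = i ∧ v.1 = j then m u.2 v.2 else 0) +
        (if v.1 = i ∧ u.1 = j then m v.2 u.2 else 0)) / 2 * toMat a.1 u v =
      (1 / 2) * ((if u.1 = i ∧ v.1 = j then m u.2 v.2 else 0) * toMat a.1 u v) +
      (1 / 2) * ((if v.1 = i ∧ u.1 = j then m v.2 u.2 else 0) * toMat a.1 u v) := by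
    intro u v; ring
  simp only [e3, Finset.sum_add_distrib, ← Finset.mul_sum]
  rw [e1 fun u v => toMat a.1 u v, e2]
  ring

/-- Symmetrization does not increase the norm. -/
theorem norm_emb_sq_le (i j : Fin N) (h : |(i : ℤ) - (j : ℤ)| ≤ 1) (m : Matrix (Fin M) (Fin M) ℝ) :
    ‖emb i j h m‖ ^ 2 ≤ frobSq m := by
  have h1 : ‖emb i j h m‖ ^ 2 = ∑ p, ∑ q, m p q * toMat (emb i j h m).1 (i, p) (j, q) := by
    rw [← real_inner_self_eq_norm_sq, inner_emb]
  have h2 : ∑ p, ∑ q, m p q * toMat (emb i j h m).1 (i, p) (j, q) ≤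
      ∑ p, ∑ q, (m p q ^ 2 * (3 / 4) + m q p ^ 2 * (1 / 4)) := by
    refine Finset.sum_le_sum fun p _ => Finset.sum_le_sum fun q _ => ?_
    rw [toMat_emb]
    simp only [and_self, if_true]
    split_ifs
    · nlinarith [sq_nonneg (m p q - m q p)]
    · nlinarith [sq_nonneg (m p q), sq_nonneg (m q p)]
  have h3 : ∑ p, ∑ q, (m p q ^ 2 * (3 / 4) + m q p ^ 2 * (1 / 4)) = frobSq m := by
    simp only [Finset.sum_add_distrib, ← Finset.sum_mul]
    rw [Finset.sum_comm (f := fun p q => m q p ^ 2), frobSq]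
    ring
  rw [h1]; exact h2.trans_eq h3

theorem block_succ (a : blockTridiag N M) (i j : Fin N) (p q : Fin M) :
    block a (i + 1) (j + 1) p q = toMat a.1 (i, p) (j, q) := by
  have h : (1 ≤ (i : ℕ) + 1 ∧ (i : ℕ) + 1 ≤ N) ∧ (1 ≤ (j : ℕ) + 1 ∧ (j : ℕ) + 1 ≤ N) := by omega
  simp only [block, dif_pos h, Matrix.of_apply]
  rfl

theorem block_of_not (a : blockTridiag N M) {i j : ℕ}
    (h : ¬((1 ≤ i ∧ i ≤ N) ∧ (1 ≤ j ∧ j ≤ N))) : block a i j = 0 := by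
  simp only [block, dif_neg h]

theorem block_transpose (a : blockTridiag N M) (i j : ℕ) :
    (block a i j).transpose = block a j i := by
  by_cases h : (1 ≤ i ∧ i ≤ N) ∧ (1 ≤ j ∧ j ≤ N)
  · ext p q
    simp only [block, dif_pos h, dif_pos h.symm, Matrix.transpose_apply, Matrix.of_apply]
    exact toMat_symm a _ _
  · rw [block_of_not a h, block_of_not a (fun h' => h h'.symm), Matrix.transpose_zero]

theorem continuous_block (i j : ℕ) (p q : Fin M) :
    Continuous fun a : blockTridiag N M => block a i j p q := by
  by_cases h : (1 ≤ i ∧ i ≤ N) ∧ (1 ≤ j ∧ j ≤ N)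
  · simp only [block, dif_pos h, Matrix.of_apply]
    exact continuous_toMat _ _
  · simp only [block_of_not _ h]
    exact continuous_const

/-- The correction `B_k* D_k⁻¹ B_k` in the recursion for `D`. At `k = 0` it vanishes, so
that the recursion `D_succ` holds from the first step on. -/
noncomputable def Y (lam : ℝ) (a : blockTridiag N M) (k : ℕ) : Matrix (Fin M) (Fin M) ℝ :=
  (B a k).transpose * (D lam a k)⁻¹ * B a k

theorem D_succ (lam : ℝ) (a : blockTridiag N M) (k : ℕ) :
    D lam a (k + 1) = block a (k + 1) (k + 1) - lam • (1 : Matrix (Fin M) (Fin M) ℝ) -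
      Y lam a k := by
  cases k with
  | zero => simp [D, Y]
  | succ k => rfl

theorem D_symm (lam : ℝ) (a : blockTridiag N M) (k : ℕ) :
    (D lam a k).transpose = D lam a k := by
  induction k with
  | zero => simp [D]
  | succ k ih =>
    rw [D_succ, Y]
    simp only [Matrix.transpose_sub, Matrix.transpose_smul, Matrix.transpose_one, block_transpose,
      Matrix.transpose_mul, Matrix.transpose_transpose, Matrix.transpose_nonsing_inv, ih,
      Matrix.mul_assoc]

theorem D_inv_symm (lam : ℝ) (a : blockTridiag N M) (k : ℕ) :
    ((D lam a k)⁻¹).transpose = (D lam a k)⁻¹ := by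
  rw [Matrix.transpose_nonsing_inv, D_symm]

theorem Y_symm (lam : ℝ) (a : blockTridiag N M) (k : ℕ) :
    (Y lam a k).transpose = Y lam a k := by
  rw [Y]
  simp only [Matrix.transpose_mul, Matrix.transpose_transpose, D_inv_symm, Matrix.mul_assoc]

theorem D_congr (lam : ℝ) {a b : blockTridiag N M} {k : ℕ}
    (h : ∀ i j, i ≤ k → j ≤ k → block a i j = block b i j) : D lam a k = D lam b k := by
  induction k with
  | zero => rfl
  | succ k ih =>
    rw [D_succ, D_succ, Y, Y, B, B, h _ _ le_rfl le_rfl, h k (k + 1) (by omega) le_rfl,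
      ih fun i j hi hj => h i j (by omega) (by omega)]

theorem measurable_matrix_mul {Ω : Type*} [MeasurableSpace Ω] {n : Type*} [Fintype n]
    {X X' : Ω → Matrix n n ℝ} (h : ∀ p q, Measurable fun ω => X ω p q)
    (h' : ∀ p q, Measurable fun ω => X' ω p q) (p q : n) :
    Measurable fun ω => (X ω * X' ω) p q := by
  simp only [Matrix.mul_apply]
  exact Finset.measurable_sum _ fun r _ => (h p r).mul (h' r q)

theorem measurable_matrix_det {Ω : Type*} [MeasurableSpace Ω] {n : Type*} [Fintype n]
    [DecidableEq n] {X : Ω → Matrix n n ℝ} (h : ∀ p q, Measurable fun ω => X ω p q) :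
    Measurable fun ω => (X ω).det := by
  simp only [Matrix.det_apply]
  exact Finset.measurable_sum _ fun σ _ =>
    (Finset.measurable_prod _ fun r _ => h _ _).const_smul _

theorem measurable_matrix_inv {Ω : Type*} [MeasurableSpace Ω] {n : Type*} [Fintype n]
    [DecidableEq n] {X : Ω → Matrix n n ℝ} (h : ∀ p q, Measurable fun ω => X ω p q) (p q : n) :
    Measurable fun ω => (X ω)⁻¹ p q := by
  simp only [Matrix.inv_def, Matrix.smul_apply, Ring.inverse_eq_inv', smul_eq_mul,
    Matrix.adjugate_apply]
  refine (measurable_matrix_det h).inv.mul (measurable_matrix_det fun r s => ?_)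
  by_cases hr : r = q
  · simp only [Matrix.updateRow_apply, if_pos hr]
    exact measurable_const
  · simp only [Matrix.updateRow_apply, if_neg hr]
    exact h r s

theorem measurable_frobSq {Ω : Type*} [MeasurableSpace Ω] {n : Type*} [Fintype n]
    {X : Ω → Matrix n n ℝ} (h : ∀ p q, Measurable fun ω => X ω p q) :
    Measurable fun ω => frobSq (X ω) :=
  Finset.measurable_sum _ fun p _ => Finset.measurable_sum _ fun q _ => (h p q).pow_const 2

theorem measurable_block (i j : ℕ) (p q : Fin M) :
    Measurable fun a : blockTridiag N M => block a i j p q := (continuous_block i j p q).measurable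

theorem measurable_B (k : ℕ) (p q : Fin M) :
    Measurable fun a : blockTridiag N M => B a k p q := (measurable_block k (k + 1) p q).neg

mutual
theorem measurable_D (lam : ℝ) (k : ℕ) (p q : Fin M) :
    Measurable fun a : blockTridiag N M => D lam a k p q := by
  cases k with
  | zero => exact measurable_const
  | succ k =>
    simp only [D_succ, Matrix.sub_apply]
    exact ((measurable_block _ _ _ _).sub measurable_const).sub (measurable_Y lam k p q)

theorem measurable_Y (lam : ℝ) (k : ℕ) (p q : Fin M) :
    Measurable fun a : blockTridiag N M => Y lam a k p q :=
  measurable_matrix_mul (measurable_matrix_mul (fun p q => measurable_B k q p)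
    (measurable_matrix_inv (measurable_D lam k))) (measurable_B k) p q
end

theorem measurable_D_inv (lam : ℝ) (k : ℕ) (p q : Fin M) :
    Measurable fun a : blockTridiag N M => (D lam a k)⁻¹ p q :=
  measurable_matrix_inv (measurable_D lam k) p q

theorem measurable_S (lam : ℝ) (k : ℕ) :
    Measurable fun a : blockTridiag N M => S lam a k := by
  have h1 : Measurable fun a : blockTridiag N M => (fun p q => D lam a k p q : Fin M → Fin M → ℝ) :=
    measurable_pi_lambda _ fun p => measurable_pi_lambda _ fun q => measurable_D lam k p q
  have h2 : Continuous fun m : Fin M → Fin M → ℝ =>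
      ‖Matrix.toEuclideanCLM (n := Fin M) (𝕜 := ℝ) (Matrix.of m)‖ := by
    refine continuous_norm.comp ?_
    exact LinearMap.continuous_of_finiteDimensional
      (IsLinearMap.mk' (fun m : Fin M → Fin M → ℝ =>
        Matrix.toEuclideanCLM (n := Fin M) (𝕜 := ℝ) (Matrix.of m))
        ⟨fun x y => map_add Matrix.toEuclideanCLM (Matrix.of x) (Matrix.of y),
          fun c x => map_smul Matrix.toEuclideanCLM c (Matrix.of x)⟩)
  exact h2.measurable.comp h1

theorem measurable_emb_apply {Ω : Type*} [MeasurableSpace Ω] (i j : Fin N)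
    (h : |(i : ℤ) - (j : ℤ)| ≤ 1) {X : Ω → Matrix (Fin M) (Fin M) ℝ}
    (hX : ∀ p q, Measurable fun ω => X ω p q) : Measurable fun ω => emb i j h (X ω) := by
  have h1 : Measurable fun ω => (fun p q => X ω p q : Fin M → Fin M → ℝ) :=
    measurable_pi_lambda _ fun p => measurable_pi_lambda _ fun q => hX p q
  have h2 : Continuous ((emb (M := M) i j h).comp (Matrix.ofLinearEquiv ℝ).toLinearMap) :=
    LinearMap.continuous_of_finiteDimensional _
  exact h2.measurable.comp h1

theorem block_emb (i j : Fin N) (h : |(i : ℤ) - (j : ℤ)| ≤ 1) (m : Matrix (Fin M) (Fin M) ℝ)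
    (a : blockTridiag N M) {i' j' : ℕ} (h1 : ¬(i' = i + 1 ∧ j' = j + 1))
    (h2 : ¬(j' = i + 1 ∧ i' = j + 1)) : block (a + emb i j h m) i' j' = block a i' j' := by
  by_cases hh : (1 ≤ i' ∧ i' ≤ N) ∧ (1 ≤ j' ∧ j' ≤ N)
  · ext p q
    simp only [block, dif_pos hh, Matrix.of_apply, toMat_add, toMat_emb]
    rw [if_neg, if_neg]
    · simp
    · rintro ⟨rfl, rfl⟩
      exact h2 (by simp only; omega)
    · rintro ⟨rfl, rfl⟩
      exact h1 (by simp only; omega)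
  · rw [block_of_not _ hh, block_of_not _ hh]

theorem block_add_emb_self (i : Fin N) (h : |(i : ℤ) - (i : ℤ)| ≤ 1)
    {m : Matrix (Fin M) (Fin M) ℝ} (hm : m.transpose = m) (a : blockTridiag N M) :
    block (a + emb i i h m) (i + 1) (i + 1) = block a (i + 1) (i + 1) + m := by
  ext p q
  have h1 : m q p = m p q := congrFun (congrFun hm p) q
  simp only [block_succ, toMat_add, toMat_emb, and_self, if_true, Matrix.add_apply, h1]
  ring

theorem B_add_emb (i : Fin N) (h : |(i : ℤ) - (i : ℤ)| ≤ 1)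
    (m : Matrix (Fin M) (Fin M) ℝ) (a : blockTridiag N M) (k : ℕ) :
    B (a + emb i i h m) k = B a k := by
  rw [B, B, block_emb] <;> omega

theorem D_add_emb_of_le (lam : ℝ) (i : Fin N) (h : |(i : ℤ) - (i : ℤ)| ≤ 1)
    (m : Matrix (Fin M) (Fin M) ℝ) (a : blockTridiag N M) {k : ℕ} (hk : k ≤ i) :
    D lam (a + emb i i h m) k = D lam a k :=
  D_congr lam fun i' j' hi' hj' => block_emb i i h m a (by omega) (by omega)

theorem D_add_emb_self (lam : ℝ) (i : Fin N) (h : |(i : ℤ) - (i : ℤ)| ≤ 1)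
    {m : Matrix (Fin M) (Fin M) ℝ} (hm : m.transpose = m) (a : blockTridiag N M) :
    D lam (a + emb i i h m) (i + 1) = D lam a (i + 1) + m := by
  rw [D_succ, D_succ, Y, Y, D_add_emb_of_le lam i h m a le_rfl, B_add_emb,
    block_add_emb_self i h hm]
  abel

end Structure

/-! ### Determinants along rank-two symmetric perturbations -/

section Determinant

open Matrix

variable {n : Type*} [Fintype n] [DecidableEq n]

/-- The symmetric matrix `u x* + x u*`. -/
def symProd (u x : n → ℝ) : Matrix n n ℝ := vecMulVec u x + vecMulVec x u

omit [Fintype n] [DecidableEq n] in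
theorem symProd_apply (u x : n → ℝ) (i j : n) : symProd u x i j = u i * x j + x i * u j := rfl

omit [Fintype n] [DecidableEq n] in
theorem symProd_transpose (u x : n → ℝ) : (symProd u x).transpose = symProd u x := by
  ext i j
  simp only [Matrix.transpose_apply, symProd_apply]
  ring

omit [Fintype n] [DecidableEq n] in
theorem symProd_add (u x y : n → ℝ) : symProd u (x + y) = symProd u x + symProd u y := by
  ext i j
  simp only [Matrix.add_apply, symProd_apply, Pi.add_apply]
  ring

omit [Fintype n] [DecidableEq n] in
theorem symProd_smul (u x : n → ℝ) (c : ℝ) : symProd u (c • x) = c • symProd u x := by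
  ext i j
  simp only [Matrix.smul_apply, symProd_apply, Pi.smul_apply, smul_eq_mul]
  ring

omit [DecidableEq n] in
theorem dotProduct_mulVec_comm {H : Matrix n n ℝ} (hH : H.transpose = H) (x y : n → ℝ) :
    x ⬝ᵥ H *ᵥ y = y ⬝ᵥ H *ᵥ x := by
  rw [dotProduct_mulVec, ← mulVec_transpose, hH, dotProduct_comm]

omit [DecidableEq n] in
theorem trace_mul_symProd {H : Matrix n n ℝ} (hH : H.transpose = H) (u x : n → ℝ) :
    (H * symProd u x).trace = 2 * (u ⬝ᵥ H *ᵥ x) := by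
  rw [symProd, Matrix.mul_add, trace_add, mul_vecMulVec, mul_vecMulVec, trace_vecMulVec,
    trace_vecMulVec, dotProduct_comm, dotProduct_mulVec_comm hH x u, dotProduct_comm (H *ᵥ x)]
  ring

/-- The determinant is a quadratic function of `x` along the perturbations `u x* + x u*` of rank
two, by the matrix determinant lemma. -/
theorem det_add_symProd {G : Matrix n n ℝ} (hG : G.transpose = G) (h0 : G.det ≠ 0)
    (u x : n → ℝ) :
    (G + symProd u x).det =
      G.det * ((1 + u ⬝ᵥ G⁻¹ *ᵥ x) ^ 2 - (u ⬝ᵥ G⁻¹ *ᵥ u) * (x ⬝ᵥ G⁻¹ *ᵥ x)) := by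
  have hH : (G⁻¹).transpose = G⁻¹ := by rw [transpose_nonsing_inv, hG]
  set U : Matrix n (Fin 2) ℝ := of fun i => ![u i, x i] with hU
  set W : Matrix (Fin 2) n ℝ := of ![x, u] with hW
  have h1 : symProd u x = U * W := by
    ext i j
    simp [symProd_apply, Matrix.mul_apply, Fin.sum_univ_two, hU, hW]
  have hu : IsUnit G.det := isUnit_iff_ne_zero.2 h0
  have h2 : G + symProd u x = G * (1 + (G⁻¹ * U) * W) := by
    rw [Matrix.mul_add, Matrix.mul_one, Matrix.mul_assoc G⁻¹, ← Matrix.mul_assoc G,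
      mul_nonsing_inv _ hu, Matrix.one_mul, h1]
  have h3 : ∀ (i j : Fin 2), (W * (G⁻¹ * U)) i j = (W i) ⬝ᵥ G⁻¹ *ᵥ (fun r => U r j) := by
    intro i j
    simp only [Matrix.mul_apply, dotProduct, mulVec]
  rw [h2, det_mul, det_one_add_mul_comm, det_fin_two]
  simp only [Matrix.add_apply, h3, Matrix.one_apply_eq]
  have e0 : (fun r => U r 0) = u := by funext r; simp [hU]
  have e1 : (fun r => U r 1) = x := by funext r; simp [hU]
  have e2 : W 0 = x := rfl
  have e3 : W 1 = u := rfl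
  rw [e0, e1, e2, e3, dotProduct_mulVec_comm hH x u]
  simp only [Matrix.one_apply, Fin.isValue, zero_ne_one, one_ne_zero, if_false, zero_add]
  ring

/-- Along a circle of perturbations `u x* + x u*`, the inverse matrix can be large in the tangent
direction for a small set of angles only. The determinant is a trigonometric polynomial of
degree `2`, whatever the size of the matrix, and its logarithmic derivative is the trace below. -/
theorem volume_resolvent_le {G : Matrix n n ℝ} (hG : G.transpose = G) (u w w' : n → ℝ) {y : ℝ}
    (hy : 0 < y) :
    volume {θ : ℝ | θ ∈ Set.Icc (0 : ℝ) 1 ∧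
      (G + symProd u ((Real.cos θ - 1) • w + Real.sin θ • w')).det ≠ 0 ∧
      y ≤ |((G + symProd u ((Real.cos θ - 1) • w + Real.sin θ • w'))⁻¹ *
        symProd u (Real.cos θ • w' - Real.sin θ • w)).trace|} ≤ ENNReal.ofReal (256 / y) := by
  set F : ℝ → Matrix n n ℝ := fun θ =>
    G + symProd u ((Real.cos θ - 1) • w + Real.sin θ • w') with hF
  have hFs : ∀ θ, (F θ).transpose = F θ := fun θ => by
    simp only [hF, transpose_add, hG, symProd_transpose]
  have hHs : ∀ θ, ((F θ)⁻¹).transpose = (F θ)⁻¹ := fun θ => by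
    rw [transpose_nonsing_inv, hFs]
  -- expanding about any angle `θ₀` with invertible `F θ₀` serves twice: once to see that `det F` is
  -- a trigonometric polynomial, and at `θ₀ = θ` to compute its derivative
  have orbit : ∀ θ₀, (F θ₀).det ≠ 0 → ∃ a b c k : ℝ, ∀ θ, (F θ).det = (F θ₀).det *
      ((1 + ((Real.cos θ - Real.cos θ₀) * (u ⬝ᵥ (F θ₀)⁻¹ *ᵥ w) +
        (Real.sin θ - Real.sin θ₀) * (u ⬝ᵥ (F θ₀)⁻¹ *ᵥ w'))) ^ 2 -
        k * ((Real.cos θ - Real.cos θ₀) ^ 2 * a +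
          (Real.cos θ - Real.cos θ₀) * (Real.sin θ - Real.sin θ₀) * b +
          (Real.sin θ - Real.sin θ₀) ^ 2 * c)) := by
    intro θ₀ h0
    refine ⟨w ⬝ᵥ (F θ₀)⁻¹ *ᵥ w, w ⬝ᵥ (F θ₀)⁻¹ *ᵥ w' + w' ⬝ᵥ (F θ₀)⁻¹ *ᵥ w,
      w' ⬝ᵥ (F θ₀)⁻¹ *ᵥ w', u ⬝ᵥ (F θ₀)⁻¹ *ᵥ u, fun θ => ?_⟩
    have h1 : F θ = F θ₀ + symProd u ((Real.cos θ - Real.cos θ₀) • w +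
        (Real.sin θ - Real.sin θ₀) • w') := by
      simp only [hF]
      rw [add_assoc, ← symProd_add]
      congr 2
      module
    rw [h1, det_add_symProd (hFs θ₀) h0]
    simp only [mulVec_add, mulVec_smul, dotProduct_add, add_dotProduct, dotProduct_smul,
      smul_dotProduct, smul_eq_mul]
    ring
  rcases Set.eq_empty_or_nonempty {θ : ℝ | θ ∈ Set.Icc (0 : ℝ) 1 ∧ (F θ).det ≠ 0 ∧
      y ≤ |((F θ)⁻¹ * symProd u (Real.cos θ • w' - Real.sin θ • w)).trace|} with h | ⟨θ₀, -, h₀, -⟩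
  · rw [h]; simp
  obtain ⟨a, b, c, k, hq⟩ := orbit θ₀ h₀
  set β := u ⬝ᵥ (F θ₀)⁻¹ *ᵥ w
  set β' := u ⬝ᵥ (F θ₀)⁻¹ *ᵥ w'
  have hd : ∀ θ, DifferentiableAt ℝ (fun θ => (F θ).det) θ := by
    intro θ
    have : (fun θ => (F θ).det) = _ := funext hq
    rw [this]
    fun_prop
  have hderiv := fun θ => (hd θ).hasDerivAt
  refine (measure_mono ?_).trans (volume_logDeriv_quadratic_le
    ((F θ₀).det * ((1 - Real.cos θ₀ * β - Real.sin θ₀ * β') ^ 2 - k * (Real.cos θ₀ ^ 2 * a +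
      Real.cos θ₀ * Real.sin θ₀ * b + Real.sin θ₀ ^ 2 * c)))
    ((F θ₀).det * (2 * (1 - Real.cos θ₀ * β - Real.sin θ₀ * β') * β + k * (2 * Real.cos θ₀ * a +
      Real.sin θ₀ * b)))
    ((F θ₀).det * (2 * (1 - Real.cos θ₀ * β - Real.sin θ₀ * β') * β' + k * (2 * Real.sin θ₀ * c +
      Real.cos θ₀ * b)))
    ((F θ₀).det * (β ^ 2 - k * a)) ((F θ₀).det * (2 * β * β' - k * b))
    ((F θ₀).det * (β' ^ 2 - k * c)) hderiv (fun θ => ?_) hy)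
  · rintro θ ⟨hθ, hne, hle⟩
    refine ⟨hθ, hne, ?_⟩
    obtain ⟨a₁, b₁, c₁, k₁, hq₁⟩ := orbit θ hne
    have hc := Real.hasDerivAt_cos θ
    have hs := Real.hasDerivAt_sin θ
    have hc' := hc.sub_const (Real.cos θ)
    have hs' := hs.sub_const (Real.sin θ)
    have h1 := (((((hc'.mul_const (u ⬝ᵥ (F θ)⁻¹ *ᵥ w)).add
      (hs'.mul_const (u ⬝ᵥ (F θ)⁻¹ *ᵥ w'))).const_add 1).pow 2).sub
      (((((hc'.pow 2).mul_const a₁).add ((hc'.mul hs').mul_const b₁)).add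
        ((hs'.pow 2).mul_const c₁)).const_mul k₁)).const_mul (F θ).det
    have h5 := (hderiv θ).unique (h1.congr_of_eventuallyEq (Filter.Eventually.of_forall hq₁))
    simp only [Pi.add_apply, sub_self, zero_mul, mul_zero, add_zero, pow_one, mul_one,
      Nat.cast_ofNat, Nat.add_one_sub_one, sub_zero] at h5
    have h6 : ((F θ)⁻¹ * symProd u (Real.cos θ • w' - Real.sin θ • w)).trace =
        2 * (Real.cos θ * (u ⬝ᵥ (F θ)⁻¹ *ᵥ w') - Real.sin θ * (u ⬝ᵥ (F θ)⁻¹ *ᵥ w)) := by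
      rw [trace_mul_symProd (hHs θ)]
      simp only [mulVec_sub, mulVec_smul, dotProduct_sub, dotProduct_smul, smul_eq_mul]
    have h7 : deriv (fun θ => (F θ).det) θ = (F θ).det *
        ((F θ)⁻¹ * symProd u (Real.cos θ • w' - Real.sin θ • w)).trace := by
      rw [h6, h5]
      ring
    rw [h7, abs_mul, mul_comm]
    gcongr
  · rw [hq θ]
    ring

end Determinant

/-! ### Rotations of Gaussian pairs and small values of `D_k` along a vector -/

section GaussianTools

variable {E : Type*} [NormedAddCommGroup E] [InnerProductSpace ℝ E] [FiniteDimensional ℝ E]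
  [MeasurableSpace E] [BorelSpace E]

/-- A probability for two independent Gaussian vectors is bounded by the proportion of angles for
which the rotated pair lies in the event, uniformly over the orbits. -/
theorem prod_measure_le_of_orbits {b : ℝ} (hb : 0 < b) {Q : E →ₗ[ℝ] E} (hQ : ∀ x, Q (Q x) = Q x)
    (hs : ∀ x y, inner ℝ (Q x) y = inner ℝ x (Q y)) {S : Set (E × E)} (hS : MeasurableSet S)
    {K : ENNReal} (h : ∀ z, volume {θ : ℝ | θ ∈ Set.Icc (0 : ℝ) 1 ∧
      rotOn Q (Real.cos θ) (Real.sin θ) z ∈ S} ≤ K) :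
    ((isoGauss E b).prod (isoGauss E b)) S ≤ K := by
  have := isProbabilityMeasure_isoGauss (E := E) hb
  have hc : Continuous Q := LinearMap.continuous_of_finiteDimensional _
  have hm : Measurable fun x : ℝ × (E × E) => rotOn Q (Real.cos x.1) (Real.sin x.1) x.2 := by
    simp only [rotOn_apply]
    exact Continuous.measurable (by fun_prop)
  have hm1 : Measurable fun x : ℝ × (E × E) =>
      S.indicator (1 : E × E → ENNReal) (rotOn Q (Real.cos x.1) (Real.sin x.1) x.2) :=
    (measurable_one.indicator hS).comp hm
  have h1 : ∀ θ : ℝ, ∫⁻ z, S.indicator (1 : E × E → ENNReal)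
      (rotOn Q (Real.cos θ) (Real.sin θ) z) ∂((isoGauss E b).prod (isoGauss E b)) =
        ((isoGauss E b).prod (isoGauss E b)) S := by
    intro θ
    rw [(measurePreserving_rotOn hb hQ hs (Real.cos_sq_add_sin_sq θ)).lintegral_comp
      (measurable_one.indicator hS), lintegral_indicator_one hS]
  calc ((isoGauss E b).prod (isoGauss E b)) S
      = ∫⁻ θ in Set.Icc (0 : ℝ) 1, ((isoGauss E b).prod (isoGauss E b)) S := by simp
    _ = ∫⁻ θ in Set.Icc (0 : ℝ) 1, ∫⁻ z, S.indicator (1 : E × E → ENNReal)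
      (rotOn Q (Real.cos θ) (Real.sin θ) z) ∂((isoGauss E b).prod (isoGauss E b)) := by
        simp only [h1]
    _ = ∫⁻ z, ∫⁻ θ in Set.Icc (0 : ℝ) 1, S.indicator (1 : E × E → ENNReal)
      (rotOn Q (Real.cos θ) (Real.sin θ) z) ∂(volume : Measure ℝ)
        ∂((isoGauss E b).prod (isoGauss E b)) :=
        lintegral_lintegral_swap hm1.aemeasurable
    _ ≤ ∫⁻ _ : E × E, K ∂((isoGauss E b).prod (isoGauss E b)) := by
        refine lintegral_mono fun z => ?_
        have hmz : MeasurableSet {θ : ℝ | rotOn Q (Real.cos θ) (Real.sin θ) z ∈ S} :=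
          (hm.comp (measurable_id.prodMk measurable_const)) hS
        refine le_trans (le_of_eq ?_) (h z)
        have h2 : ∀ θ : ℝ, S.indicator (1 : E × E → ENNReal)
            (rotOn Q (Real.cos θ) (Real.sin θ) z) =
            {θ : ℝ | rotOn Q (Real.cos θ) (Real.sin θ) z ∈ S}.indicator 1 θ := fun _ => rfl
        simp only [h2]
        rw [lintegral_indicator_one hmz, Measure.restrict_apply hmz, Set.inter_comm]
        rfl
    _ = K := by simp

/-- A linear functional of a Gaussian vector is of the order of its standard deviation with a
probability bounded below. -/
theorem isoGauss_real_inner_sq_ge {b : ℝ} (hb : 0 < b) (v : E) :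
    1 / 400 ≤ (isoGauss E b).real {a | ‖v‖ ^ 2 / (4 * b) ≤ (inner ℝ v a) ^ 2} := by
  have := isProbabilityMeasure_isoGauss (E := E) hb
  rcases eq_or_ne v 0 with rfl | hv
  · simp
    norm_num
  have hv' : 0 < ‖v‖ := norm_pos_iff.2 hv
  have h := paley_zygmund (isoGauss E b) (Z := fun a => (inner ℝ v a) ^ 2) (by fun_prop)
    (integrable_inner_pow_isoGauss hb v 2)
    (by simpa only [← pow_mul] using integrable_inner_pow_isoGauss hb v 4)
    (m := ‖v‖ ^ 2 / (2 * b)) (K := 100) (by positivity) (by norm_num)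
    (integral_inner_sq_isoGauss hb v).ge
    (by simpa only [← pow_mul] using integral_inner_pow_four_isoGauss_le hb v)
  have e : ‖v‖ ^ 2 / (2 * b) / 2 = ‖v‖ ^ 2 / (4 * b) := by field_simp; norm_num
  rw [e] at h
  norm_num at h ⊢
  exact h

variable {ι : Type*} [Fintype ι]

theorem integral_sum_inner_sq {b : ℝ} (hb : 0 < b) (v : ι → E) :
    ∫ a, ∑ i, (inner ℝ (v i) a) ^ 2 ∂(isoGauss E b) = ∑ i, ‖v i‖ ^ 2 / (2 * b) := by
  rw [integral_finsetSum _ fun i _ => integrable_inner_pow_isoGauss hb (v i) 2]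
  simp only [integral_inner_sq_isoGauss hb]

theorem integrable_sum_inner_sq {b : ℝ} (hb : 0 < b) (v : ι → E) :
    Integrable (fun a => ∑ i, (inner ℝ (v i) a) ^ 2) (isoGauss E b) :=
  integrable_finsetSum _ fun i _ => integrable_inner_pow_isoGauss hb (v i) 2

omit [FiniteDimensional ℝ E] [MeasurableSpace E] [BorelSpace E] in
/-- The Cauchy–Schwarz inequality weighted by the variances. For a zero vector the junk value
`0⁻¹ = 0` is harmless, as both sides get no contribution from it. -/
theorem sq_sum_inner_sq_le {b : ℝ} (hb : 0 < b) (v : ι → E) (a : E) :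
    (∑ i, (inner ℝ (v i) a) ^ 2) ^ 2 ≤ (∑ i, ‖v i‖ ^ 2 / (2 * b)) *
      ∑ i, (‖v i‖ ^ 2 / (2 * b))⁻¹ * (inner ℝ (v i) a) ^ 4 := by
  refine Finset.sum_sq_le_sum_mul_sum_of_sq_le_mul _ (fun i _ => by positivity)
    (fun i _ => by positivity) fun i _ => ?_
  rcases eq_or_ne (v i) 0 with h | h
  · simp [h]
  · have h' : 0 < ‖v i‖ := norm_pos_iff.2 h
    rw [mul_inv_cancel_left₀ (by positivity)]
    exact le_of_eq (by ring)

theorem integrable_sq_sum_inner_sq {b : ℝ} (hb : 0 < b) (v : ι → E) :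
    Integrable (fun a => (∑ i, (inner ℝ (v i) a) ^ 2) ^ 2) (isoGauss E b) := by
  have hi : Integrable (fun a => (∑ i, ‖v i‖ ^ 2 / (2 * b)) *
      ∑ i, (‖v i‖ ^ 2 / (2 * b))⁻¹ * (inner ℝ (v i) a) ^ 4) (isoGauss E b) :=
    (integrable_finsetSum _ fun i _ =>
      (integrable_inner_pow_isoGauss hb (v i) 4).const_mul _).const_mul _
  refine hi.mono' (Measurable.aestronglyMeasurable (by fun_prop))
    (Filter.Eventually.of_forall fun a => ?_)
  rw [Real.norm_of_nonneg (by positivity)]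
  exact sq_sum_inner_sq_le hb v a

/-- The second moment of a sum of squares of Gaussian variables is comparable to the square of its
mean, whatever the covariances. -/
theorem integral_sq_sum_inner_sq_le {b : ℝ} (hb : 0 < b) (v : ι → E) :
    ∫ a, (∑ i, (inner ℝ (v i) a) ^ 2) ^ 2 ∂(isoGauss E b) ≤
      100 * (∑ i, ‖v i‖ ^ 2 / (2 * b)) ^ 2 := by
  have hi : ∀ i, Integrable (fun a => (‖v i‖ ^ 2 / (2 * b))⁻¹ * (inner ℝ (v i) a) ^ 4)
      (isoGauss E b) := fun i => (integrable_inner_pow_isoGauss hb (v i) 4).const_mul _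
  have h1 := integral_mono (integrable_sq_sum_inner_sq hb v)
    ((integrable_finsetSum Finset.univ fun i _ => hi i).const_mul (∑ i, ‖v i‖ ^ 2 / (2 * b)))
    (sq_sum_inner_sq_le hb v)
  rw [integral_const_mul, integral_finsetSum _ fun i _ => hi i] at h1
  simp only [integral_const_mul] at h1
  have h2 : ∀ i, (‖v i‖ ^ 2 / (2 * b))⁻¹ * ∫ a, (inner ℝ (v i) a) ^ 4 ∂(isoGauss E b) ≤
      100 * (‖v i‖ ^ 2 / (2 * b)) := by
    intro i
    refine (mul_le_mul_of_nonneg_left (integral_inner_pow_four_isoGauss_le hb (v i))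
      (by positivity)).trans ?_
    rcases eq_or_ne (v i) 0 with h | h
    · simp [h]
    · have h' : ‖v i‖ ^ 2 / (2 * b) ≠ 0 := by
        have : 0 < ‖v i‖ := norm_pos_iff.2 h
        positivity
      refine le_of_eq ?_
      rw [mul_left_comm, pow_two (_ / _), inv_mul_cancel_left₀ h']
  refine h1.trans ((mul_le_mul_of_nonneg_left (Finset.sum_le_sum fun i _ => h2 i)
    (Finset.sum_nonneg fun i _ => by positivity)).trans_eq ?_)
  rw [← Finset.mul_sum]
  ring

end GaussianTools

theorem mul_measure_le_prod {α β : Type*} [MeasurableSpace α] [MeasurableSpace β] (μ : Measure α)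
    (ν : Measure β) [SFinite μ] [SFinite ν] {A : Set α} (hA : MeasurableSet A) {S : Set (α × β)}
    (hS : MeasurableSet S) {c : ENNReal} (h : ∀ a ∈ A, c ≤ ν {b | (a, b) ∈ S}) :
    c * μ A ≤ (μ.prod ν) S := by
  rw [Measure.prod_apply hS]
  calc c * μ A = ∫⁻ _ in A, c ∂μ := by simp
    _ ≤ ∫⁻ a in A, ν (Prod.mk a ⁻¹' S) ∂μ := setLIntegral_mono' hA h
    _ ≤ ∫⁻ a, ν (Prod.mk a ⁻¹' S) ∂μ := setLIntegral_le_lintegral _ _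

section Wegner

open Matrix

variable {N M : ℕ}

theorem inner_emb_emb (i : Fin N) (h : |(i : ℤ) - (i : ℤ)| ≤ 1) (m : Matrix (Fin M) (Fin M) ℝ)
    {m' : Matrix (Fin M) (Fin M) ℝ} (hm' : m'.transpose = m') :
    inner ℝ (emb i i h m) (emb i i h m') = (m * m').trace := by
  rw [inner_emb, Matrix.trace]
  refine Finset.sum_congr rfl fun p _ => ?_
  rw [Matrix.diag_apply, Matrix.mul_apply]
  refine Finset.sum_congr rfl fun q _ => ?_
  have h1 : m' q p = m' p q := congrFun (congrFun hm' p) q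
  rw [toMat_emb]
  simp only [and_self, if_true, h1]
  ring

theorem measurable_mulVec_sq {Ω : Type*} [MeasurableSpace Ω] {n : Type*} [Fintype n]
    {X : Ω → Matrix n n ℝ} {u : Ω → n → ℝ} (hX : ∀ p q, Measurable fun ω => X ω p q)
    (hu : ∀ p, Measurable fun ω => u ω p) :
    Measurable fun ω => (X ω *ᵥ u ω) ⬝ᵥ (X ω *ᵥ u ω) := by
  have h : ∀ p, Measurable fun ω => (X ω *ᵥ u ω) p := fun p =>
    Finset.measurable_sum _ fun q _ => (hX p q).mul (hu q)
  exact Finset.measurable_sum _ fun p _ => (h p).mul (h p)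

theorem frobSq_symProd_le {n : Type*} [Fintype n] (u w : n → ℝ) :
    frobSq (symProd u w) ≤ 4 * ((u ⬝ᵥ u) * (w ⬝ᵥ w)) := by
  have h1 : frobSq (symProd u w) ≤
      ∑ i, ∑ j, (2 * ((u i * u i) * (w j * w j)) + 2 * ((w i * w i) * (u j * u j))) := by
    refine Finset.sum_le_sum fun i _ => Finset.sum_le_sum fun j _ => ?_
    rw [symProd_apply]
    nlinarith [sq_nonneg (u i * w j - w i * u j)]
  refine h1.trans_eq ?_
  simp only [Finset.sum_add_distrib, ← Finset.mul_sum, ← Finset.sum_mul, dotProduct]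
  ring

theorem exists_projection_range {E : Type*} [NormedAddCommGroup E] [InnerProductSpace ℝ E]
    [FiniteDimensional ℝ E] (V : Submodule ℝ E) :
    ∃ Q : E →ₗ[ℝ] E, (∀ x, Q (Q x) = Q x) ∧ (∀ x y, inner ℝ (Q x) y = inner ℝ x (Q y)) ∧
      (∀ x, Q x ∈ V) ∧ ∀ x ∈ V, Q x = x := by
  refine ⟨V.starProjection.toLinearMap, fun x => ?_, fun x y => ?_, fun x => ?_, fun x hx => ?_⟩
  · exact Submodule.starProjection_eq_self_iff.2 (Submodule.starProjection_apply_mem V x)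
  · exact Submodule.inner_starProjection_left_eq_right V x y
  · exact Submodule.starProjection_apply_mem V x
  · exact Submodule.starProjection_eq_self_iff.2 hx

theorem abs_sub_self_le (i : Fin N) : |(i : ℤ) - (i : ℤ)| ≤ 1 := by simp

/-- The matrices `u w* + w u*` in a diagonal block. -/
noncomputable def symEmb (κ : Fin N) (u : Fin M → ℝ) : (Fin M → ℝ) →ₗ[ℝ] blockTridiag N M where
  toFun w := emb κ κ (abs_sub_self_le κ) (symProd u w)
  map_add' w w' := by rw [symProd_add, map_add]
  map_smul' c w := by rw [symProd_smul, map_smul, RingHom.id_apply]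

theorem symEmb_apply (κ : Fin N) (u w : Fin M → ℝ) :
    symEmb κ u w = emb κ κ (abs_sub_self_le κ) (symProd u w) := rfl

/-- The projection of a symmetric block `H` to the matrices `u w* + w u*` has norm at least
`‖H u‖ / ‖u‖`; test it against `w = H u`. -/
theorem mulVec_sq_le_projection (κ : Fin N) (u : Fin M → ℝ)
    {Q : blockTridiag N M →ₗ[ℝ] blockTridiag N M}
    (hQs : ∀ x y, inner ℝ (Q x) y = inner ℝ x (Q y))
    (hQid : ∀ x ∈ LinearMap.range (symEmb κ u), Q x = x)
    {H : Matrix (Fin M) (Fin M) ℝ} (hH : H.transpose = H) (ht : 0 < (H *ᵥ u) ⬝ᵥ (H *ᵥ u)) :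
    (H *ᵥ u) ⬝ᵥ (H *ᵥ u) ≤ ‖Q (emb κ κ (abs_sub_self_le κ) H)‖ ^ 2 * (u ⬝ᵥ u) := by
  have h1 : inner ℝ (Q (emb κ κ (abs_sub_self_le κ) H)) (symEmb κ u (H *ᵥ u)) =
      2 * ((H *ᵥ u) ⬝ᵥ (H *ᵥ u)) := by
    rw [hQs, hQid _ ⟨_, rfl⟩, symEmb_apply, inner_emb_emb κ _ _ (symProd_transpose _ _),
      trace_mul_symProd hH, dotProduct_mulVec_comm hH u (H *ᵥ u)]
  have h2 := real_inner_mul_inner_self_le (Q (emb κ κ (abs_sub_self_le κ) H))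
    (symEmb κ u (H *ᵥ u))
  rw [h1, real_inner_self_eq_norm_sq, real_inner_self_eq_norm_sq, symEmb_apply] at h2
  have h3 := (norm_emb_sq_le κ κ (abs_sub_self_le κ) (symProd u (H *ᵥ u))).trans
    (frobSq_symProd_le u (H *ᵥ u))
  have hr : 0 ≤ ‖Q (emb κ κ (abs_sub_self_le κ) H)‖ ^ 2 := sq_nonneg _
  generalize ‖Q (emb κ κ (abs_sub_self_le κ) H)‖ ^ 2 = r at *
  have h5 := h2.trans (mul_le_mul_of_nonneg_left h3 hr)
  generalize (H *ᵥ u) ⬝ᵥ (H *ᵥ u) = t at *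
  have h6 : t * (4 * t) ≤ (r * (u ⬝ᵥ u)) * (4 * t) := by linarith
  exact le_of_mul_le_mul_right h6 (by linarith)

/-- The pairs `(a, a')` such that the derivative of `log |det D_k|` at `a`, in the direction of
the projection `Q a'` of `a'`, is at least `y` in absolute value. Here `Q` is meant to project to
matrices supported in the block `(k, k)`, on which `D_k` depends by a translation. -/
def largeLogDeriv (κ : Fin N) (lam y : ℝ) (Q : blockTridiag N M →ₗ[ℝ] blockTridiag N M) :
    Set (blockTridiag N M × blockTridiag N M) :=
  {z | (D lam z.1 (κ + 1)).det ≠ 0 ∧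
    y ≤ |inner ℝ (emb κ κ (abs_sub_self_le κ) (D lam z.1 (κ + 1))⁻¹) (Q z.2)|}

theorem measurableSet_largeLogDeriv (κ : Fin N) (lam y : ℝ)
    (Q : blockTridiag N M →ₗ[ℝ] blockTridiag N M) :
    MeasurableSet (largeLogDeriv κ lam y Q) := by
  have hQc : Continuous Q := LinearMap.continuous_of_finiteDimensional _
  have h1 : Measurable fun a : blockTridiag N M => (D lam a (κ + 1)).det :=
    measurable_matrix_det (measurable_D lam _)
  have h2 : Measurable fun a : blockTridiag N M =>
      emb κ κ (abs_sub_self_le κ) (D lam a (κ + 1))⁻¹ :=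
    measurable_emb_apply κ κ _ (measurable_D_inv lam _)
  have h3 : Measurable fun z : blockTridiag N M × blockTridiag N M =>
      inner ℝ (emb κ κ (abs_sub_self_le κ) (D lam z.1 (κ + 1))⁻¹) (Q z.2) :=
    (h2.comp measurable_fst).inner (hQc.measurable.comp measurable_snd)
  have h4 : Measurable fun z : blockTridiag N M × blockTridiag N M =>
      |inner ℝ (emb κ κ (abs_sub_self_le κ) (D lam z.1 (κ + 1))⁻¹) (Q z.2)| := by
    simpa only [Real.norm_eq_abs] using h3.norm
  exact (measurableSet_eq_fun (h1.comp measurable_fst) measurable_const).compl.inter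
    (measurableSet_le measurable_const h4)

/-- On every orbit of the rotations, the determinant of `D_k` is a trigonometric polynomial, as in
`volume_resolvent_le`. -/
theorem prod_largeLogDeriv_le {b : ℝ} (hb : 0 < b) (κ : Fin N) (lam : ℝ) (u : Fin M → ℝ) {y : ℝ}
    (hy : 0 < y) {Q : blockTridiag N M →ₗ[ℝ] blockTridiag N M} (hQ : ∀ x, Q (Q x) = Q x)
    (hQs : ∀ x y, inner ℝ (Q x) y = inner ℝ x (Q y))
    (hQV : ∀ x, Q x ∈ LinearMap.range (symEmb κ u)) :
    ((isoGauss (blockTridiag N M) b).prod (isoGauss (blockTridiag N M) b))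
      (largeLogDeriv κ lam y Q) ≤ ENNReal.ofReal (256 / y) := by
  refine prod_measure_le_of_orbits hb hQ hQs (measurableSet_largeLogDeriv κ lam y Q) fun z => ?_
  obtain ⟨w, hw⟩ := hQV z.1
  obtain ⟨w', hw'⟩ := hQV z.2
  refine (measure_mono ?_).trans
    (volume_resolvent_le (D_symm lam z.1 (κ + 1)) u w w' hy)
  rintro θ ⟨hθ, h1, h2⟩
  rw [rotOn_apply] at h1 h2
  have e1 : z.1 + (Real.cos θ - 1) • Q z.1 + Real.sin θ • Q z.2 =
      z.1 + emb κ κ (abs_sub_self_le κ)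
        (symProd u ((Real.cos θ - 1) • w + Real.sin θ • w')) := by
    rw [← symEmb_apply, map_add, map_smul, map_smul, hw, hw', add_assoc]
  have e2 : Q (z.2 + (Real.cos θ - 1) • Q z.2 - Real.sin θ • Q z.1) =
      emb κ κ (abs_sub_self_le κ) (symProd u (Real.cos θ • w' - Real.sin θ • w)) := by
    rw [← symEmb_apply, map_sub, map_sub, map_add, map_smul, map_smul, map_smul, map_smul, hQ, hQ,
      hw, hw']
    module
  dsimp only at h1 h2
  rw [e1, D_add_emb_self lam κ _ (symProd_transpose _ _)] at h1
  rw [e1, e2, D_add_emb_self lam κ _ (symProd_transpose _ _),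
    inner_emb_emb κ _ _ (symProd_transpose _ _)] at h2
  exact ⟨hθ, h1, h2⟩

/-- The inverse of `D_k`, applied to a fixed vector `u`, exceeds `x ‖u‖` with probability
`O (√M / x)`. This uses the Gaussian components of the diagonal block along the matrices
`u w* + w u*` only. -/
theorem isoGauss_inv_mulVec_ge_le (hM : 0 < M) (κ : Fin N) (lam : ℝ) (u : Fin M → ℝ) {x : ℝ}
    (hx : 0 < x) :
    isoGauss (blockTridiag N M) ((M : ℝ) / 4) {a |
      x ^ 2 * (u ⬝ᵥ u) ≤ ((D lam a (κ + 1))⁻¹ *ᵥ u) ⬝ᵥ ((D lam a (κ + 1))⁻¹ *ᵥ u) ∧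
      0 < ((D lam a (κ + 1))⁻¹ *ᵥ u) ⬝ᵥ ((D lam a (κ + 1))⁻¹ *ᵥ u)} ≤
      ENNReal.ofReal (102400 * Real.sqrt M / x) := by
  have hM' : (0 : ℝ) < M := by exact_mod_cast hM
  have hb : (0 : ℝ) < (M : ℝ) / 4 := by positivity
  have := isProbabilityMeasure_isoGauss (E := blockTridiag N M) hb
  obtain ⟨Q, hQ, hQs, hQV, hQid⟩ := exists_projection_range (LinearMap.range (symEmb κ u))
  set y : ℝ := x / Real.sqrt M with hy
  have hsM : 0 < Real.sqrt M := Real.sqrt_pos.2 hM'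
  have hyp : 0 < y := by positivity
  have hSle := prod_largeLogDeriv_le hb κ lam u hyp hQ hQs hQV
  have h1 : Measurable fun a : blockTridiag N M =>
      ((D lam a (κ + 1))⁻¹ *ᵥ u) ⬝ᵥ ((D lam a (κ + 1))⁻¹ *ᵥ u) :=
    measurable_mulVec_sq (measurable_D_inv lam (κ + 1)) fun _ => measurable_const
  have hAm := (measurableSet_le (measurable_const (a := x ^ 2 * (u ⬝ᵥ u))) h1).inter
    (measurableSet_lt (measurable_const (a := (0 : ℝ))) h1)
  have hsec : ∀ a ∈ {a : blockTridiag N M | x ^ 2 * (u ⬝ᵥ u) ≤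
        ((D lam a (κ + 1))⁻¹ *ᵥ u) ⬝ᵥ ((D lam a (κ + 1))⁻¹ *ᵥ u)} ∩
        {a | 0 < ((D lam a (κ + 1))⁻¹ *ᵥ u) ⬝ᵥ ((D lam a (κ + 1))⁻¹ *ᵥ u)},
      ENNReal.ofReal (1 / 400) ≤
      isoGauss (blockTridiag N M) ((M : ℝ) / 4) {a' | (a, a') ∈ largeLogDeriv κ lam y Q} := by
    intro a ha
    rw [Set.mem_inter_iff, Set.mem_ofPred_eq, Set.mem_ofPred_eq] at ha
    obtain ⟨ha1, ha2⟩ := ha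
    -- the inverse of a singular matrix is `0` by convention
    have hdet : (D lam a (κ + 1)).det ≠ 0 := by
      intro h0
      rw [Matrix.nonsing_inv_apply_not_isUnit _ (by simpa using h0)] at ha2
      simp at ha2
    have h4 := mulVec_sq_le_projection κ u hQs hQid (D_inv_symm lam a (κ + 1)) ha2
    have hs0 : 0 < u ⬝ᵥ u := by
      rcases (show 0 ≤ u ⬝ᵥ u from
        Finset.sum_nonneg fun i _ => mul_self_nonneg _).lt_or_eq with h | h
      · exact h
      · rw [← h] at h4; linarith
    have h7 := le_of_mul_le_mul_right (ha1.trans h4) hs0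
    have h8 := isoGauss_real_inner_sq_ge hb
      (Q (emb κ κ (abs_sub_self_le κ) (D lam a (κ + 1))⁻¹))
    rw [measureReal_def] at h8
    refine (ENNReal.ofReal_le_of_le_toReal h8).trans (measure_mono fun a' ha' => ⟨hdet, ?_⟩)
    dsimp only
    rw [← hQs]
    refine le_of_eq_of_le (abs_of_pos hyp).symm (sq_le_sq.1 (le_trans ?_ ha'))
    rw [hy, div_pow, Real.sq_sqrt hM'.le, mul_div_cancel₀ _ (by norm_num)]
    gcongr
  have hfin := (mul_measure_le_prod _ _ hAm (measurableSet_largeLogDeriv κ lam y Q) hsec).trans hSle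
  have h400 : ENNReal.ofReal 400 * ENNReal.ofReal (1 / 400) = 1 := by
    rw [← ENNReal.ofReal_mul (by norm_num)]; norm_num
  have hfin2 := mul_le_mul_right hfin (ENNReal.ofReal 400)
  rw [← mul_assoc, h400, one_mul, ← ENNReal.ofReal_mul (by norm_num)] at hfin2
  refine hfin2.trans_eq ?_
  congr 1
  rw [hy]; field_simp; norm_num

end Wegner

/-! ### Tails of the inverse of `D_k` and of the Schur complement corrections -/

section Wegner

open Matrix

variable {N M : ℕ}

theorem sum_inner_row_sq {n : Type*} [Fintype n] (m : Matrix n n ℝ) (u : EuclideanSpace ℝ n) :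
    ∑ i, (inner ℝ (WithLp.toLp 2 (m i) : EuclideanSpace ℝ n) u) ^ 2 =
      (m *ᵥ u.ofLp) ⬝ᵥ (m *ᵥ u.ofLp) := by
  refine Finset.sum_congr rfl fun i _ => ?_
  rw [PiLp.inner_apply, pow_two]
  have : ∑ j, inner ℝ ((WithLp.toLp 2 (m i) : EuclideanSpace ℝ n) j) (u j) = (m *ᵥ u.ofLp) i := by
    refine Finset.sum_congr rfl fun j _ => ?_
    simp [mul_comm]
  rw [this]

theorem sum_norm_row_sq {n : Type*} [Fintype n] (m : Matrix n n ℝ) :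
    ∑ i, ‖(WithLp.toLp 2 (m i) : EuclideanSpace ℝ n)‖ ^ 2 / (2 * (1 / 2 : ℝ)) = frobSq m := by
  refine Finset.sum_congr rfl fun i _ => ?_
  rw [EuclideanSpace.norm_sq_eq]
  simp

theorem frobSq_one {n : Type*} [Fintype n] [DecidableEq n] :
    frobSq (1 : Matrix n n ℝ) = Fintype.card n := by
  simp [frobSq, Matrix.one_apply]

/-- A standard Gaussian vector `u` satisfies `‖m u‖ / ‖u‖ ≥ c ‖m‖_F / √M` with a probability bounded
below. -/
theorem random_vector_mulVec_ge {m : Matrix (Fin M) (Fin M) ℝ} (hm : 0 < frobSq m) (hM : 0 < M) :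
    1 / 800 ≤ (isoGauss (EuclideanSpace ℝ (Fin M)) (1 / 2)).real
      {u | frobSq m / 2 ≤ (m *ᵥ u.ofLp) ⬝ᵥ (m *ᵥ u.ofLp) ∧ u.ofLp ⬝ᵥ u.ofLp ≤ 800 * M} := by
  have hb : (0 : ℝ) < 1 / 2 := by norm_num
  have hM' : (0 : ℝ) < M := by exact_mod_cast hM
  have := isProbabilityMeasure_isoGauss (E := EuclideanSpace ℝ (Fin M)) hb
  set ν := isoGauss (EuclideanSpace ℝ (Fin M)) (1 / 2) with hν
  have hmeas : ∀ m : Matrix (Fin M) (Fin M) ℝ, Measurable fun u : EuclideanSpace ℝ (Fin M) =>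
      (m *ᵥ u.ofLp) ⬝ᵥ (m *ᵥ u.ofLp) := fun m => by
    refine measurable_mulVec_sq (fun _ _ => measurable_const) fun p => ?_
    fun_prop
  have hi : ∀ m : Matrix (Fin M) (Fin M) ℝ, Integrable (fun u : EuclideanSpace ℝ (Fin M) =>
      (m *ᵥ u.ofLp) ⬝ᵥ (m *ᵥ u.ofLp)) ν := fun m => by
    simpa only [sum_inner_row_sq] using
      integrable_sum_inner_sq hb fun i => (WithLp.toLp 2 (m i) : EuclideanSpace ℝ (Fin M))
  have hi1 : ∀ m : Matrix (Fin M) (Fin M) ℝ, ∫ u : EuclideanSpace ℝ (Fin M),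
      (m *ᵥ u.ofLp) ⬝ᵥ (m *ᵥ u.ofLp) ∂ν = frobSq m := fun m => by
    simpa only [sum_inner_row_sq, sum_norm_row_sq] using
      integral_sum_inner_sq hb fun i => (WithLp.toLp 2 (m i) : EuclideanSpace ℝ (Fin M))
  have h1 := paley_zygmund ν (hmeas m) (hi m)
    (by simpa only [sum_inner_row_sq] using
      integrable_sq_sum_inner_sq hb fun i => (WithLp.toLp 2 (m i) : EuclideanSpace ℝ (Fin M)))
    hm (K := 100) (by norm_num) (hi1 m).ge
    (by simpa only [sum_inner_row_sq, sum_norm_row_sq] using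
      integral_sq_sum_inner_sq_le hb fun i => (WithLp.toLp 2 (m i) : EuclideanSpace ℝ (Fin M)))
  have h2 := mul_meas_ge_le_integral_of_nonneg (μ := ν)
    (Filter.Eventually.of_forall fun u => show (0 : ℝ) ≤ _ from
      Finset.sum_nonneg fun i _ => mul_self_nonneg (((1 : Matrix (Fin M) (Fin M) ℝ) *ᵥ u.ofLp) i))
    (hi 1) (800 * M)
  have h3 : ∫ u : EuclideanSpace ℝ (Fin M), (∑ i, ((1 : Matrix (Fin M) (Fin M) ℝ) *ᵥ u.ofLp) i *
      ((1 : Matrix (Fin M) (Fin M) ℝ) *ᵥ u.ofLp) i) ∂ν = M := by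
    have := hi1 1
    rw [frobSq_one, Fintype.card_fin] at this
    exact this
  rw [h3] at h2
  have h4 : ν.real {u | 800 * (M : ℝ) ≤ ∑ i, ((1 : Matrix (Fin M) (Fin M) ℝ) *ᵥ u.ofLp) i *
      ((1 : Matrix (Fin M) (Fin M) ℝ) *ᵥ u.ofLp) i} ≤ 1 / 800 := by
    rw [le_div_iff₀ (by norm_num)]
    have h5 : (M : ℝ) * (ν.real {u | 800 * (M : ℝ) ≤ ∑ i,
      ((1 : Matrix (Fin M) (Fin M) ℝ) *ᵥ u.ofLp) i *
      ((1 : Matrix (Fin M) (Fin M) ℝ) *ᵥ u.ofLp) i} * 800) ≤ M * 1 := by linarith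
    exact le_of_mul_le_mul_left h5 hM'
  have hsub : {u : EuclideanSpace ℝ (Fin M) | frobSq m / 2 ≤ (m *ᵥ u.ofLp) ⬝ᵥ (m *ᵥ u.ofLp)} ⊆
      {u | frobSq m / 2 ≤ (m *ᵥ u.ofLp) ⬝ᵥ (m *ᵥ u.ofLp) ∧ u.ofLp ⬝ᵥ u.ofLp ≤ 800 * M} ∪
      {u | 800 * (M : ℝ) ≤ ∑ i, ((1 : Matrix (Fin M) (Fin M) ℝ) *ᵥ u.ofLp) i *
        ((1 : Matrix (Fin M) (Fin M) ℝ) *ᵥ u.ofLp) i} := by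
    intro u hu
    rcases le_total (u.ofLp ⬝ᵥ u.ofLp) (800 * M) with h | h
    · exact Or.inl ⟨hu, h⟩
    · right
      rw [Set.mem_ofPred_eq, Matrix.one_mulVec]
      exact h
  have h6 := (measureReal_mono (μ := ν) hsub).trans (measureReal_union_le _ _)
  linarith

/-- The Wegner estimate: `‖D_k⁻¹‖_F` exceeds `X` with probability `O (M / X)`. It follows from the
estimate for fixed vectors, applied to an independent Gaussian vector `u`, for which `‖D_k⁻¹ u‖` is
comparable to `‖D_k⁻¹‖_F` with a probability bounded below. -/
theorem isoGauss_frobSq_inv_ge_le (hM : 0 < M) (κ : Fin N) (lam : ℝ) {X : ℝ} (hX : 0 < X) :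
    isoGauss (blockTridiag N M) ((M : ℝ) / 4) {a | X ^ 2 ≤ frobSq (D lam a (κ + 1))⁻¹} ≤
      ENNReal.ofReal (3276800000 * M / X) := by
  have hM' : (0 : ℝ) < M := by exact_mod_cast hM
  have hb : (0 : ℝ) < (M : ℝ) / 4 := by positivity
  have := isProbabilityMeasure_isoGauss (E := blockTridiag N M) hb
  have hb2 : (0 : ℝ) < 1 / 2 := by norm_num
  have := isProbabilityMeasure_isoGauss (E := EuclideanSpace ℝ (Fin M)) hb2
  have hsM : 0 < Real.sqrt M := Real.sqrt_pos.2 hM'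
  set x : ℝ := X / (40 * Real.sqrt M) with hx
  have hxp : 0 < x := by positivity
  have hx2 : x ^ 2 = X ^ 2 / (1600 * M) := by
    rw [hx, div_pow, mul_pow, Real.sq_sqrt hM'.le]; norm_num
  have hA : MeasurableSet {a : blockTridiag N M | X ^ 2 ≤ frobSq (D lam a (κ + 1))⁻¹} :=
    measurableSet_le measurable_const (measurable_frobSq (measurable_D_inv lam (κ + 1)))
  have h1 : Measurable fun z : blockTridiag N M × EuclideanSpace ℝ (Fin M) =>
      ((D lam z.1 (κ + 1))⁻¹ *ᵥ z.2.ofLp) ⬝ᵥ ((D lam z.1 (κ + 1))⁻¹ *ᵥ z.2.ofLp) := by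
    refine measurable_mulVec_sq
      (fun p q => (measurable_D_inv lam (κ + 1) p q).comp measurable_fst) fun p => ?_
    fun_prop
  have h2 : Measurable fun z : blockTridiag N M × EuclideanSpace ℝ (Fin M) =>
      x ^ 2 * (z.2.ofLp ⬝ᵥ z.2.ofLp) := by
    refine measurable_const.mul (Finset.measurable_sum _ fun i _ => ?_)
    fun_prop
  set S : Set (blockTridiag N M × EuclideanSpace ℝ (Fin M)) :=
    {z | x ^ 2 * (z.2.ofLp ⬝ᵥ z.2.ofLp) ≤
        ((D lam z.1 (κ + 1))⁻¹ *ᵥ z.2.ofLp) ⬝ᵥ ((D lam z.1 (κ + 1))⁻¹ *ᵥ z.2.ofLp)} ∩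
      {z | 0 < ((D lam z.1 (κ + 1))⁻¹ *ᵥ z.2.ofLp) ⬝ᵥ ((D lam z.1 (κ + 1))⁻¹ *ᵥ z.2.ofLp)} with hSdef
  have hS : MeasurableSet S := (measurableSet_le h2 h1).inter (measurableSet_lt measurable_const h1)
  have hsec : ∀ a ∈ {a : blockTridiag N M | X ^ 2 ≤ frobSq (D lam a (κ + 1))⁻¹},
      ENNReal.ofReal (1 / 800) ≤
        isoGauss (EuclideanSpace ℝ (Fin M)) (1 / 2) {u | (a, u) ∈ S} := by
    intro a ha
    rw [Set.mem_ofPred_eq] at ha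
    have hXp : 0 < X ^ 2 := by positivity
    have h3 := random_vector_mulVec_ge (hXp.trans_le ha) hM
    rw [measureReal_def] at h3
    refine (ENNReal.ofReal_le_of_le_toReal h3).trans (measure_mono fun u hu => ?_)
    rw [Set.mem_ofPred_eq] at hu
    refine ⟨?_, ?_⟩
    · rw [Set.mem_ofPred_eq]
      refine le_trans ?_ hu.1
      dsimp only
      rw [hx2]
      calc X ^ 2 / (1600 * M) * (u.ofLp ⬝ᵥ u.ofLp) ≤ X ^ 2 / (1600 * M) * (800 * M) := by
            gcongr; exact hu.2
        _ = X ^ 2 / 2 := by field_simp; norm_num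
        _ ≤ _ := by gcongr
    · rw [Set.mem_ofPred_eq]
      refine lt_of_lt_of_le ?_ hu.1
      linarith
  have hle : ((isoGauss (blockTridiag N M) ((M : ℝ) / 4)).prod
      (isoGauss (EuclideanSpace ℝ (Fin M)) (1 / 2))) S ≤
        ENNReal.ofReal (102400 * Real.sqrt M / x) := by
    rw [Measure.prod_apply_symm hS]
    calc _ ≤ ∫⁻ _ : EuclideanSpace ℝ (Fin M), ENNReal.ofReal (102400 * Real.sqrt M / x)
          ∂(isoGauss (EuclideanSpace ℝ (Fin M)) (1 / 2)) :=
          lintegral_mono fun u => isoGauss_inv_mulVec_ge_le hM κ lam u.ofLp hxp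
      _ = _ := by rw [lintegral_const, measure_univ, mul_one]
  have hfin := (mul_measure_le_prod _ _ hA hS hsec).trans hle
  have h800 : ENNReal.ofReal 800 * ENNReal.ofReal (1 / 800) = 1 := by
    rw [← ENNReal.ofReal_mul (by norm_num)]; norm_num
  have hfin2 := mul_le_mul_right hfin (ENNReal.ofReal 800)
  rw [← mul_assoc, h800, one_mul, ← ENNReal.ofReal_mul (by norm_num)] at hfin2
  refine hfin2.trans_eq ?_
  congr 1
  rw [hx]
  have : (M : ℝ) = Real.sqrt M * Real.sqrt M := (Real.mul_self_sqrt hM'.le).symm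
  field_simp
  rw [Real.sq_sqrt hM'.le]
  ring

end Wegner

section OffDiagonal

open Matrix

variable {N M : ℕ}

/-- The projection to the entries in column `p` of the block `(κ, κ')` and to their mirror
images. -/
def colMask (κ κ' : Fin N) (p : Fin M) : blockTridiag N M →ₗ[ℝ] blockTridiag N M where
  toFun a := ⟨WithLp.toLp 2 fun x =>
      if (x.1.1 = κ ∧ x.2 = (κ', p)) ∨ (x.2.1 = κ ∧ x.1 = (κ', p)) then toMat a.1 x.1 x.2 else 0, by
    refine ⟨?_, fun i' j' p' q' hij => ?_⟩
    · ext u v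
      simp only [toMat, Matrix.transpose_apply, Matrix.of_apply]
      have h := toMat_symm a u v
      simp only [toMat, Matrix.of_apply] at h
      simp only [h, or_comm]
    · simp only [toMat, Matrix.of_apply]
      split_ifs
      · exact a.2.2 i' j' p' q' hij
      · rfl⟩
  map_add' a b := by
    refine ext_toMat fun u v => ?_
    simp only [toMat_add]
    simp only [toMat, Matrix.of_apply]
    split_ifs
    · rfl
    · simp
  map_smul' c a := by
    refine ext_toMat fun u v => ?_
    simp only [toMat_smul, RingHom.id_apply]
    simp only [toMat, Matrix.of_apply]
    split_ifs
    · rfl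
    · simp

theorem toMat_colMask (κ κ' : Fin N) (p : Fin M) (a : blockTridiag N M) (u v : Fin N × Fin M) :
    toMat (colMask κ κ' p a).1 u v =
      if (u.1 = κ ∧ v = (κ', p)) ∨ (v.1 = κ ∧ u = (κ', p)) then toMat a.1 u v else 0 := rfl

theorem colMask_idem (κ κ' : Fin N) (p : Fin M) (a : blockTridiag N M) :
    colMask κ κ' p (colMask κ κ' p a) = colMask κ κ' p a := by
  refine ext_toMat fun u v => ?_
  rw [toMat_colMask, toMat_colMask]
  split_ifs <;> rfl

theorem colMask_inner (κ κ' : Fin N) (p : Fin M) (a b : blockTridiag N M) :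
    inner ℝ (colMask κ κ' p a) b = inner ℝ a (colMask κ κ' p b) := by
  rw [inner_eq_sum, inner_eq_sum]
  refine Finset.sum_congr rfl fun u _ => Finset.sum_congr rfl fun v _ => ?_
  rw [toMat_colMask, toMat_colMask]
  split_ifs <;> simp

/-- The matrix `a`, with column `p` of the block `(κ, κ')` and its mirror image taken from `a'`. -/
def resample (κ κ' : Fin N) (p : Fin M) (a a' : blockTridiag N M) : blockTridiag N M :=
  a - colMask κ κ' p a + colMask κ κ' p a'

theorem B_succ (a : blockTridiag N M) {κ κ' : Fin N} (h : (κ' : ℕ) = κ + 1) (i p : Fin M) :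
    B a (κ + 1) i p = -toMat a.1 (κ, i) (κ', p) := by
  rw [B, Matrix.neg_apply, ← block_succ, h]

theorem B_resample (a a' : blockTridiag N M) {κ κ' : Fin N} (h : (κ' : ℕ) = κ + 1)
    (i p q : Fin M) : B (resample κ κ' p a a') (κ + 1) i q =
      if q = p then B a' (κ + 1) i p else B a (κ + 1) i q := by
  have hne : κ' ≠ κ := fun h' => by rw [h'] at h; omega
  rw [B_succ _ h, B_succ _ h, B_succ _ h, resample, toMat_add, toMat_sub, toMat_colMask,
    toMat_colMask]
  by_cases hq : q = p
  · simp [hq]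
  · simp [hq, hne.symm]

theorem block_resample (a a' : blockTridiag N M) {κ κ' : Fin N} (h : (κ' : ℕ) = κ + 1)
    (p : Fin M) {i j : ℕ} (hi : i ≤ κ + 1) (hj : j ≤ κ + 1) :
    block (resample κ κ' p a a') i j = block a i j := by
  by_cases hh : (1 ≤ i ∧ i ≤ N) ∧ (1 ≤ j ∧ j ≤ N)
  · ext r s
    simp only [block, dif_pos hh, Matrix.of_apply, resample, toMat_add, toMat_sub, toMat_colMask]
    rw [if_neg, if_neg]
    · simp
    all_goals
      rintro (⟨-, h2⟩ | ⟨-, h2⟩)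
      all_goals
        have h3 := congrArg (fun x : Fin N × Fin M => (x.1 : ℕ)) h2
        simp only at h3
        omega
  · rw [block_of_not _ hh, block_of_not _ hh]

theorem lintegral_resample {b : ℝ} (hb : 0 < b) (κ κ' : Fin N) (p : Fin M)
    {F : blockTridiag N M → ENNReal} (hF : Measurable F) :
    ∫⁻ a, F a ∂(isoGauss (blockTridiag N M) b) =
      ∫⁻ a, ∫⁻ a', F (resample κ κ' p a a') ∂(isoGauss (blockTridiag N M) b)
        ∂(isoGauss (blockTridiag N M) b) :=
  lintegral_isoGauss_resample hb (colMask_idem κ κ' p) (colMask_inner κ κ' p) hF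

/-- Column `p` of `B_k`. -/
noncomputable def colB (a : blockTridiag N M) (k : ℕ) (p : Fin M) : Fin M → ℝ := fun i => B a k i p

theorem abs_sub_succ_le {κ κ' : Fin N} (h : (κ' : ℕ) = κ + 1) : |(κ : ℤ) - (κ' : ℤ)| ≤ 1 := by
  rw [h]; simp

/-- The vector representing the linear functional `a ↦ c · B_k e_p`. -/
noncomputable def colVec {κ κ' : Fin N} (h : (κ' : ℕ) = κ + 1) (p : Fin M) (c : Fin M → ℝ) :
    blockTridiag N M :=
  emb κ κ' (abs_sub_succ_le h) (Matrix.of fun i j => if j = p then -c i else 0)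

theorem inner_colVec {κ κ' : Fin N} (h : (κ' : ℕ) = κ + 1) (p : Fin M) (c : Fin M → ℝ)
    (a : blockTridiag N M) : inner ℝ (colVec h p c) a = c ⬝ᵥ colB a (κ + 1) p := by
  rw [colVec, inner_emb]
  refine Finset.sum_congr rfl fun i _ => ?_
  rw [colB, B_succ a h]
  simp

theorem norm_colVec_sq_le {κ κ' : Fin N} (h : (κ' : ℕ) = κ + 1) (p : Fin M) (c : Fin M → ℝ) :
    ‖colVec h p c‖ ^ 2 ≤ c ⬝ᵥ c := by
  refine (norm_emb_sq_le _ _ _ _).trans_eq ?_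
  refine Finset.sum_congr rfl fun i _ => ?_
  simp [pow_two]

theorem sum_inner_colVec_sq {κ κ' : Fin N} (h : (κ' : ℕ) = κ + 1) (p : Fin M)
    (m : Matrix (Fin M) (Fin M) ℝ) (a : blockTridiag N M) :
    ∑ i, (inner ℝ (colVec h p (m i)) a) ^ 2 =
      (m *ᵥ colB a (κ + 1) p) ⬝ᵥ (m *ᵥ colB a (κ + 1) p) := by
  refine Finset.sum_congr rfl fun i _ => ?_
  rw [inner_colVec, pow_two]
  rfl

theorem sum_norm_colVec_sq_le (hM : 0 < M) {κ κ' : Fin N} (h : (κ' : ℕ) = κ + 1) (p : Fin M)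
    (m : Matrix (Fin M) (Fin M) ℝ) :
    ∑ i, ‖colVec h p (m i)‖ ^ 2 / (2 * ((M : ℝ) / 4)) ≤ 2 * frobSq m / M := by
  have hM' : (0 : ℝ) < M := by exact_mod_cast hM
  rw [← Finset.sum_div, frobSq, Finset.mul_sum, div_le_div_iff₀ (by positivity) hM']
  have : ∑ i, ‖colVec h p (m i)‖ ^ 2 ≤ ∑ i, ∑ j, m i j ^ 2 := by
    refine Finset.sum_le_sum fun i _ => (norm_colVec_sq_le h p (m i)).trans_eq ?_
    exact Finset.sum_congr rfl fun j _ => (pow_two _).symm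
  rw [← Finset.mul_sum]
  nlinarith

theorem lintegral_dot_colB_sq_le (hM : 0 < M) {κ κ' : Fin N} (h : (κ' : ℕ) = κ + 1) (p : Fin M)
    (c : Fin M → ℝ) :
    ∫⁻ a, ENNReal.ofReal ((c ⬝ᵥ colB a (κ + 1) p) ^ 2)
      ∂(isoGauss (blockTridiag N M) ((M : ℝ) / 4)) ≤ ENNReal.ofReal (2 * (c ⬝ᵥ c) / M) := by
  have hM' : (0 : ℝ) < M := by exact_mod_cast hM
  have hb : (0 : ℝ) < (M : ℝ) / 4 := by positivity
  simp only [← inner_colVec h]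
  rw [← ofReal_integral_eq_lintegral_ofReal (integrable_inner_pow_isoGauss hb _ 2)
    (Filter.Eventually.of_forall fun a => sq_nonneg _), integral_inner_sq_isoGauss hb]
  refine ENNReal.ofReal_le_ofReal ?_
  rw [div_le_div_iff₀ (by positivity) hM']
  nlinarith [norm_colVec_sq_le h p c]

theorem lintegral_mulVec_colB_sq_le (hM : 0 < M) {κ κ' : Fin N} (h : (κ' : ℕ) = κ + 1) (p : Fin M)
    (m : Matrix (Fin M) (Fin M) ℝ) :
    ∫⁻ a, ENNReal.ofReal ((m *ᵥ colB a (κ + 1) p) ⬝ᵥ (m *ᵥ colB a (κ + 1) p))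
      ∂(isoGauss (blockTridiag N M) ((M : ℝ) / 4)) ≤ ENNReal.ofReal (2 * frobSq m / M) := by
  have hM' : (0 : ℝ) < M := by exact_mod_cast hM
  have hb : (0 : ℝ) < (M : ℝ) / 4 := by positivity
  simp only [← sum_inner_colVec_sq h]
  rw [← ofReal_integral_eq_lintegral_ofReal (integrable_sum_inner_sq hb _)
    (Filter.Eventually.of_forall fun a => Finset.sum_nonneg fun i _ => sq_nonneg _),
    integral_sum_inner_sq hb]
  exact ENNReal.ofReal_le_ofReal (sum_norm_colVec_sq_le hM h p m)

theorem lintegral_quadratic_colB_sq_le (hM : 0 < M) {κ κ' : Fin N} (h : (κ' : ℕ) = κ + 1)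
    (p : Fin M) {m : Matrix (Fin M) (Fin M) ℝ} {X : ℝ} (hX : 0 < X) (hm : frobSq m ≤ X ^ 2) :
    ∫⁻ a, ENNReal.ofReal ((colB a (κ + 1) p ⬝ᵥ m *ᵥ colB a (κ + 1) p) ^ 2)
      ∂(isoGauss (blockTridiag N M) ((M : ℝ) / 4)) ≤ ENNReal.ofReal (400 * X ^ 2 / M) := by
  have hM' : (0 : ℝ) < M := by exact_mod_cast hM
  have hb : (0 : ℝ) < (M : ℝ) / 4 := by positivity
  set γ := isoGauss (blockTridiag N M) ((M : ℝ) / 4) with hγ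
  set f : Matrix (Fin M) (Fin M) ℝ → blockTridiag N M → ℝ := fun m a =>
    (∑ i, (inner ℝ (colVec h p (m i)) a) ^ 2) ^ 2 with hf
  have hfi : ∀ m, Integrable (f m) γ := fun m => integrable_sq_sum_inner_sq hb _
  have hfint : ∀ m, ∫ a, f m a ∂γ ≤ 100 * (2 * frobSq m / M) ^ 2 := fun m =>
    (integral_sq_sum_inner_sq_le hb _).trans (by
      gcongr
      exact sum_norm_colVec_sq_le hM h p m)
  have hfa : ∀ m a, f m a = ((m *ᵥ colB a (κ + 1) p) ⬝ᵥ (m *ᵥ colB a (κ + 1) p)) ^ 2 :=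
    fun m a => by simp only [hf, sum_inner_colVec_sq h]
  -- balance the two fourth moments in `(b · m b)² ≤ ‖b‖² ‖m b‖²`
  have hpt : ∀ a, (colB a (κ + 1) p ⬝ᵥ m *ᵥ colB a (κ + 1) p) ^ 2 ≤
      (X ^ 2 / (2 * M)) * f 1 a + (M / (2 * X ^ 2)) * f m a := by
    intro a
    have hcs : (colB a (κ + 1) p ⬝ᵥ m *ᵥ colB a (κ + 1) p) ^ 2 ≤
        (colB a (κ + 1) p ⬝ᵥ colB a (κ + 1) p) *
          ((m *ᵥ colB a (κ + 1) p) ⬝ᵥ (m *ᵥ colB a (κ + 1) p)) := by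
      have := Finset.sum_mul_sq_le_sq_mul_sq Finset.univ (colB a (κ + 1) p)
        (m *ᵥ colB a (κ + 1) p)
      simp only [pow_two] at this
      rw [pow_two]
      exact this
    rw [hfa, hfa, Matrix.one_mulVec]
    refine hcs.trans ?_
    generalize colB a (κ + 1) p ⬝ᵥ colB a (κ + 1) p = s
    generalize (m *ᵥ colB a (κ + 1) p) ⬝ᵥ (m *ᵥ colB a (κ + 1) p) = t
    have e : X ^ 2 / (2 * M) * s ^ 2 + M / (2 * X ^ 2) * t ^ 2 - s * t =
        (X ^ 2 * s - M * t) ^ 2 / (2 * M * X ^ 2) := by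
      field_simp; ring
    have : 0 ≤ (X ^ 2 * s - M * t) ^ 2 / (2 * M * X ^ 2) := by positivity
    linarith
  calc _ ≤ ∫⁻ a, ENNReal.ofReal ((X ^ 2 / (2 * M)) * f 1 a + (M / (2 * X ^ 2)) * f m a) ∂γ :=
        lintegral_mono fun a => ENNReal.ofReal_le_ofReal (hpt a)
    _ = ENNReal.ofReal (∫ a, ((X ^ 2 / (2 * M)) * f 1 a + (M / (2 * X ^ 2)) * f m a) ∂γ) := by
        refine (ofReal_integral_eq_lintegral_ofReal
          (((hfi 1).const_mul _).add ((hfi m).const_mul _))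
          (Filter.Eventually.of_forall fun a => ?_)).symm
        exact le_trans (sq_nonneg _) (hpt a)
    _ ≤ ENNReal.ofReal (400 * X ^ 2 / M) := by
        refine ENNReal.ofReal_le_ofReal ?_
        rw [integral_add ((hfi 1).const_mul _) ((hfi m).const_mul _), integral_const_mul,
          integral_const_mul]
        have h1 : ∫ a, f 1 a ∂γ ≤ 400 := by
          refine (hfint 1).trans_eq ?_
          rw [frobSq_one, Fintype.card_fin]
          field_simp; norm_num
        have h2 : ∫ a, f m a ∂γ ≤ 400 * X ^ 4 / M ^ 2 := by
          refine (hfint m).trans ?_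
          have h3 : 100 * (2 * frobSq m / M) ^ 2 ≤ 100 * (2 * X ^ 2 / M) ^ 2 := by
            gcongr
            exact div_nonneg (mul_nonneg two_pos.le (frobSq_nonneg m)) hM'.le
          refine h3.trans_eq ?_
          field_simp; norm_num
        calc _ ≤ X ^ 2 / (2 * M) * 400 + M / (2 * X ^ 2) * (400 * X ^ 4 / M ^ 2) := by gcongr
          _ = 400 * X ^ 2 / M := by field_simp; norm_num

theorem colB_resample (a a' : blockTridiag N M) {κ κ' : Fin N} (h : (κ' : ℕ) = κ + 1)
    (p q : Fin M) : colB (resample κ κ' p a a') (κ + 1) q =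
      if q = p then colB a' (κ + 1) p else colB a (κ + 1) q := by
  funext i
  rw [colB, B_resample _ _ h]
  split_ifs <;> rfl

theorem measurable_colB (k : ℕ) (p i : Fin M) :
    Measurable fun a : blockTridiag N M => colB a k p i := measurable_B k i p

theorem measurable_dot_mulVec {Ω : Type*} [MeasurableSpace Ω] {n : Type*} [Fintype n]
    {X : Ω → Matrix n n ℝ} {u v : Ω → n → ℝ} (hX : ∀ p q, Measurable fun ω => X ω p q)
    (hu : ∀ p, Measurable fun ω => u ω p) (hv : ∀ p, Measurable fun ω => v ω p) :
    Measurable fun ω => u ω ⬝ᵥ X ω *ᵥ v ω :=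
  Finset.measurable_sum _ fun p _ => (hu p).mul
    (Finset.measurable_sum _ fun q _ => (hX p q).mul (hv q))

/-- If `H` depends on the blocks up to `k` only, then it is independent of `B_k`, whose entries have
variance `1 / M`, and `B_k* H B_k` is of the size of `H` in Frobenius norm. The off-diagonal
entries are handled by resampling one column of `B_k` at a time. -/
theorem lintegral_frobSq_conj_le (hM : 0 < M) {κ κ' : Fin N} (h : (κ' : ℕ) = κ + 1)
    {H : blockTridiag N M → Matrix (Fin M) (Fin M) ℝ} (hH : ∀ p q, Measurable fun a => H a p q)
    (hdep : ∀ a b, (∀ i j, i ≤ (κ : ℕ) + 1 → j ≤ (κ : ℕ) + 1 → block a i j = block b i j) →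
      H a = H b) {X : ℝ} (hX : 0 < X) (hHX : ∀ a, frobSq (H a) ≤ X ^ 2) :
    ∫⁻ a, ENNReal.ofReal (frobSq ((B a (κ + 1)).transpose * H a * B a (κ + 1)))
      ∂(isoGauss (blockTridiag N M) ((M : ℝ) / 4)) ≤ ENNReal.ofReal (404 * X ^ 2) := by
  have hM' : (0 : ℝ) < M := by exact_mod_cast hM
  have hb : (0 : ℝ) < (M : ℝ) / 4 := by positivity
  have := isProbabilityMeasure_isoGauss (E := blockTridiag N M) hb
  set γ := isoGauss (blockTridiag N M) ((M : ℝ) / 4) with hγ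
  have hHr : ∀ p a a', H (resample κ κ' p a a') = H a := fun p a a' =>
    hdep _ _ fun i j hi hj => block_resample a a' h p hi hj
  have hent : ∀ a p q, ((B a (κ + 1)).transpose * H a * B a (κ + 1)) p q =
      colB a (κ + 1) p ⬝ᵥ H a *ᵥ colB a (κ + 1) q := by
    intro a p q
    rw [Matrix.mul_assoc]
    rfl
  have hm1 : ∀ p q, Measurable fun a =>
      ENNReal.ofReal ((colB a (κ + 1) p ⬝ᵥ H a *ᵥ colB a (κ + 1) q) ^ 2) := fun p q =>
    ((measurable_dot_mulVec hH (measurable_colB _ p) (measurable_colB _ q)).pow_const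
      2).ennreal_ofReal
  have hm2 : ∀ q, Measurable fun a =>
      ENNReal.ofReal ((H a *ᵥ colB a (κ + 1) q) ⬝ᵥ (H a *ᵥ colB a (κ + 1) q)) := fun q =>
    (measurable_mulVec_sq hH (measurable_colB _ q)).ennreal_ofReal
  have hvec : ∀ q, ∫⁻ a, ENNReal.ofReal ((H a *ᵥ colB a (κ + 1) q) ⬝ᵥ
      (H a *ᵥ colB a (κ + 1) q)) ∂γ ≤ ENNReal.ofReal (2 * X ^ 2 / M) := by
    intro q
    rw [lintegral_resample hb κ κ' q (hm2 q)]
    calc _ ≤ ∫⁻ _ : blockTridiag N M, ENNReal.ofReal (2 * X ^ 2 / M) ∂γ := by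
          refine lintegral_mono fun a => ?_
          simp only [hHr, colB_resample _ _ h, if_true]
          refine (lintegral_mulVec_colB_sq_le hM h q (H a)).trans (ENNReal.ofReal_le_ofReal ?_)
          gcongr
          exact hHX a
      _ = _ := by rw [lintegral_const, measure_univ, mul_one]
  have hoff : ∀ p q, p ≠ q → ∫⁻ a, ENNReal.ofReal
      ((colB a (κ + 1) p ⬝ᵥ H a *ᵥ colB a (κ + 1) q) ^ 2) ∂γ ≤
        ENNReal.ofReal (4 * X ^ 2 / M ^ 2) := by
    intro p q hpq
    rw [lintegral_resample hb κ κ' p (hm1 p q)]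
    calc _ ≤ ∫⁻ a, ENNReal.ofReal (2 / M) * ENNReal.ofReal ((H a *ᵥ colB a (κ + 1) q) ⬝ᵥ
          (H a *ᵥ colB a (κ + 1) q)) ∂γ := by
          refine lintegral_mono fun a => ?_
          simp only [hHr, colB_resample _ _ h, if_true, if_neg hpq.symm]
          simp only [dotProduct_comm (colB _ (κ + 1) p)]
          refine (lintegral_dot_colB_sq_le hM h p _).trans_eq ?_
          rw [← ENNReal.ofReal_mul (by positivity)]
          congr 1
          ring
      _ ≤ ENNReal.ofReal (2 / M) * ENNReal.ofReal (2 * X ^ 2 / M) := by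
          rw [lintegral_const_mul _ (hm2 q)]
          gcongr
          exact hvec q
      _ = _ := by
          rw [← ENNReal.ofReal_mul (by positivity)]
          congr 1
          field_simp
          norm_num
  have hdiag : ∀ p, ∫⁻ a, ENNReal.ofReal
      ((colB a (κ + 1) p ⬝ᵥ H a *ᵥ colB a (κ + 1) p) ^ 2) ∂γ ≤
        ENNReal.ofReal (400 * X ^ 2 / M) := by
    intro p
    rw [lintegral_resample hb κ κ' p (hm1 p p)]
    calc _ ≤ ∫⁻ _ : blockTridiag N M, ENNReal.ofReal (400 * X ^ 2 / M) ∂γ := by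
          refine lintegral_mono fun a => ?_
          simp only [hHr, colB_resample _ _ h, if_true]
          exact lintegral_quadratic_colB_sq_le hM h p hX (hHX a)
      _ = _ := by rw [lintegral_const, measure_univ, mul_one]
  have hsum : ∀ a, ENNReal.ofReal (frobSq ((B a (κ + 1)).transpose * H a * B a (κ + 1))) =
      ∑ p, ∑ q, ENNReal.ofReal ((colB a (κ + 1) p ⬝ᵥ H a *ᵥ colB a (κ + 1) q) ^ 2) := by
    intro a
    simp only [frobSq, hent]
    rw [ENNReal.ofReal_sum_of_nonneg fun p _ => Finset.sum_nonneg fun q _ => sq_nonneg _]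
    refine Finset.sum_congr rfl fun p _ => ?_
    rw [ENNReal.ofReal_sum_of_nonneg fun q _ => sq_nonneg _]
  simp only [hsum]
  rw [lintegral_finsetSum _ fun p _ => Finset.measurable_sum _ fun q _ => hm1 p q]
  simp only [lintegral_finsetSum _ fun q _ => hm1 _ q]
  calc _ ≤ ∑ p : Fin M, ∑ q : Fin M, ENNReal.ofReal
        ((if p = q then 400 * X ^ 2 / M else 0) + 4 * X ^ 2 / M ^ 2) := by
        refine Finset.sum_le_sum fun p _ => Finset.sum_le_sum fun q _ => ?_
        by_cases hpq : p = q
        · subst hpq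
          refine (hdiag p).trans (ENNReal.ofReal_le_ofReal ?_)
          rw [if_pos rfl]
          have : 0 ≤ 4 * X ^ 2 / (M : ℝ) ^ 2 := by positivity
          linarith
        · rw [if_neg hpq, zero_add]
          exact hoff p q hpq
    _ = ENNReal.ofReal (∑ p : Fin M, ∑ q : Fin M,
        ((if p = q then 400 * X ^ 2 / M else 0) + 4 * X ^ 2 / M ^ 2)) := by
        have h0 : ∀ p q : Fin M, 0 ≤ (if p = q then 400 * X ^ 2 / (M : ℝ) else 0) +
            4 * X ^ 2 / (M : ℝ) ^ 2 := fun p q => by split_ifs <;> positivity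
        rw [ENNReal.ofReal_sum_of_nonneg fun p _ => Finset.sum_nonneg fun q _ => h0 p q]
        refine Finset.sum_congr rfl fun p _ => ?_
        rw [ENNReal.ofReal_sum_of_nonneg fun q _ => h0 p q]
    _ = ENNReal.ofReal (404 * X ^ 2) := by
        congr 1
        simp only [Finset.sum_add_distrib, Finset.sum_ite_eq, Finset.mem_univ, if_true,
          Finset.sum_const, Finset.card_univ, Fintype.card_fin, nsmul_eq_mul]
        field_simp
        ring

/-- The tail of `Y_k = B_k* D_k⁻¹ B_k`, for every truncation level `X` of `‖D_k⁻¹‖_F`. -/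
theorem isoGauss_frobSq_Y_ge_le (hM : 0 < M) {κ κ' : Fin N} (h : (κ' : ℕ) = κ + 1) (lam : ℝ)
    {X τ : ℝ} (hX : 0 < X) (hτ : 0 < τ) :
    isoGauss (blockTridiag N M) ((M : ℝ) / 4) {a | τ ≤ frobSq (Y lam a (κ + 1))} ≤
      ENNReal.ofReal (3276800000 * M / X + 404 * X ^ 2 / τ) := by
  classical
  have hM' : (0 : ℝ) < M := by exact_mod_cast hM
  -- `D_k⁻¹` has no second moment and is truncated at the level `X`
  set H : blockTridiag N M → Matrix (Fin M) (Fin M) ℝ := fun a =>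
    if frobSq (D lam a (κ + 1))⁻¹ ≤ X ^ 2 then (D lam a (κ + 1))⁻¹ else 0 with hHdef
  have hH : ∀ p q, Measurable fun a => H a p q := by
    intro p q
    have : (fun a => H a p q) = fun a => if frobSq (D lam a (κ + 1))⁻¹ ≤ X ^ 2 then
        (D lam a (κ + 1))⁻¹ p q else 0 := by
      funext a
      simp only [hHdef]
      split_ifs <;> rfl
    rw [this]
    exact Measurable.ite (measurableSet_le (measurable_frobSq (measurable_D_inv lam _))
      measurable_const) (measurable_D_inv lam _ p q) measurable_const
  have hHX : ∀ a, frobSq (H a) ≤ X ^ 2 := by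
    intro a
    simp only [hHdef]
    split_ifs with h1
    · exact h1
    · simp only [frobSq, Matrix.zero_apply]
      simp
      positivity
  have hlin := lintegral_frobSq_conj_le hM h hH (fun a b hab => by
    simp only [hHdef, D_congr lam hab]) hX hHX
  have hmarkov := mul_meas_ge_le_lintegral (μ := isoGauss (blockTridiag N M) ((M : ℝ) / 4))
    (f := fun a => ENNReal.ofReal (frobSq ((B a (κ + 1)).transpose * H a * B a (κ + 1))))
    (measurable_frobSq (measurable_matrix_mul (measurable_matrix_mul
      (fun p q => measurable_B _ q p) hH) (measurable_B _))).ennreal_ofReal (ENNReal.ofReal τ)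
  have hsub : {a : blockTridiag N M | τ ≤ frobSq (Y lam a (κ + 1))} ⊆
      {a | X ^ 2 ≤ frobSq (D lam a (κ + 1))⁻¹} ∪ {a | ENNReal.ofReal τ ≤
        ENNReal.ofReal (frobSq ((B a (κ + 1)).transpose * H a * B a (κ + 1)))} := by
    intro a ha
    rcases le_total (X ^ 2) (frobSq (D lam a (κ + 1))⁻¹) with h1 | h1
    · exact Or.inl h1
    · right
      rw [Set.mem_ofPred_eq] at ha ⊢
      refine ENNReal.ofReal_le_ofReal ?_
      simp only [hHdef, if_pos h1]
      exact ha
  refine (measure_mono hsub).trans ((measure_union_le _ _).trans ?_)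
  rw [ENNReal.ofReal_add (by positivity) (by positivity)]
  refine add_le_add (isoGauss_frobSq_inv_ge_le hM κ lam hX) ?_
  rw [ENNReal.ofReal_div_of_pos hτ, ENNReal.le_div_iff_mul_le
    (Or.inl (by simpa using hτ)) (Or.inl ENNReal.ofReal_ne_top), mul_comm]
  exact hmarkov.trans hlin

end OffDiagonal

/-! ### Tails of `D_k` and square integrability of `log S_k` -/

section Tails

variable {N M : ℕ}

theorem frobSq_smul {n : Type*} [Fintype n] (c : ℝ) (m : Matrix n n ℝ) :
    frobSq (c • m) = c ^ 2 * frobSq m := by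
  simp only [frobSq, Matrix.smul_apply, smul_eq_mul, mul_pow, Finset.mul_sum]

theorem frobSq_sub_sub_le {n : Type*} [Fintype n] (m m' m'' : Matrix n n ℝ) :
    frobSq (m - m' - m'') ≤ 3 * (frobSq m + frobSq m' + frobSq m'') := by
  simp only [frobSq, ← Finset.sum_add_distrib, Finset.mul_sum]
  refine Finset.sum_le_sum fun p _ => Finset.sum_le_sum fun q _ => ?_
  simp only [Matrix.sub_apply]
  nlinarith [sq_nonneg (m p q + m' p q), sq_nonneg (m p q + m'' p q),
    sq_nonneg (m' p q - m'' p q)]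

theorem norm_toEuclideanCLM_sq_le (m : Matrix (Fin M) (Fin M) ℝ) :
    ‖Matrix.toEuclideanCLM (n := Fin M) (𝕜 := ℝ) m‖ ^ 2 ≤ frobSq m := by
  have h : ‖Matrix.toEuclideanCLM (n := Fin M) (𝕜 := ℝ) m‖ ≤ Real.sqrt (frobSq m) := by
    refine ContinuousLinearMap.opNorm_le_bound _ (Real.sqrt_nonneg _) fun x => ?_
    refine (pow_le_pow_iff_left₀ (norm_nonneg _) (by positivity) two_ne_zero).1 ?_
    rw [mul_pow, Real.sq_sqrt (frobSq_nonneg m), EuclideanSpace.norm_sq_eq,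
      EuclideanSpace.norm_sq_eq, frobSq, Finset.sum_mul]
    refine Finset.sum_le_sum fun p _ => ?_
    simp only [Real.norm_eq_abs, sq_abs]
    rw [Matrix.ofLp_toEuclideanCLM]
    exact Finset.sum_mul_sq_le_sq_mul_sq Finset.univ (m p) x.ofLp
  calc _ ≤ Real.sqrt (frobSq m) ^ 2 := by gcongr
    _ = frobSq m := Real.sq_sqrt (frobSq_nonneg m)

theorem one_le_norm_toEuclideanCLM_mul (hM : 0 < M) {m : Matrix (Fin M) (Fin M) ℝ}
    (hm : m.det ≠ 0) : 1 ≤ ‖Matrix.toEuclideanCLM (n := Fin M) (𝕜 := ℝ) m⁻¹‖ *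
      ‖Matrix.toEuclideanCLM (n := Fin M) (𝕜 := ℝ) m‖ := by
  have : Nonempty (Fin M) := ⟨⟨0, hM⟩⟩
  have : Nontrivial (EuclideanSpace ℝ (Fin M)) := inferInstance
  have h1 : Matrix.toEuclideanCLM (n := Fin M) (𝕜 := ℝ) m⁻¹ *
      Matrix.toEuclideanCLM (n := Fin M) (𝕜 := ℝ) m = 1 := by
    rw [← map_mul, Matrix.nonsing_inv_mul _ (isUnit_iff_ne_zero.2 hm), map_one]
  calc (1 : ℝ) = ‖(1 : EuclideanSpace ℝ (Fin M) →L[ℝ] EuclideanSpace ℝ (Fin M))‖ := by simp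
    _ ≤ _ := by rw [← h1]; exact norm_mul_le _ _

theorem isoGauss_frobSq_block_ge_le (hM : 0 < M) (κ : Fin N) {τ : ℝ} (hτ : 0 < τ) :
    isoGauss (blockTridiag N M) ((M : ℝ) / 4) {a | τ ≤ frobSq (block a (κ + 1) (κ + 1))} ≤
      ENNReal.ofReal (2 * M / τ) := by
  have hM' : (0 : ℝ) < M := by exact_mod_cast hM
  have hb : (0 : ℝ) < (M : ℝ) / 4 := by positivity
  have := isProbabilityMeasure_isoGauss (E := blockTridiag N M) hb
  set v : Fin M × Fin M → blockTridiag N M := fun x =>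
    emb κ κ (abs_sub_self_le κ) (Matrix.single x.1 x.2 1) with hv
  have hv1 : ∀ x, ‖v x‖ ^ 2 ≤ 1 := by
    intro x
    refine (norm_emb_sq_le _ _ _ _).trans_eq ?_
    rw [frobSq, Finset.sum_eq_single x.1, Finset.sum_eq_single x.2]
    · simp
    · intro q _ hq; simp [hq.symm]
    · simp
    · intro p _ hp; simp [hp.symm]
    · simp
  have hin : ∀ a, frobSq (block a (κ + 1) (κ + 1)) = ∑ x, (inner ℝ (v x) a) ^ 2 := by
    intro a
    rw [frobSq, Fintype.sum_prod_type]
    refine Finset.sum_congr rfl fun p _ => Finset.sum_congr rfl fun q _ => ?_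
    rw [block_succ, hv]
    dsimp only
    rw [inner_emb, Finset.sum_eq_single p, Finset.sum_eq_single q]
    · simp
    · intro q' _ hq; simp [hq.symm]
    · simp
    · intro p' _ hp; simp [hp.symm]
    · simp
  have h1 : ∫ a, ∑ x, (inner ℝ (v x) a) ^ 2 ∂(isoGauss (blockTridiag N M) ((M : ℝ) / 4)) ≤
      2 * M := by
    rw [integral_sum_inner_sq hb]
    calc ∑ x, ‖v x‖ ^ 2 / (2 * ((M : ℝ) / 4)) ≤ ∑ _x : Fin M × Fin M, 1 / (2 * ((M : ℝ) / 4)) :=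
          Finset.sum_le_sum fun x _ => by gcongr; exact hv1 x
      _ = 2 * M := by
          simp only [Finset.sum_const, Finset.card_univ, Fintype.card_prod, Fintype.card_fin,
            nsmul_eq_mul]
          push_cast; field_simp; norm_num
  have h2 := mul_meas_ge_le_integral_of_nonneg
    (Filter.Eventually.of_forall fun a => Finset.sum_nonneg fun x _ => sq_nonneg (inner ℝ (v x) a))
    (integrable_sum_inner_sq hb v) τ
  simp only [hin]
  rw [← ofReal_measureReal]
  refine ENNReal.ofReal_le_ofReal ?_
  rw [le_div_iff₀ hτ, mul_comm]
  exact h2.trans h1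

/-- Tails of `‖D_k‖_F²` for `k ≥ 2`, from those of the three terms of the recursion. -/
theorem isoGauss_frobSq_D_ge_le (hM : 0 < M) {κ κ' : Fin N} (h : (κ' : ℕ) = κ + 1) (lam : ℝ)
    {X τ : ℝ} (hX : 0 < X) (hτ : 0 < τ) :
    isoGauss (blockTridiag N M) ((M : ℝ) / 4) {a | 9 * τ ≤ frobSq (D lam a (κ' + 1))} ≤
      ENNReal.ofReal (2 * M / τ + lam ^ 2 * M / τ +
        (3276800000 * M / X + 404 * X ^ 2 / τ)) := by
  have hM' : (0 : ℝ) < M := by exact_mod_cast hM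
  have hb : (0 : ℝ) < (M : ℝ) / 4 := by positivity
  have := isProbabilityMeasure_isoGauss (E := blockTridiag N M) hb
  rw [ENNReal.ofReal_add (by positivity) (by positivity), ENNReal.ofReal_add (by positivity)
    (by positivity)]
  have hsub : {a : blockTridiag N M | 9 * τ ≤ frobSq (D lam a (κ' + 1))} ⊆
      ({a | τ ≤ frobSq (block a (κ' + 1) (κ' + 1))} ∪ {_a | τ ≤ lam ^ 2 * M}) ∪
        {a | τ ≤ frobSq (Y lam a (κ + 1))} := by
    intro a ha
    rw [Set.mem_ofPred_eq, D_succ, h] at ha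
    have h1 := ha.trans (frobSq_sub_sub_le _ _ _)
    rw [frobSq_smul, frobSq_one, Fintype.card_fin] at h1
    simp only [Set.mem_union, Set.mem_ofPred_eq]
    by_contra! hcon
    rw [h] at hcon
    linarith [hcon.1.1, hcon.1.2, hcon.2]
  refine (measure_mono hsub).trans ((measure_union_le _ _).trans (add_le_add
    ((measure_union_le _ _).trans (add_le_add (isoGauss_frobSq_block_ge_le hM κ' hτ) ?_))
    (isoGauss_frobSq_Y_ge_le hM h lam hX hτ)))
  by_cases hl : τ ≤ lam ^ 2 * M
  -- the event concerning `lam` is deterministic, and `lam ^ 2 * M / τ ≥ 1` if it occurs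
  · refine prob_le_one.trans ?_
    rw [← ENNReal.ofReal_one]
    exact ENNReal.ofReal_le_ofReal (by rwa [le_div_iff₀ hτ, one_mul])
  · simp [hl]

theorem ae_isoGauss {E : Type*} [NormedAddCommGroup E] [InnerProductSpace ℝ E]
    [FiniteDimensional ℝ E] [MeasurableSpace E] [BorelSpace E] {b : ℝ} {p : E → Prop}
    (h : ∀ᵐ a, p a) : ∀ᵐ a ∂(isoGauss E b), p a :=
  (withDensity_absolutelyContinuous _ _).ae_le h

/-- Almost surely, `D_k` is invertible: along the direction of the identity matrix in the block
`(k, k)`, its determinant is a characteristic polynomial. -/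
theorem ae_det_D_ne_zero (κ : Fin N) (lam b : ℝ) :
    ∀ᵐ a ∂(isoGauss (blockTridiag N M) b), (D lam a (κ + 1)).det ≠ 0 := by
  have hs : MeasurableSet {a : blockTridiag N M | (D lam a (κ + 1)).det ≠ 0} :=
    (measurable_matrix_det (measurable_D lam (κ + 1))) (measurableSet_singleton (0 : ℝ)).compl
  refine ae_isoGauss ?_
  refine ae_mem_of_ae_add_linearMap_mem (LinearMap.toSpanSingleton ℝ (blockTridiag N M)
    (emb κ κ (abs_sub_self_le κ) 1)) (volume : Measure ℝ) volume hs fun a => ?_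
  have hfin : Set.Finite {t : ℝ | (D lam a (κ + 1) + t • (1 : Matrix (Fin M) (Fin M) ℝ)).det = 0} := by
    refine ((-(D lam a (κ + 1))).charpoly.roots.toFinset.finite_toSet).subset fun t ht => ?_
    rw [Set.mem_ofPred_eq] at ht
    simp only [Finset.mem_coe, Multiset.mem_toFinset]
    rw [Polynomial.mem_roots (Matrix.charpoly_monic _).ne_zero, Polynomial.IsRoot,
      Matrix.eval_charpoly, sub_neg_eq_add, add_comm, ← ht]
    congr 2
    ext p q
    simp [Matrix.scalar_apply, Matrix.diagonal_apply, Matrix.one_apply]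
  refine Filter.mem_of_superset (compl_mem_ae_iff.2 (hfin.measure_zero volume)) fun t ht => ?_
  have e : a + LinearMap.toSpanSingleton ℝ (blockTridiag N M) (emb κ κ (abs_sub_self_le κ) 1) t =
      a + emb κ κ (abs_sub_self_le κ) (t • 1) := by
    rw [LinearMap.toSpanSingleton_apply, map_smul]
  change (D lam (a + LinearMap.toSpanSingleton ℝ (blockTridiag N M)
    (emb κ κ (abs_sub_self_le κ) 1) t) (κ + 1)).det ≠ 0
  rw [e, D_add_emb_self lam κ _ (by simp)]
  exact ht

/-- Exponential tails imply square integrability; `Z²` is summed over the level sets by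
`m² = 1 + 3 + ⋯ + (2 m - 1)`. -/
theorem memLp_two_of_exp_tail {Ω : Type*} [MeasurableSpace Ω] {P : Measure Ω} {Z : Ω → ℝ}
    (hZ : Measurable Z) {K q : ℝ} (hK : 0 ≤ K) (hq : 0 < q) (hq1 : q < 1)
    (h : ∀ n : ℕ, P {ω | (n : ℝ) ≤ |Z ω|} ≤ ENNReal.ofReal (K * q ^ n)) : MemLp Z 2 P := by
  rw [memLp_two_iff_integrable_sq hZ.aestronglyMeasurable]
  refine ⟨(hZ.pow_const 2).aestronglyMeasurable, ?_⟩
  have hms : ∀ n : ℕ, MeasurableSet {ω | (n : ℝ) ≤ |Z ω|} := fun n =>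
    measurableSet_le measurable_const hZ.abs
  have hsum : ∀ m : ℕ, ∑ n ∈ Finset.range m, (2 * (n : ℝ) + 1) = (m : ℝ) ^ 2 := by
    intro m
    induction m with
    | zero => simp
    | succ m ih => rw [Finset.sum_range_succ, ih]; push_cast; ring
  have hpt : ∀ ω, ‖Z ω ^ 2‖ₑ ≤ ∑' n : ℕ, ENNReal.ofReal (2 * n + 1) *
      {ω | (n : ℝ) ≤ |Z ω|}.indicator 1 ω := by
    intro ω
    refine le_trans ?_ (ENNReal.sum_le_tsum (Finset.range (⌊|Z ω|⌋₊ + 1)))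
    have e : ∀ n ∈ Finset.range (⌊|Z ω|⌋₊ + 1), ENNReal.ofReal (2 * n + 1) *
      {ω | (n : ℝ) ≤ |Z ω|}.indicator 1 ω = ENNReal.ofReal (2 * n + 1) := by
      intro n hn
      rw [Set.indicator_of_mem]
      · simp
      · exact (Nat.le_floor_iff (abs_nonneg _)).1 (Nat.lt_succ_iff.1 (Finset.mem_range.1 hn))
    rw [Finset.sum_congr rfl e, ← ENNReal.ofReal_sum_of_nonneg fun n _ => by positivity, hsum,
      Real.enorm_eq_ofReal (sq_nonneg _)]
    refine ENNReal.ofReal_le_ofReal ?_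
    rw [← sq_abs]
    gcongr
    push_cast
    exact (Nat.lt_floor_add_one _).le
  have hs : Summable fun n : ℕ => (2 * (n : ℝ) + 1) * (K * q ^ n) := by
    have h1 := summable_pow_mul_geometric_of_norm_lt_one 1 (r := q)
      (by rwa [Real.norm_of_nonneg hq.le])
    have h2 := summable_geometric_of_lt_one hq.le hq1
    refine ((h1.mul_left (2 * K)).add (h2.mul_left K)).congr fun n => ?_
    simp only [pow_one]; ring
  calc ∫⁻ ω, ‖Z ω ^ 2‖ₑ ∂P ≤ ∫⁻ ω, ∑' n : ℕ, ENNReal.ofReal (2 * n + 1) *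
        {ω | (n : ℝ) ≤ |Z ω|}.indicator 1 ω ∂P := lintegral_mono hpt
    _ = ∑' n : ℕ, ENNReal.ofReal (2 * n + 1) * P {ω | (n : ℝ) ≤ |Z ω|} := by
        rw [lintegral_tsum fun n =>
          ((measurable_one.indicator (hms n)).const_mul _).aemeasurable]
        refine tsum_congr fun n => ?_
        rw [lintegral_const_mul _ (measurable_one.indicator (hms n)),
          lintegral_indicator_one (hms n)]
    _ ≤ ∑' n : ℕ, ENNReal.ofReal ((2 * (n : ℝ) + 1) * (K * q ^ n)) := by
        refine ENNReal.tsum_le_tsum fun n => ?_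
        rw [ENNReal.ofReal_mul (by positivity)]
        gcongr
        exact h n
    _ = ENNReal.ofReal (∑' n : ℕ, (2 * (n : ℝ) + 1) * (K * q ^ n)) :=
        (ENNReal.ofReal_tsum_of_nonneg (fun n => by positivity) hs).symm
    _ < ⊤ := ENNReal.ofReal_lt_top

theorem S_pos_of_det (hM : 0 < M) {lam : ℝ} {a : blockTridiag N M} {k : ℕ}
    (h : (D lam a k).det ≠ 0) : 0 < S lam a k := by
  have h1 := one_le_norm_toEuclideanCLM_mul hM h
  refine lt_of_le_of_ne (norm_nonneg _) fun h0 => ?_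
  rw [S] at h0
  rw [← h0, mul_zero] at h1
  linarith

/-- Small values of `S_k` are excluded by the Wegner estimate, as `‖D_k‖ ‖D_k⁻¹‖ ≥ 1`, and large ones
by the tails of `‖D_k‖_F`; both tails decay like a power. -/
theorem memLp_log_S (hM : 0 < M) {κ κ' : Fin N} (h : (κ' : ℕ) = κ + 1) (lam : ℝ) :
    MemLp (fun a => Real.log (S lam a (κ' + 1))) 2
      (isoGauss (blockTridiag N M) ((M : ℝ) / 4)) := by
  have hM' : (0 : ℝ) < M := by exact_mod_cast hM
  set q : ℝ := Real.exp (-(1 / 2)) with hq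
  have hqp : 0 < q := Real.exp_pos _
  have hq1 : q < 1 := by rw [hq, Real.exp_lt_one_iff]; norm_num
  refine memLp_two_of_exp_tail (Real.measurable_log.comp (measurable_S lam (κ' + 1)))
    (K := 3276800000 * M + (9 * (2 * M) + 9 * (lam ^ 2 * M) + (3276800000 * M + 404 * 9)))
    (by positivity) hqp hq1 fun n => ?_
  -- `Λ = exp (n / 2)`
  set Λ : ℝ := q⁻¹ ^ n with hΛ
  have hΛp : 0 < Λ := by positivity
  have hΛ1 : 1 ≤ Λ := one_le_pow₀ (by rw [one_le_inv₀ hqp]; exact hq1.le)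
  have hexp : Real.exp n = Λ ^ 2 := by
    rw [hΛ, hq, ← Real.exp_neg, neg_neg, ← Real.exp_nat_mul, ← Real.exp_nat_mul]
    congr 1; push_cast; ring
  have hqn : q ^ n = 1 / Λ := by rw [hΛ, inv_pow, one_div, inv_inv]
  have hsub : {a : blockTridiag N M | (n : ℝ) ≤ |Real.log (S lam a (κ' + 1))|} ⊆
      ({a | (D lam a (κ' + 1)).det = 0} ∪ {a | (Λ ^ 2) ^ 2 ≤ frobSq (D lam a (κ' + 1))⁻¹}) ∪
        {a | 9 * (Λ ^ 4 / 9) ≤ frobSq (D lam a (κ' + 1))} := by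
    intro a ha
    rw [Set.mem_ofPred_eq] at ha
    simp only [Set.mem_union, Set.mem_ofPred_eq, or_assoc]
    by_cases hd : (D lam a (κ' + 1)).det = 0
    · exact Or.inl hd
    refine Or.inr ?_
    have hS := S_pos_of_det hM hd
    rcases le_abs'.1 ha with h1 | h1
    · left
      have h2 : S lam a (κ' + 1) ≤ (Λ ^ 2)⁻¹ := by
        rw [← hexp, ← Real.exp_neg, ← Real.exp_log hS]
        exact Real.exp_le_exp.2 h1
      have h3 := one_le_norm_toEuclideanCLM_mul hM hd
      have h4 : 1 ≤ ‖Matrix.toEuclideanCLM (n := Fin M) (𝕜 := ℝ) (D lam a (κ' + 1))⁻¹‖ *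
          (Λ ^ 2)⁻¹ := h3.trans (mul_le_mul_of_nonneg_left h2 (norm_nonneg _))
      rw [← div_eq_mul_inv, one_le_div (by positivity)] at h4
      calc (Λ ^ 2) ^ 2 ≤ ‖Matrix.toEuclideanCLM (n := Fin M) (𝕜 := ℝ) (D lam a (κ' + 1))⁻¹‖ ^ 2 := by
            gcongr
        _ ≤ _ := norm_toEuclideanCLM_sq_le _
    · right
      have h2 : Λ ^ 2 ≤ S lam a (κ' + 1) := by
        rw [← hexp, ← Real.exp_log hS]
        exact Real.exp_le_exp.2 h1
      calc 9 * (Λ ^ 4 / 9) = (Λ ^ 2) ^ 2 := by ring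
        _ ≤ S lam a (κ' + 1) ^ 2 := by gcongr
        _ ≤ _ := norm_toEuclideanCLM_sq_le _
  have hdet : isoGauss (blockTridiag N M) ((M : ℝ) / 4) {a | (D lam a (κ' + 1)).det = 0} = 0 := by
    have := ae_det_D_ne_zero (M := M) κ' lam ((M : ℝ) / 4)
    rw [ae_iff] at this
    simpa using this
  refine (measure_mono hsub).trans ((measure_union_le _ _).trans ?_)
  have h1 := isoGauss_frobSq_inv_ge_le hM κ' lam (X := Λ ^ 2) (by positivity)
  have h2 := isoGauss_frobSq_D_ge_le hM h lam (X := Λ) (τ := Λ ^ 4 / 9) hΛp (by positivity)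
  have h3 : isoGauss (blockTridiag N M) ((M : ℝ) / 4) ({a | (D lam a (κ' + 1)).det = 0} ∪
      {a | (Λ ^ 2) ^ 2 ≤ frobSq (D lam a (κ' + 1))⁻¹}) ≤ ENNReal.ofReal (3276800000 * M / Λ ^ 2) := by
    refine (measure_union_le _ _).trans ?_
    rw [hdet, zero_add]
    exact h1
  refine (add_le_add h3 h2).trans ?_
  rw [← ENNReal.ofReal_add (by positivity) (by positivity)]
  refine ENNReal.ofReal_le_ofReal ?_
  rw [hqn, add_mul, add_mul, add_mul, add_mul]
  have hp2 : 1 / Λ ^ 2 ≤ 1 / Λ := by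
    gcongr; nlinarith
  have hp4 : 1 / Λ ^ 4 ≤ 1 / Λ := by
    gcongr; exact le_self_pow₀ hΛ1 (by norm_num)
  refine add_le_add ?_ (add_le_add (add_le_add ?_ ?_) (add_le_add ?_ ?_))
  · rw [div_eq_mul_one_div]; gcongr
  · calc _ = 9 * (2 * (M : ℝ)) * (1 / Λ ^ 4) := by field_simp
      _ ≤ _ := by gcongr
  · calc _ = 9 * (lam ^ 2 * (M : ℝ)) * (1 / Λ ^ 4) := by field_simp
      _ ≤ _ := by gcongr
  · rw [div_eq_mul_one_div]
  · calc _ = 404 * 9 * (1 / Λ ^ 2) := by field_simp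
      _ ≤ _ := by gcongr

end Tails

/-! ### The flow scaling `D_k` -/

section ScalingFlow

variable {N M : ℕ}

/-- The junk value `0` of the inverse of a singular matrix is consistent with scaling, so that no
invertibility is needed. -/
theorem inv_smul_matrix {n : Type*} [Fintype n] [DecidableEq n] {c : ℝ} (hc : c ≠ 0)
    (m : Matrix n n ℝ) : (c • m)⁻¹ = c⁻¹ • m⁻¹ := by
  by_cases h : IsUnit m.det
  · have := Matrix.inv_smul' (A := m) (Units.mk0 c hc) h
    simpa [Units.smul_def] using this
  · have h' : ¬IsUnit (c • m).det := by
      rw [Matrix.det_smul, IsUnit.mul_iff, not_and]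
      exact fun _ => h
    rw [Matrix.nonsing_inv_apply_not_isUnit _ h, Matrix.nonsing_inv_apply_not_isUnit _ h',
      smul_zero]

/-- The flow that multiplies `D_k` by `exp x` and leaves `D_j` for `j ≠ k` and all `B_j`
unchanged. The block `(k, k)` absorbs the change of `D_k`, and the block `(k + 1, k + 1)` the
resulting change of `B_k* D_k⁻¹ B_k`. Here `k = κ + 1`, as blocks are numbered from `1`. -/
noncomputable def scaleFlow (κ κ' : Fin N) (lam x : ℝ) (a : blockTridiag N M) :
    blockTridiag N M :=
  a + emb κ κ (abs_sub_self_le κ) ((Real.exp x - 1) • D lam a (κ + 1)) +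
    emb κ' κ' (abs_sub_self_le κ') ((Real.exp (-x) - 1) • Y lam a (κ + 1))

variable {κ κ' : Fin N}

theorem smul_transpose {n : Type*} {m : Matrix n n ℝ} (h : m.transpose = m) (c : ℝ) :
    (c • m).transpose = c • m := by rw [Matrix.transpose_smul, h]

theorem B_scaleFlow (lam x : ℝ) (a : blockTridiag N M) (j : ℕ) :
    B (scaleFlow κ κ' lam x a) j = B a j := by
  rw [scaleFlow, B_add_emb, B_add_emb]

theorem D_scaleFlow_of_le (h : (κ' : ℕ) = κ + 1) (lam x : ℝ) (a : blockTridiag N M) {j : ℕ}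
    (hj : j ≤ κ) : D lam (scaleFlow κ κ' lam x a) j = D lam a j := by
  rw [scaleFlow, D_add_emb_of_le _ _ _ _ _ (by omega), D_add_emb_of_le _ _ _ _ _ hj]

theorem D_scaleFlow_self (h : (κ' : ℕ) = κ + 1) (lam x : ℝ) (a : blockTridiag N M) :
    D lam (scaleFlow κ κ' lam x a) (κ + 1) = Real.exp x • D lam a (κ + 1) := by
  rw [scaleFlow, D_add_emb_of_le _ _ _ _ _ (by omega),
    D_add_emb_self _ _ _ (smul_transpose (D_symm lam a _) _)]
  module

theorem Y_smul {lam c : ℝ} (hc : c ≠ 0) {a b : blockTridiag N M} {j : ℕ} (hB : B b j = B a j)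
    (hD : D lam b j = c • D lam a j) : Y lam b j = c⁻¹ • Y lam a j := by
  rw [Y, Y, hB, hD, inv_smul_matrix hc, Matrix.mul_smul, Matrix.smul_mul]

theorem Y_scaleFlow (h : (κ' : ℕ) = κ + 1) (lam x : ℝ) (a : blockTridiag N M) :
    Y lam (scaleFlow κ κ' lam x a) (κ + 1) = Real.exp (-x) • Y lam a (κ + 1) := by
  rw [Real.exp_neg]
  exact Y_smul (Real.exp_ne_zero x) (B_scaleFlow lam x a _) (D_scaleFlow_self h lam x a)

theorem D_scaleFlow_succ (h : (κ' : ℕ) = κ + 1) (lam x : ℝ) (a : blockTridiag N M) :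
    D lam (scaleFlow κ κ' lam x a) (κ' + 1) = D lam a (κ' + 1) := by
  have hY := Y_scaleFlow h lam x a
  rw [← h] at hY
  rw [D_succ, D_succ, hY, scaleFlow, block_add_emb_self _ _ (smul_transpose (Y_symm lam a _) _),
    block_emb _ _ _ _ _ (by omega) (by omega), h]
  module

theorem S_scaleFlow (h : (κ' : ℕ) = κ + 1) (lam x : ℝ) (a : blockTridiag N M) :
    S lam (scaleFlow κ κ' lam x a) (κ + 1) = Real.exp x * S lam a (κ + 1) := by
  rw [S, D_scaleFlow_self h, map_smul, norm_smul, Real.norm_of_nonneg (Real.exp_nonneg x), S]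

theorem Dbar_scaleFlow (h : (κ' : ℕ) = κ + 1) (lam x : ℝ) (a : blockTridiag N M) :
    Dbar lam (scaleFlow κ κ' lam x a) (κ + 1) = Dbar lam a (κ + 1) := by
  rw [Dbar, Dbar, S_scaleFlow h, D_scaleFlow_self h, smul_smul, mul_inv_rev, mul_assoc,
    inv_mul_cancel₀ (Real.exp_ne_zero x), mul_one]

theorem scaleFlow_neg_scaleFlow (h : (κ' : ℕ) = κ + 1) (lam x : ℝ) (a : blockTridiag N M) :
    scaleFlow κ κ' lam (-x) (scaleFlow κ κ' lam x a) = a := by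
  have he : Real.exp (-x) * Real.exp x = 1 := by rw [← Real.exp_add]; simp
  rw [scaleFlow, D_scaleFlow_self h, Y_scaleFlow h, scaleFlow, neg_neg, smul_smul, smul_smul,
    sub_mul, sub_mul, he, mul_comm (Real.exp x), he, one_mul, one_mul]
  simp only [map_smul]
  module

/-- The component of a matrix in the block `(κ, κ)`. -/
noncomputable def diagBlockProj (κ : Fin N) : blockTridiag N M →ₗ[ℝ] blockTridiag N M :=
  (emb κ κ (abs_sub_self_le κ)).comp
    ({toFun := fun a => block a (κ + 1) (κ + 1)
      map_add' := fun a b => by ext p q; simp only [block_succ, Matrix.add_apply, toMat_add]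
      map_smul' := fun c a => by
        ext p q
        simp only [block_succ, Matrix.smul_apply, toMat_smul, RingHom.id_apply, smul_eq_mul] } :
      blockTridiag N M →ₗ[ℝ] Matrix (Fin M) (Fin M) ℝ)

theorem diagBlockProj_apply (κ : Fin N) (a : blockTridiag N M) :
    diagBlockProj κ a = emb κ κ (abs_sub_self_le κ) (block a (κ + 1) (κ + 1)) := rfl

theorem diagBlockProj_emb (κ : Fin N) {m : Matrix (Fin M) (Fin M) ℝ} (hm : m.transpose = m) :
    diagBlockProj κ (emb κ κ (abs_sub_self_le κ) m) = emb κ κ (abs_sub_self_le κ) m := by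
  have h := block_add_emb_self κ (abs_sub_self_le κ) hm (0 : blockTridiag N M)
  have h0 : block (0 : blockTridiag N M) (κ + 1) (κ + 1) = 0 := by
    ext p q; rw [block_succ]; rfl
  rw [zero_add, h0, zero_add] at h
  rw [diagBlockProj_apply, h]

/-- The flow multiplies Lebesgue measure by a constant: it rescales the block `(k, k)` about a point
depending on the earlier blocks, and then shifts the block `(k + 1, k + 1)`. -/
theorem map_scaleFlow (h : (κ' : ℕ) = κ + 1) (lam x : ℝ) : ∃ c : ENNReal, c ≠ 0 ∧ c ≠ ⊤ ∧
    (volume : Measure (blockTridiag N M)).map (scaleFlow κ κ' lam x) = c • volume := by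
  set ψ : blockTridiag N M → blockTridiag N M := fun a =>
    emb κ κ (abs_sub_self_le κ) (lam • (1 : Matrix (Fin M) (Fin M) ℝ) + Y lam a κ) with hψ
  have hψm : Measurable ψ := by
    refine measurable_emb_apply _ _ _ fun p q => ?_
    simp only [Matrix.add_apply]
    exact measurable_const.add (measurable_Y lam κ p q)
  obtain ⟨c, hc, hc', hmap⟩ := map_rescale_shear (Q := diagBlockProj (M := M) κ)
    (fun a => diagBlockProj_emb κ (block_transpose a _ _)) hψm
    (fun a => diagBlockProj_emb κ (by
      rw [Matrix.transpose_add, Matrix.transpose_smul, Matrix.transpose_one, Y_symm]))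
    (fun a v => by
      rw [hψ]
      dsimp only
      rw [diagBlockProj_apply, Y, Y, B_add_emb, D_add_emb_of_le _ _ _ _ _ le_rfl]) x
  have hR : ∀ a, a + (Real.exp x - 1) • (diagBlockProj κ a - ψ a) =
      a + emb κ κ (abs_sub_self_le κ) ((Real.exp x - 1) • D lam a (κ + 1)) := by
    intro a
    rw [hψ, diagBlockProj_apply, ← map_sub, ← map_smul, D_succ, sub_sub]
  set φ : blockTridiag N M → blockTridiag N M := fun a =>
    emb κ' κ' (abs_sub_self_le κ') ((1 - Real.exp x) • Y lam a (κ + 1)) with hφ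
  have hφm : Measurable φ := by
    refine measurable_emb_apply _ _ _ fun p q => ?_
    simp only [Matrix.smul_apply, smul_eq_mul]
    exact (measurable_Y lam _ p q).const_mul _
  have hsh := measurePreserving_shear (LinearMap.range (emb (M := M) κ' κ' (abs_sub_self_le κ')))
    hφm (fun a => ⟨_, rfl⟩) (by
      rintro a _ ⟨m, rfl⟩
      rw [hφ]
      dsimp only
      rw [Y, Y, B_add_emb, D_add_emb_of_le _ _ _ _ _ (by omega)])
  have hRm : Measurable fun a : blockTridiag N M =>
      a + (Real.exp x - 1) • (diagBlockProj κ a - ψ a) := by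
    have h1 : Measurable fun a : blockTridiag N M => diagBlockProj κ a - ψ a :=
      (diagBlockProj κ).continuous_of_finiteDimensional.measurable.sub hψm
    exact measurable_id.add (h1.const_smul (Real.exp x - 1))
  refine ⟨c, hc, hc', ?_⟩
  have hcomp : scaleFlow κ κ' lam x = (fun a => a + φ a) ∘
      (fun a : blockTridiag N M => a + (Real.exp x - 1) • (diagBlockProj κ a - ψ a)) := by
    funext a
    rw [Function.comp_apply, hR, scaleFlow, hφ]
    dsimp only
    rw [Y_smul (a := a) (Real.exp_ne_zero x) (B_add_emb _ _ _ _ _) (by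
      rw [D_add_emb_self _ _ _ (smul_transpose (D_symm lam a _) _)]; module), smul_smul, sub_mul,
      one_mul, mul_inv_cancel₀ (Real.exp_ne_zero x), Real.exp_neg]
  rw [hcomp, ← Measure.map_map hsh.measurable hRm, hmap, Measure.map_smul, hsh.map_eq]

theorem measurable_scaleFlow (κ κ' : Fin N) (lam x : ℝ) :
    Measurable (scaleFlow (M := M) κ κ' lam x) := by
  refine (measurable_id.add (measurable_emb_apply _ _ _ fun p q => ?_)).add
    (measurable_emb_apply _ _ _ fun p q => ?_)
  · simp only [Matrix.smul_apply, smul_eq_mul]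
    exact (measurable_D lam _ p q).const_mul _
  · simp only [Matrix.smul_apply, smul_eq_mul]
    exact (measurable_Y lam _ p q).const_mul _

/-- The squared size of the data entering the flow. It controls the change of the density, see
`norm_sq_scaleFlow_le`. -/
noncomputable def flowSize (κ κ' : Fin N) (lam : ℝ) (a : blockTridiag N M) : ℝ :=
  frobSq (D lam a (κ + 1)) + frobSq (Y lam a (κ + 1)) + frobSq (block a (κ + 1) (κ + 1)) +
    frobSq (block a (κ' + 1) (κ' + 1))

theorem inner_emb_le (κ : Fin N) (m : Matrix (Fin M) (Fin M) ℝ) (a : blockTridiag N M) :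
    inner ℝ (emb κ κ (abs_sub_self_le κ) m) a ≤
      (frobSq m + frobSq (block a (κ + 1) (κ + 1))) / 2 := by
  rw [inner_emb, frobSq, frobSq, ← Finset.sum_add_distrib, Finset.sum_div]
  refine Finset.sum_le_sum fun p _ => ?_
  rw [← Finset.sum_add_distrib, Finset.sum_div]
  refine Finset.sum_le_sum fun q _ => ?_
  rw [block_succ]
  nlinarith [sq_nonneg (m p q - toMat a.1 (κ, p) (κ, q))]

theorem norm_sq_add_add_norm_sq_add_le {E : Type*} [NormedAddCommGroup E] [InnerProductSpace ℝ E]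
    (a u v : E) (α β : ℝ) : ‖a + (α • u + β • v)‖ ^ 2 + ‖a + (β • u + α • v)‖ ^ 2 ≤
      2 * ‖a‖ ^ 2 + 2 * ((α + β) * (inner ℝ u a + inner ℝ v a)) +
        2 * (α ^ 2 * ‖u‖ ^ 2 + β ^ 2 * ‖u‖ ^ 2 + α ^ 2 * ‖v‖ ^ 2 + β ^ 2 * ‖v‖ ^ 2) := by
  have hsq : ∀ s t : ℝ, ‖s • u + t • v‖ ^ 2 ≤ 2 * (s ^ 2 * ‖u‖ ^ 2 + t ^ 2 * ‖v‖ ^ 2) := by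
    intro s t
    have h1 := norm_add_le (s • u) (t • v)
    have h2 : ‖s • u + t • v‖ ^ 2 ≤ (‖s • u‖ + ‖t • v‖) ^ 2 := by gcongr
    have h3 : s ^ 2 * ‖u‖ ^ 2 = ‖s • u‖ ^ 2 := by rw [norm_smul, mul_pow, Real.norm_eq_abs, sq_abs]
    have h4 : t ^ 2 * ‖v‖ ^ 2 = ‖t • v‖ ^ 2 := by rw [norm_smul, mul_pow, Real.norm_eq_abs, sq_abs]
    rw [h3, h4]
    nlinarith [sq_nonneg (‖s • u‖ - ‖t • v‖)]
  have hin : ∀ s t : ℝ, inner ℝ a (s • u + t • v) = s * inner ℝ u a + t * inner ℝ v a := by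
    intro s t
    rw [inner_add_right, real_inner_smul_right, real_inner_smul_right, real_inner_comm,
      real_inner_comm v]
  rw [norm_add_sq_real a, norm_add_sq_real a, hin, hin]
  linarith [hsq α β, hsq β α]

/-- The first order terms of the flow cancel between `x` and `-x`. -/
theorem norm_sq_scaleFlow_le (κ κ' : Fin N) (lam : ℝ) {x : ℝ} (hx : |x| ≤ 1)
    (a : blockTridiag N M) :
    ‖scaleFlow κ κ' lam x a‖ ^ 2 + ‖scaleFlow κ κ' lam (-x) a‖ ^ 2 ≤
      2 * ‖a‖ ^ 2 + 18 * x ^ 2 * flowSize κ κ' lam a := by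
  set u := emb κ κ (abs_sub_self_le κ) (D lam a (κ + 1)) with hu
  set v := emb κ' κ' (abs_sub_self_le κ') (Y lam a (κ + 1)) with hv
  set α := Real.exp x - 1 with hα
  set β := Real.exp (-x) - 1 with hβ
  have e1 : scaleFlow κ κ' lam x a = a + (α • u + β • v) := by
    rw [scaleFlow, map_smul, map_smul, add_assoc]
  have e2 : scaleFlow κ κ' lam (-x) a = a + (β • u + α • v) := by
    rw [scaleFlow, map_smul, map_smul, add_assoc, neg_neg]
  have hα2 : α ^ 2 ≤ 4 * x ^ 2 := by
    have := Real.abs_exp_sub_one_le hx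
    calc α ^ 2 = |α| ^ 2 := (sq_abs _).symm
      _ ≤ (2 * |x|) ^ 2 := by gcongr
      _ = 4 * x ^ 2 := by rw [mul_pow, sq_abs]; norm_num
  have hβ2 : β ^ 2 ≤ 4 * x ^ 2 := by
    have := Real.abs_exp_sub_one_le (x := -x) (by rwa [abs_neg])
    calc β ^ 2 = |β| ^ 2 := (sq_abs _).symm
      _ ≤ (2 * |-x|) ^ 2 := by gcongr
      _ = 4 * x ^ 2 := by rw [mul_pow, sq_abs]; norm_num
  have hs2 : α + β ≤ 2 * x ^ 2 := by
    have h1 := (abs_le.1 (Real.abs_exp_sub_one_sub_id_le hx)).2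
    have h2 := (abs_le.1 (Real.abs_exp_sub_one_sub_id_le (x := -x) (by rwa [abs_neg]))).2
    rw [hα, hβ]; linarith [neg_sq x]
  have hs0 : 0 ≤ α + β := by
    have h1 := Real.add_one_le_exp x
    have h2 := Real.add_one_le_exp (-x)
    rw [hα, hβ]; linarith
  have hun : ‖u‖ ^ 2 ≤ frobSq (D lam a (κ + 1)) := norm_emb_sq_le _ _ _ _
  have hvn : ‖v‖ ^ 2 ≤ frobSq (Y lam a (κ + 1)) := norm_emb_sq_le _ _ _ _
  have hui := inner_emb_le κ (D lam a (κ + 1)) a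
  have hvi := inner_emb_le κ' (Y lam a (κ + 1)) a
  rw [← hu] at hui
  rw [← hv] at hvi
  rw [e1, e2]
  refine (norm_sq_add_add_norm_sq_add_le a u v α β).trans ?_
  have hx2 : 0 ≤ x ^ 2 := sq_nonneg x
  have hb1 := frobSq_nonneg (block a (κ + 1) (κ + 1))
  have hb2 := frobSq_nonneg (block a (κ' + 1) (κ' + 1))
  have hb3 := frobSq_nonneg (D lam a (κ + 1))
  have hb4 := frobSq_nonneg (Y lam a (κ + 1))
  rw [flowSize]
  generalize frobSq (block a (κ + 1) (κ + 1)) = g1 at *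
  generalize frobSq (block a (κ' + 1) (κ' + 1)) = g2 at *
  generalize frobSq (D lam a (κ + 1)) = g3 at *
  generalize frobSq (Y lam a (κ + 1)) = g4 at *
  generalize inner ℝ u a = iu at *
  generalize inner ℝ v a = iv at *
  have h3 : (α + β) * (iu + iv) ≤ (2 * x ^ 2) * ((g3 + g1) / 2 + (g4 + g2) / 2) :=
    calc (α + β) * (iu + iv) ≤ (α + β) * ((g3 + g1) / 2 + (g4 + g2) / 2) := by gcongr
      _ ≤ _ := by gcongr
  have h4 : α ^ 2 * ‖u‖ ^ 2 ≤ 4 * x ^ 2 * g3 := by gcongr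
  have h5 : β ^ 2 * ‖u‖ ^ 2 ≤ 4 * x ^ 2 * g3 := by gcongr
  have h6 : α ^ 2 * ‖v‖ ^ 2 ≤ 4 * x ^ 2 * g4 := by gcongr
  have h7 : β ^ 2 * ‖v‖ ^ 2 ≤ 4 * x ^ 2 * g4 := by gcongr
  have h8 : 0 ≤ x ^ 2 * g1 := by positivity
  have h9 : 0 ≤ x ^ 2 * g2 := by positivity
  nlinarith

/-- If `F` and `c` are invariant under the flow, then `log S_k` is at least `r / 2` away from `c` on a
fixed proportion of `F`, up to the event that `flowSize` is large: the flow moves `log S_k` at unit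
speed, and changes the density by a bounded factor for times up to `r`. -/
theorem isoGauss_le_of_invariant (hM : 0 < M) (h : (κ' : ℕ) = κ + 1) (lam : ℝ) {r γ : ℝ}
    (hr : 0 < r) (hr1 : r ≤ 1) (hγ : M * r ^ 2 * γ ≤ 1) {F : Set (blockTridiag N M)}
    (hF : MeasurableSet F) (hFinv : ∀ x a, scaleFlow κ κ' lam x a ∈ F ↔ a ∈ F)
    {c : blockTridiag N M → ℝ} (hc : Measurable c)
    (hcinv : ∀ x a, c (scaleFlow κ κ' lam x a) = c a) :
    isoGauss (blockTridiag N M) ((M : ℝ) / 4) F ≤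
      isoGauss (blockTridiag N M) ((M : ℝ) / 4) {a | γ < flowSize κ κ' lam a} +
      ENNReal.ofReal (1 + 2 * Real.exp 3) * isoGauss (blockTridiag N M) ((M : ℝ) / 4)
        (F ∩ {a | r / 2 ≤ |Real.log (S lam a (κ + 1)) - c a|}) := by
  have hM' : (0 : ℝ) < M := by exact_mod_cast hM
  set b : ℝ := (M : ℝ) / 4 with hbdef
  have hb : 0 < b := by positivity
  set μ := isoGauss (blockTridiag N M) b with hμ
  set X : blockTridiag N M → ℝ := fun a => Real.log (S lam a (κ + 1)) with hX
  have hXm : Measurable X := Real.measurable_log.comp (measurable_S lam (κ + 1))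
  set J : Set (blockTridiag N M) := {a | r / 2 ≤ |X a - c a|} with hJ
  have hJm : MeasurableSet J := measurableSet_le measurable_const (hXm.sub hc).abs
  have hGm : Measurable fun a : blockTridiag N M => flowSize κ κ' lam a :=
    (((measurable_frobSq (measurable_D lam _)).add (measurable_frobSq (measurable_Y lam _))).add
      (measurable_frobSq (measurable_block _ _))).add (measurable_frobSq (measurable_block _ _))
  set S' : Set (blockTridiag N M) := (F ∩ Jᶜ) ∩ {a | flowSize κ κ' lam a ≤ γ} with hS'
  have hS'm : MeasurableSet S' := (hF.inter hJm.compl).inter (measurableSet_le hGm measurable_const)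
  have hdet := ae_det_D_ne_zero (M := M) κ lam b
  -- a point moved by `± r` to a distance less than `r / 2` from `c` was at least `r / 2` away from it
  have hpre : ∀ x, |x| = r → μ (scaleFlow κ κ' lam x ⁻¹' S') ≤ μ (F ∩ J) := by
    intro x hx
    refine measure_mono_ae ?_
    filter_upwards [hdet] with a ha hmem
    have hS := S_pos_of_det hM ha
    obtain ⟨⟨h1, h2⟩, -⟩ := hmem
    refine ⟨(hFinv x a).1 h1, ?_⟩
    rw [hJ, Set.mem_compl_iff, Set.mem_ofPred_eq, not_le, hcinv] at h2
    have h3 : X (scaleFlow κ κ' lam x a) = x + X a := by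
      rw [hX]
      dsimp only
      rw [S_scaleFlow h, Real.log_mul (Real.exp_ne_zero x) hS.ne', Real.log_exp]
    rw [h3] at h2
    change r / 2 ≤ |X a - c a|
    have h4 : |x| ≤ |x + X a - c a| + |X a - c a| := by
      calc |x| = |(x + X a - c a) - (X a - c a)| := by congr 1; ring
        _ ≤ _ := abs_sub _ _
    rw [hx] at h4
    linarith
  obtain ⟨κ₀, h0, h0', hmap⟩ := map_scaleFlow (M := M) h lam r
  have hflow : μ S' ≤ ENNReal.ofReal (Real.exp 3) *
      (μ (scaleFlow κ κ' lam r ⁻¹' S') + μ (scaleFlow κ κ' lam (-r) ⁻¹' S')) := by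
    refine measure_le_of_flow (w := fun a : blockTridiag N M =>
      (∫ x : blockTridiag N M, Real.exp (-b * ‖x‖ ^ 2))⁻¹ * Real.exp (-b * ‖a‖ ^ 2))
      ((Real.measurable_exp.comp ((measurable_norm.pow_const 2).const_mul _)).const_mul _)
      (fun a => mul_nonneg (inv_nonneg.2 (integral_gauss_pos hb).le) (Real.exp_nonneg _))
      (measurable_scaleFlow κ κ' lam r) (measurable_scaleFlow κ κ' lam (-r))
      (scaleFlow_neg_scaleFlow h lam r)
      (fun a => by simpa using scaleFlow_neg_scaleFlow h lam (-r) a) h0 h0' hmap hS'm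
      (Real.exp_nonneg 3) fun a ha => ?_
    have hn := norm_sq_scaleFlow_le κ κ' lam (x := r) (by rwa [abs_of_pos hr]) a
    have hg : flowSize κ κ' lam a ≤ γ := ha.2
    have hbr : b * (r ^ 2 * flowSize κ κ' lam a) ≤ 1 / 4 := by
      calc b * (r ^ 2 * flowSize κ κ' lam a) ≤ b * (r ^ 2 * γ) := by gcongr
        _ = M * r ^ 2 * γ / 4 := by rw [hbdef]; ring
        _ ≤ 1 / 4 := by gcongr
    have hexp : Real.exp (-b * ‖a‖ ^ 2) ^ 2 ≤ Real.exp 3 ^ 2 *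
        (Real.exp (-b * ‖scaleFlow κ κ' lam r a‖ ^ 2) *
          Real.exp (-b * ‖scaleFlow κ κ' lam (-r) a‖ ^ 2)) := by
      simp only [← Real.exp_nat_mul, ← Real.exp_add]
      refine Real.exp_le_exp.2 ?_
      have := mul_le_mul_of_nonneg_left hn hb.le
      push_cast
      nlinarith
    have hZ : 0 ≤ ((∫ x : blockTridiag N M, Real.exp (-b * ‖x‖ ^ 2))⁻¹) ^ 2 := sq_nonneg _
    calc _ = ((∫ x : blockTridiag N M, Real.exp (-b * ‖x‖ ^ 2))⁻¹) ^ 2 *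
          Real.exp (-b * ‖a‖ ^ 2) ^ 2 := by ring
      _ ≤ _ := mul_le_mul_of_nonneg_left hexp hZ
      _ = _ := by ring
  have hcov : F ⊆ ({a | γ < flowSize κ κ' lam a} ∪ (F ∩ J)) ∪ S' := by
    intro a ha
    by_cases h1 : γ < flowSize κ κ' lam a
    · exact Or.inl (Or.inl h1)
    by_cases h2 : a ∈ J
    · exact Or.inl (Or.inr ⟨ha, h2⟩)
    · exact Or.inr ⟨⟨ha, h2⟩, not_lt.1 h1⟩
  calc μ F ≤ μ {a | γ < flowSize κ κ' lam a} + μ (F ∩ J) + μ S' :=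
        (measure_mono hcov).trans ((measure_union_le _ _).trans
          (add_le_add (measure_union_le _ _) le_rfl))
    _ ≤ μ {a | γ < flowSize κ κ' lam a} + μ (F ∩ J) +
        ENNReal.ofReal (Real.exp 3) * (μ (F ∩ J) + μ (F ∩ J)) := by
        refine add_le_add le_rfl (hflow.trans (mul_le_mul' le_rfl (add_le_add
          (hpre r (abs_of_pos hr)) (hpre (-r) (by rw [abs_neg, abs_of_pos hr])))))
    _ = _ := by
        rw [ENNReal.ofReal_add (by norm_num) (by positivity), ENNReal.ofReal_mul (by norm_num),
          ENNReal.ofReal_one, ENNReal.ofReal_ofNat]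
        ring

end ScalingFlow

/-! ### The conditional variance of `log S_k` -/

section ConditionalVariance

/-- Where the conditional variance is small, the variable is close to its conditional mean with
high probability. -/
theorem measure_condVar_lt_inter_le {Ω : Type*} {m m₀ : MeasurableSpace Ω} {P : Measure Ω}
    [IsProbabilityMeasure P] (hm : m ≤ m₀) {X : Ω → ℝ} (hX : MemLp X 2 P) {δ r : ℝ} (hδ : 0 < δ)
    (hr : 0 < r) : P ({ω | condVar m X P ω < δ} ∩ {ω | r / 2 ≤ |X ω - (P[X | m]) ω|}) ≤
      ENNReal.ofReal (4 * δ / r ^ 2) := by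
  set s : Set Ω := {ω | condVar m X P ω < δ} with hs
  have hsm : MeasurableSet[m] s := by
    have h1 : StronglyMeasurable[m] (condVar m X P) := stronglyMeasurable_condVar
    exact h1.measurable measurableSet_Iio
  have hi : Integrable ((X - P[X | m]) ^ 2) P := (hX.sub (hX.condExp one_le_two)).integrable_sq
  have h1 := setIntegral_condVar (hm := hm) hi hsm
  have h2 : ∫ ω in s, condVar m X P ω ∂P ≤ δ := by
    calc ∫ ω in s, condVar m X P ω ∂P ≤ ∫ _ω in s, δ ∂P :=
          setIntegral_mono_on integrable_condVar.integrableOn (integrable_const δ).integrableOn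
            (hm _ hsm) fun ω hω => le_of_lt hω
      _ = P.real s * δ := by rw [setIntegral_const, smul_eq_mul]
      _ ≤ 1 * δ := by gcongr; exact measureReal_le_one
      _ = δ := one_mul δ
  have h3 := mul_meas_ge_le_integral_of_nonneg (μ := P.restrict s)
    (Filter.Eventually.of_forall fun ω => sq_nonneg ((X - P[X | m]) ω)) hi.restrict ((r / 2) ^ 2)
  have h4 : P ({ω | condVar m X P ω < δ} ∩ {ω | r / 2 ≤ |X ω - (P[X | m]) ω|}) ≤
      (P.restrict s) {ω | (r / 2) ^ 2 ≤ ((X - P[X | m]) ω) ^ 2} := by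
    rw [Measure.restrict_apply' (hm _ hsm), Set.inter_comm]
    refine measure_mono fun ω hω => ⟨?_, hω.2⟩
    have h5 : r / 2 ≤ |X ω - (P[X | m]) ω| := hω.1
    rw [Set.mem_ofPred_eq, Pi.sub_apply, ← sq_abs (X ω - _)]
    gcongr
  refine h4.trans ?_
  rw [← ofReal_measureReal]
  refine ENNReal.ofReal_le_ofReal ?_
  rw [le_div_iff₀ (by positivity)]
  have h6 := h3.trans (h1.symm.le.trans h2)
  linarith

variable {N M : ℕ} {κ κ' : Fin N}

/-- The conditioning variables `(D_{k-1}, D̄_k, D_{k+1}, B_{k-1}, B_k)` as a function of `A`. They take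
values in plain functions, as matrices carry no global measurable structure, so that `condSigma` is
the σ-algebra they generate. -/
noncomputable def condTuple (lam : ℝ) (k : ℕ) (a : blockTridiag N M) :
    ((((Fin M → Fin M → ℝ) × (Fin M → Fin M → ℝ)) × (Fin M → Fin M → ℝ)) × (Fin M → Fin M → ℝ)) ×
      (Fin M → Fin M → ℝ) :=
  ((((fun i j => D lam a (k - 1) i j, fun i j => Dbar lam a k i j), fun i j => D lam a (k + 1) i j),
    fun i j => B a (k - 1) i j), fun i j => B a k i j)

theorem measurable_condTuple (lam : ℝ) (k : ℕ) :
    Measurable (condTuple (N := N) (M := M) lam k) := by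
  have h : ∀ {X : blockTridiag N M → Matrix (Fin M) (Fin M) ℝ},
      (∀ p q, Measurable fun a => X a p q) → Measurable fun a (i j : Fin M) => X a i j :=
    fun hX => measurable_pi_lambda _ fun p => measurable_pi_lambda _ fun q => hX p q
  refine ((((h (measurable_D lam _)).prodMk (h fun p q => ?_)).prodMk
    (h (measurable_D lam _))).prodMk (h (measurable_B _))).prodMk (h (measurable_B _))
  simp only [Dbar, Matrix.smul_apply, smul_eq_mul]
  exact (measurable_S lam k).inv.mul (measurable_D lam k p q)

theorem condSigma_eq_comap {Ω : Type*} (lam : ℝ) (A : Ω → blockTridiag N M) (k : ℕ) :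
    condSigma lam A k = MeasurableSpace.comap (condTuple lam k ∘ A) inferInstance := by
  simp only [condSigma, sigma, ← MeasurableSpace.comap_prodMk]
  rfl

theorem condTuple_scaleFlow (h : (κ' : ℕ) = κ + 1) (lam x : ℝ) (a : blockTridiag N M) :
    condTuple lam (κ + 1) (scaleFlow κ κ' lam x a) = condTuple lam (κ + 1) a := by
  have h1 := D_scaleFlow_succ h lam x a
  rw [h] at h1
  simp only [condTuple, B_scaleFlow, Dbar_scaleFlow h, h1]
  rw [D_scaleFlow_of_le h lam x a (by omega)]

/-- The conditional variance of `log S_k` is rarely small. It and the conditional mean are functions of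
the conditioning variables, hence invariant under the flow. -/
theorem measure_condVarLogS_lt_le (hM : 0 < M) {κ₀ : Fin N} (h₀ : (κ : ℕ) = κ₀ + 1)
    (h : (κ' : ℕ) = κ + 1) (lam : ℝ) {r γ δ : ℝ} (hr : 0 < r) (hr1 : r ≤ 1)
    (hγ : M * r ^ 2 * γ ≤ 1) (hδ : 0 < δ) {Ω : Type*} [MeasurableSpace Ω] (P : Measure Ω)
    [IsProbabilityMeasure P] {A : Ω → blockTridiag N M} (hA : Measurable A)
    (hlaw : P.map A = law N M) :
    P {ω | condVarLogS P lam A (κ + 1) ω < δ} ≤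
      isoGauss (blockTridiag N M) ((M : ℝ) / 4) {a | γ < flowSize κ κ' lam a} +
        ENNReal.ofReal (1 + 2 * Real.exp 3) * ENNReal.ofReal (4 * δ / r ^ 2) := by
  have hΦ := measurable_condTuple (N := N) (M := M) lam (κ + 1)
  have hcs := condSigma_eq_comap lam A (κ + 1)
  have hm : condSigma lam A (κ + 1) ≤ ‹MeasurableSpace Ω› := by
    rw [hcs]
    exact (hΦ.comp hA).comap_le
  set X : Ω → ℝ := fun ω => Real.log (S lam (A ω) (κ + 1)) with hX
  have hXL : MemLp X 2 P := by
    have h1 := memLp_log_S hM h₀ lam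
    rw [← law_eq_isoGauss, ← hlaw] at h1
    exact h1.comp_of_map hA.aemeasurable
  have hV : StronglyMeasurable[condSigma lam A (κ + 1)] (condVar (condSigma lam A (κ + 1)) X P) :=
    stronglyMeasurable_condVar
  have hE : StronglyMeasurable[condSigma lam A (κ + 1)] (P[X | condSigma lam A (κ + 1)]) :=
    stronglyMeasurable_condExp
  have hmain := measure_condVar_lt_inter_le hm hXL hδ hr
  rw [hcs] at hV hE
  obtain ⟨V₀, hV₀, hVe⟩ := hV.exists_eq_measurable_comp
  obtain ⟨c₀, hc₀, hce⟩ := hE.exists_eq_measurable_comp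
  rw [← hcs] at hVe hce
  set F : Set (blockTridiag N M) := {a | V₀ (condTuple lam (κ + 1) a) < δ} with hF
  have hFm : MeasurableSet F := measurableSet_lt (hV₀.measurable.comp hΦ) measurable_const
  have hcm : Measurable fun a : blockTridiag N M => c₀ (condTuple lam (κ + 1) a) :=
    hc₀.measurable.comp hΦ
  have hflow := isoGauss_le_of_invariant hM h lam hr hr1 hγ hFm
    (fun x a => by rw [hF, Set.mem_ofPred_eq, Set.mem_ofPred_eq, condTuple_scaleFlow h]) hcm
    (fun x a => by rw [condTuple_scaleFlow h])
  have e1 : P {ω | condVarLogS P lam A (κ + 1) ω < δ} =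
      isoGauss (blockTridiag N M) ((M : ℝ) / 4) F := by
    rw [← law_eq_isoGauss, ← hlaw, Measure.map_apply hA hFm]
    rw [condVarLogS, hVe]
    rfl
  have hXm : Measurable fun a : blockTridiag N M => Real.log (S lam a (κ + 1)) :=
    Real.measurable_log.comp (measurable_S lam (κ + 1))
  have e2 : P ({ω | condVar (condSigma lam A (κ + 1)) X P ω < δ} ∩
      {ω | r / 2 ≤ |X ω - (P[X | condSigma lam A (κ + 1)]) ω|}) =
      isoGauss (blockTridiag N M) ((M : ℝ) / 4)
        (F ∩ {a | r / 2 ≤ |Real.log (S lam a (κ + 1)) - c₀ (condTuple lam (κ + 1) a)|}) := by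
    have hJm : MeasurableSet {a : blockTridiag N M |
        r / 2 ≤ |Real.log (S lam a (κ + 1)) - c₀ (condTuple lam (κ + 1) a)|} :=
      measurableSet_le measurable_const (hXm.sub hcm).abs
    rw [← law_eq_isoGauss, ← hlaw, Measure.map_apply hA (hFm.inter hJm), hVe, hce]
    rfl
  rw [e2] at hmain
  rw [e1]
  refine hflow.trans ?_
  gcongr

/-- The three tail bounds combined; `12 = 9 + 1 + 1 + 1`. -/
theorem isoGauss_flowSize_le (hM : 0 < M) {κ₀ : Fin N} (h₀ : (κ : ℕ) = κ₀ + 1)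
    (h : (κ' : ℕ) = κ + 1) (lam : ℝ) {X τ : ℝ} (hX : 0 < X) (hτ : 0 < τ) :
    isoGauss (blockTridiag N M) ((M : ℝ) / 4) {a | 12 * τ < flowSize κ κ' lam a} ≤
      ENNReal.ofReal (6 * M / τ + lam ^ 2 * M / τ +
        2 * (3276800000 * M / X + 404 * X ^ 2 / τ)) := by
  have hM' : (0 : ℝ) < M := by exact_mod_cast hM
  have hsub : {a : blockTridiag N M | 12 * τ < flowSize κ κ' lam a} ⊆
      (({a | 9 * τ ≤ frobSq (D lam a (κ + 1))} ∪ {a | τ ≤ frobSq (Y lam a (κ + 1))}) ∪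
        {a | τ ≤ frobSq (block a (κ + 1) (κ + 1))}) ∪
          {a | τ ≤ frobSq (block a (κ' + 1) (κ' + 1))} := by
    intro a ha
    rw [Set.mem_ofPred_eq, flowSize] at ha
    simp only [Set.mem_union, Set.mem_ofPred_eq]
    by_contra! hcon
    linarith [hcon.1.1.1, hcon.1.1.2, hcon.1.2, hcon.2]
  refine (measure_mono hsub).trans ((measure_union_le _ _).trans ((add_le_add
    ((measure_union_le _ _).trans (add_le_add ((measure_union_le _ _).trans (add_le_add
      (isoGauss_frobSq_D_ge_le hM h₀ lam hX hτ) (isoGauss_frobSq_Y_ge_le hM h lam hX hτ)))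
      (isoGauss_frobSq_block_ge_le hM κ hτ))) (isoGauss_frobSq_block_ge_le hM κ' hτ)).trans ?_))
  rw [← ENNReal.ofReal_add (by positivity) (by positivity), ← ENNReal.ofReal_add (by positivity)
    (by positivity), ← ENNReal.ofReal_add (by positivity) (by positivity)]
  refine ENNReal.ofReal_le_ofReal (le_of_eq ?_)
  ring

/-- The tail bounds with the powers of `M` chosen: `X = M^{1 + η}`, `τ = M^{2 + 4 η} / 12`,
`r² = M^{-3 - 4 η}` and `δ = M^{-3 - 8 η}`. -/
theorem measure_condVarLogS_lt_rpow_le (hM : 0 < M) {κ₀ : Fin N} (h₀ : (κ : ℕ) = κ₀ + 1)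
    (h : (κ' : ℕ) = κ + 1) {lam L η : ℝ} (hlam : lam ^ 2 ≤ L) (hη : 0 < η)
    {Ω : Type*} [MeasurableSpace Ω] (P : Measure Ω) [IsProbabilityMeasure P]
    {A : Ω → blockTridiag N M} (hA : Measurable A) (hlaw : P.map A = law N M) :
    P.real {ω | condVarLogS P lam A (κ + 1) ω < (M : ℝ) ^ (-3 - 8 * η)} ≤
      (72 + 12 * L + 2 * (3276800000 + 404 * 12) + 4 * (1 + 2 * Real.exp 3)) * (M : ℝ) ^ (-η) := by
  have hM' : (0 : ℝ) < M := by exact_mod_cast hM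
  have hM1 : (1 : ℝ) ≤ M := by exact_mod_cast hM
  have hL : 0 ≤ L := (sq_nonneg lam).trans hlam
  set u : ℝ := (M : ℝ) ^ η with hu
  have hu0 : 0 < u := Real.rpow_pos_of_pos hM' _
  have hu1 : 1 ≤ u := Real.one_le_rpow hM1 hη.le
  have hun : ∀ n : ℕ, (M : ℝ) ^ (n * η) = u ^ n := by
    intro n
    rw [mul_comm, Real.rpow_mul hM'.le, Real.rpow_natCast]
  have hδ : (M : ℝ) ^ (-3 - 8 * η) = 1 / (M ^ 3 * u ^ 8) := by
    rw [Real.rpow_sub hM', Real.rpow_neg hM'.le, show (8 : ℝ) = ((8 : ℕ) : ℝ) by norm_num, hun,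
      show (3 : ℝ) = ((3 : ℕ) : ℝ) by norm_num, Real.rpow_natCast]
    field_simp
  have hη' : (M : ℝ) ^ (-η) = 1 / u := by rw [Real.rpow_neg hM'.le, one_div]
  set r : ℝ := Real.sqrt (1 / (M ^ 3 * u ^ 4)) with hr
  have hr2 : r ^ 2 = 1 / (M ^ 3 * u ^ 4) := Real.sq_sqrt (by positivity)
  have hr0 : 0 < r := Real.sqrt_pos.2 (by positivity)
  have hr1 : r ≤ 1 := by
    refine Real.sqrt_le_iff.2 ⟨zero_le_one, ?_⟩
    rw [one_pow, div_le_one (by positivity)]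
    exact one_le_mul_of_one_le_of_one_le (one_le_pow₀ hM1) (one_le_pow₀ hu1)
  set τ : ℝ := M ^ 2 * u ^ 4 / 12 with hτ
  have hτ0 : 0 < τ := by positivity
  have h1 := measure_condVarLogS_lt_le hM h₀ h lam (γ := 12 * τ) (δ := (M : ℝ) ^ (-3 - 8 * η))
    hr0 hr1 (by rw [hr2, hτ]; apply le_of_eq; field_simp) (Real.rpow_pos_of_pos hM' _) P hA hlaw
  have h2 := isoGauss_flowSize_le hM h₀ h lam (X := M * u) (by positivity) hτ0
  have h3 := h1.trans (add_le_add h2 le_rfl)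
  rw [← ENNReal.ofReal_mul (by positivity), ← ENNReal.ofReal_add (by positivity)
    (mul_nonneg (by positivity) (div_nonneg (mul_nonneg (by norm_num)
      (Real.rpow_nonneg hM'.le _)) (sq_nonneg _)))] at h3
  have h4 := ENNReal.toReal_le_of_le_ofReal (add_nonneg (by positivity)
    (mul_nonneg (by positivity) (div_nonneg (mul_nonneg (by norm_num)
      (Real.rpow_nonneg hM'.le _)) (sq_nonneg _)))) h3
  refine h4.trans ?_
  rw [hη', hδ, hr2, hτ]
  have hsplit : ∀ x y z w t : ℝ, (x + y + z + w) * t = x * t + y * t + z * t + w * t := by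
    intros; ring
  rw [hsplit]
  have hp : 1 / (M * u ^ 4) ≤ 1 / u := by
    gcongr
    calc u = 1 * u ^ 1 := by ring
      _ ≤ M * u ^ 4 := by gcongr; norm_num
  have hp2 : 1 / u ^ 2 ≤ 1 / u := by
    gcongr; exact le_self_pow₀ hu1 (by norm_num)
  have hp4 : 1 / u ^ 4 ≤ 1 / u := by
    gcongr; exact le_self_pow₀ hu1 (by norm_num)
  refine add_le_add (add_le_add (add_le_add ?_ ?_) ?_) ?_
  · calc _ = 72 * (1 / (M * u ^ 4)) := by field_simp; norm_num
      _ ≤ _ := by gcongr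
  · calc _ = 12 * lam ^ 2 * (1 / (M * u ^ 4)) := by field_simp
      _ ≤ _ := by gcongr
  · calc _ = 2 * (3276800000 * (1 / u) + 404 * 12 * (1 / u ^ 2)) := by field_simp
      _ ≤ 2 * (3276800000 * (1 / u) + 404 * 12 * (1 / u)) := by gcongr
      _ = _ := by ring
  · calc _ = 4 * (1 + 2 * Real.exp 3) * (1 / u ^ 4) := by field_simp
      _ ≤ _ := by gcongr

end ConditionalVariance

end BandMatrix

theorem lemma3p6 (ε : ℝ) (hε : 0 < ε) :
    ∃ C c : ℝ, 1 < C ∧ 0 < c ∧ c < 1 ∧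
      ∀ (lam : ℝ) (N M : ℕ), |lam| < ε⁻¹ → C ≤ (M : ℝ) →
      ∀ {Ω : Type*} [MeasurableSpace Ω] (P : Measure Ω) [IsProbabilityMeasure P]
        (A : Ω → BandMatrix.blockTridiag N M), Measurable A → P.map A = BandMatrix.law N M →
        (∀ k : ℕ, 1 < k → k < N →
          1 - (M : ℝ) ^ (-c) ≤
            P.real {ω | (M : ℝ) ^ (-3 - ε) ≤ BandMatrix.condVarLogS P lam A k ω}) ∧
        (∀ k : ℕ, 1 < k → k < N →
          (M : ℝ) ^ (-3 - ε) ≤ ∫ ω, BandMatrix.condVarLogS P lam A k ω ∂P) := by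
  set K : ℝ := 72 + 12 * (ε⁻¹) ^ 2 + 2 * (3276800000 + 404 * 12) + 4 * (1 + 2 * Real.exp 3) with hK
  have hK1 : 2 ≤ K := by
    have h1 : 0 ≤ (ε⁻¹) ^ 2 := sq_nonneg _
    have h2 := Real.exp_pos 3
    rw [hK]; linarith
  set c : ℝ := min (ε / 32) (1 / 2) with hc
  have hc0 : 0 < c := lt_min (by positivity) (by norm_num)
  -- `K * M ^ (-ε / 16) ≤ M ^ (-c)`, as `2 * c ≤ ε / 16` and `K ≤ M ^ c`
  refine ⟨K ^ (1 / c), c, Real.one_lt_rpow (by linarith) (by positivity), hc0,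
    (min_le_right _ _).trans_lt (by norm_num), fun lam N M hlam hCM Ω _ P _ A hA hlaw => ?_⟩
  have hCp : 1 < K ^ (1 / c) := Real.one_lt_rpow (by linarith) (by positivity)
  have hM1 : (1 : ℝ) < M := hCp.trans_le hCM
  have hM0 : (0 : ℝ) < M := by linarith
  have hM : 0 < M := by exact_mod_cast hM0
  have hKM : K ≤ (M : ℝ) ^ c := by
    calc K = (K ^ (1 / c)) ^ c := by
          rw [← Real.rpow_mul (by linarith), one_div, inv_mul_cancel₀ hc0.ne', Real.rpow_one]
      _ ≤ (M : ℝ) ^ c := Real.rpow_le_rpow (by linarith) hCM hc0.le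
  have hMc : 0 < (M : ℝ) ^ c := Real.rpow_pos_of_pos hM0 _
  have hMcn : (M : ℝ) ^ (-c) ≤ 1 / 2 := by
    rw [Real.rpow_neg hM0.le, ← one_div]
    exact one_div_le_one_div_of_le (by norm_num) (hK1.trans hKM)
  have hcε : c ≤ ε / 32 := min_le_left _ _
  set δ : ℝ := (M : ℝ) ^ (-3 - 8 * (ε / 16)) with hδ
  have hδ0 : 0 < δ := Real.rpow_pos_of_pos hM0 _
  have hδε : (M : ℝ) ^ (-3 - ε) ≤ δ * (1 / 2) := by
    calc (M : ℝ) ^ (-3 - ε) = δ * (M : ℝ) ^ (-(ε / 2)) := by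
          rw [hδ, ← Real.rpow_add hM0]; congr 1; ring
      _ ≤ δ * (M : ℝ) ^ (-c) := by
          gcongr
          · exact hM1.le
          · linarith
      _ ≤ δ * (1 / 2) := by gcongr
  have hkey : ∀ k : ℕ, 1 < k → k < N →
      P.real {ω | BandMatrix.condVarLogS P lam A k ω < δ} ≤ (M : ℝ) ^ (-c) := by
    intro k hk hkN
    obtain ⟨j, rfl⟩ : ∃ j, k = j + 1 + 1 := ⟨k - 2, by omega⟩
    have hlam2 : lam ^ 2 ≤ (ε⁻¹) ^ 2 := by
      rw [← sq_abs]
      gcongr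
    have h1 := BandMatrix.measure_condVarLogS_lt_rpow_le hM (κ₀ := (⟨j, by omega⟩ : Fin N))
      (κ := ⟨j + 1, by omega⟩) (κ' := ⟨j + 1 + 1, by omega⟩) rfl rfl hlam2
      (η := ε / 16) (by positivity) P hA hlaw
    refine h1.trans ?_
    calc K * (M : ℝ) ^ (-(ε / 16)) ≤ (M : ℝ) ^ c * (M : ℝ) ^ (-(2 * c)) := by
          gcongr
          · exact hM1.le
          · linarith
      _ = (M : ℝ) ^ (-c) := by
          rw [← Real.rpow_add hM0]; congr 1; ring
  have hVm : ∀ k : ℕ, Measurable (BandMatrix.condVarLogS P lam A k) := by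
    intro k
    have hm : BandMatrix.condSigma lam A k ≤ ‹MeasurableSpace Ω› := by
      rw [BandMatrix.condSigma_eq_comap]
      exact ((BandMatrix.measurable_condTuple lam k).comp hA).comap_le
    have h1 : StronglyMeasurable[BandMatrix.condSigma lam A k] (BandMatrix.condVarLogS P lam A k) :=
      stronglyMeasurable_condVar
    exact (h1.mono hm).measurable
  have hcompl : ∀ k : ℕ, 1 < k → k < N →
      1 - (M : ℝ) ^ (-c) ≤ P.real {ω | δ ≤ BandMatrix.condVarLogS P lam A k ω} := by
    intro k hk hkN
    have h1 := hkey k hk hkN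
    have h2 : {ω | δ ≤ BandMatrix.condVarLogS P lam A k ω} =
        {ω | BandMatrix.condVarLogS P lam A k ω < δ}ᶜ := by
      ext ω
      rw [Set.mem_compl_iff, Set.mem_ofPred_eq, Set.mem_ofPred_eq, not_lt]
    rw [h2, probReal_compl_eq_one_sub (measurableSet_lt (hVm k) measurable_const)]
    linarith
  refine ⟨fun k hk hkN => ?_, fun k hk hkN => ?_⟩
  · refine (hcompl k hk hkN).trans (measureReal_mono fun ω hω => ?_)
    exact (hδε.trans (by linarith)).trans hω
  · have hV0 : 0 ≤ᵐ[P] BandMatrix.condVarLogS P lam A k :=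
      condExp_nonneg (Filter.Eventually.of_forall fun ω => sq_nonneg _)
    have h1 := mul_meas_ge_le_integral_of_nonneg hV0 integrable_condVar δ
    have h2 := hcompl k hk hkN
    calc (M : ℝ) ^ (-3 - ε) ≤ δ * (1 / 2) := hδε
      _ ≤ δ * P.real {ω | δ ≤ BandMatrix.condVarLogS P lam A k ω} := by gcongr; linarith
      _ ≤ _ := h1
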